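/- **Setting.** Let $d\in\{2,3\}$, $T>0$, and let $\mathcal P$ be a conforming partition of a bounded open polyhedral set $\Omega\subset\mathbb R^d$ into finitely many closed nondegenerate simplices and/or affine quadrilaterals/hexahedra (parallelograms in dimension 2, parallelepipeds in dimension 3): the elements have pairwise disjoint interiors, two elements meet in the empty set or in a common face, and $\Omega$ is the interior of their union (this covers every bounded polyhedral Lipschitz domain). For $k\ge 1$ let $V_{\mathcal P}$ be the space of functions in $C^0(\overline\Omega)\cap H^1_0(\Omega)$ whose restriction to each $K\in\mathcal P$ lies in $\mathbb P_k(K)$ if $K$ is a simplex, and in the affinely mapped space $\mathbb Q_k(K)$ otherwise. Let $x_1,\dots,x_M$ be the (equispaced) Lagrange nodes of degree $k$ of $\mathcal P$ lying in $\Omega$, and $\phi_1,\dots,\phi_M\in V_{\mathcal P}$ the associated nodal basis. Let $\varepsilon>0$, $\mu\ge 0$, $\gamma\ge 0$, $\alpha>0$, $\theta\in[\tfrac12,1]$; for each $t\in[0,T]$ let $\kappa(t)>0$, $f(t)\in L^2(\Omega)$, and let $\beta(t)\in W^{1,\infty}(\Omega)^d$ (continuous on $\overline\Omega$) satisfy $\operatorname{div}\beta(t)=0$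 in $\Omega$. Let $N\ge1$, $\Delta t=T/N$, $t_n=n\Delta t$. For $v_h\in V_{\mathcal P}$ and at the time level $t_n$ put $$v_h^+=\sum_{i=1}^M\max\{0,\min\{v_h(x_i),\kappa(t_n)\}\}\,\phi_i,\qquad v_h^-=v_h-v_h^+,\qquad V_{\mathcal P}^+=\{v_h\in V_{\mathcal P}: v_h(x_i)\in[0,\kappa(t_n)]\ \forall i\}.$$ Let $(\cdot,\cdot)_\Omega$ be the $L^2(\Omega)$ inner product and, at time $t$, let $$a_J(w,v)=\varepsilon(\nabla w,\nabla v)_\Omega+(\beta(t)\cdot\nabla w,v)_\Omega+\mu(w,v)_\Omega+J(w,v),\qquad J(w,v)=\gamma\sum_F\int_F\|\beta(t)\|_{0,\infty,F}\,h_F^2\,[\![\nabla w]\!]\cdot[\![\nabla v]\!]\,ds,$$ where $F$ runs over the internal facets, $h_F=\operatorname{diam}F$, $[\![\cdot]\!]$ is the jump across $F$, and $\|\cdot\|_{0,\infty,G}$ is the $L^\infty(G)$ norm. Let $$s(v,w)=\alpha\sum_{i=1}^M\Big(\varepsilon\,\mathfrak h(x_i)^{d-2}+\|\beta(t_n)\|_{0,\infty,\omega_i}\mathfrak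 h(x_i)^{d-1}+\big(\tfrac1{\Delta t}+\mu\big)\mathfrak h(x_i)^d\Big)v(x_i)w(x_i),$$ where $\omega_i$ is the union of the elements containing $x_i$, and $\mathfrak h$ is the continuous element-wise linear (multilinear on quadrilaterals/hexahedra) function whose value at each mesh vertex is the mean of the diameters of the elements containing that vertex. Fix $n\in\{1,\dots,N\}$ and an arbitrary previous iterate $u_h^{n-1}\in V_{\mathcal P}$. Let $(u_h^{n-1})^+$ be formed with $\kappa(t_{n-1})$, let $f^{n-1+\theta}=\theta f(t_n)+(1-\theta)f(t_{n-1})$, and let $$F^n(v)=\Delta t\,(f^{n-1+\theta},v)_\Omega-\Delta t(1-\theta)\,a_J((u_h^{n-1})^+,v)+((u_h^{n-1})^+,v)_\Omega,$$ with $a_J$ taken at time $t_{n-1}$; below, $a_J$ is taken at time $t_n$. Consider the problem: find $u_h^n\in V_{\mathcal P}$ such that $$((u_h^n)^+,v)_\Omega+\Delta t\,\theta\,a_J((u_h^n)^+,v)+\Delta t\,s((u_h^n)^-,v)=F^n(v)\qquad\forall v\in V_{\mathcal P}.\tag{1}$$ **Theorem.** (a) Problem (1) has a solution $u_h^n\in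 V_{\mathcal P}$. (b) For every solution $u_h^n$ of (1), $(u_h^n)^+\in V_{\mathcal P}^+$ and $$((u_h^n)^+,v-(u_h^n)^+)_\Omega+\Delta t\,\theta\,a_J((u_h^n)^+,v-(u_h^n)^+)\ \ge\ F^n(v-(u_h^n)^+)\qquad\forall v\in V_{\mathcal P}^+.$$ (c) For every solution $u_h^n$ of (1), $(u_h^n)^-$ is the unique $z\in V_{\mathcal P}$ with $$\Delta t\,s(z,v)=F^n(v)-\big[((u_h^n)^+,v)_\Omega+\Delta t\,\theta\,a_J((u_h^n)^+,v)\big]\qquad\forall v\in V_{\mathcal P}.$$ (d) The solution of (1) is unique. -/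

import Mathlib

open MeasureTheory Set
open scoped MeasureTheory ContDiff ENNReal

noncomputable section

namespace BPFEM

/-- The Euclidean space `ℝ^d`. -/
abbrev Space (d : ℕ) := EuclideanSpace ℝ (Fin d)

/-! ### Function spaces -/

/-- Smooth functions with compact support contained in `Ω`. -/
def IsTestFunction {d : ℕ} (Ω : Set (Space d)) (φ : Space d → ℝ) : Prop :=
  ContDiff ℝ ∞ φ ∧ HasCompactSupport φ ∧ tsupport φ ⊆ Ω

/-- `g` is a weak partial derivative of `v` in the `j`-th coordinate direction on `Ω`. -/
def IsWeakPartial {d : ℕ} (Ω : Set (Space d)) (j : Fin d) (v g : Space d → ℝ) : Prop :=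
  ∀ φ : Space d → ℝ, IsTestFunction Ω φ →
    ∫ x in Ω, v x * fderiv ℝ φ x (EuclideanSpace.single j 1) = -∫ x in Ω, g x * φ x

/-- The Sobolev space `W^{1,p}(Ω)`; the case `p = 2` is `H^1(Ω)`. -/
def MemW1 {d : ℕ} (Ω : Set (Space d)) (p : ℝ≥0∞) (v : Space d → ℝ) : Prop :=
  MemLp v p (volume.restrict Ω) ∧
    ∀ j : Fin d, ∃ g : Space d → ℝ, MemLp g p (volume.restrict Ω) ∧ IsWeakPartial Ω j v g

/-- `div b = 0` in `Ω`, in the sense of distributions. -/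
def IsSolenoidal {d : ℕ} (Ω : Set (Space d)) (b : Space d → Space d) : Prop :=
  ∀ φ : Space d → ℝ, IsTestFunction Ω φ → ∫ x in Ω, inner ℝ (b x) (gradient φ x) = 0

/-- A solenoidal field of class `W^{1,∞}(Ω)^d`, given by its continuous representative on the
closure of `Ω` (so that it has values on the facets of a mesh). -/
def IsConvection {d : ℕ} (Ω : Set (Space d)) (b : Space d → Space d) : Prop :=
  ContinuousOn b (closure Ω) ∧ (∀ i : Fin d, MemW1 Ω ∞ (fun x => b x i)) ∧ IsSolenoidal Ω b

/-! ### Elements -/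

/-- An element is a simplex or a parallelotope (affine quadrilateral / hexahedron). -/
inductive CellKind
  | simplex
  | parallelotope

/-- The reference elements: the unit simplex and the unit cube. -/
def CellKind.ref (d : ℕ) : CellKind → Set (Fin d → ℝ)
  | .simplex => {y | (∀ j, 0 ≤ y j) ∧ ∑ j, y j ≤ 1}
  | .parallelotope => {y | ∀ j, 0 ≤ y j ∧ y j ≤ 1}

/-- A nondegenerate element of `ℝ^d`: the image of a reference element under the affine bijection
`y ↦ origin + ∑ j, y j • edge j`. -/
structure Cell (d : ℕ) where
  kind : CellKind
  origin : Space d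
  edge : Fin d → Space d
  indep : LinearIndependent ℝ edge

namespace Cell

variable {d : ℕ}

/-- The affine map from the reference element. -/
def map (K : Cell d) (y : Fin d → ℝ) : Space d := K.origin + ∑ j, y j • K.edge j

/-- The element as a (closed) set of points. -/
def carrier (K : Cell d) : Set (Space d) := K.map '' K.kind.ref d

/-- `v` restricted to `K` belongs to `ℙ_k(K)` (total degree at most `k`) if `K` is a simplex, and
to the mapped space `ℚ_k(K)` (degree at most `k` in each variable) if `K` is a parallelotope. -/
def IsShape (K : Cell d) (k : ℕ) (v : Space d → ℝ) : Prop :=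
  ∃ q : MvPolynomial (Fin d) ℝ,
    (match K.kind with
      | .simplex => q.totalDegree ≤ k
      | .parallelotope => ∀ j, q.degreeOf j ≤ k) ∧
    ∀ y ∈ K.kind.ref d, v (K.map y) = MvPolynomial.eval y q

/-- The usual (equispaced) Lagrange nodes of degree `k` of `K`: the images of the points of the
reference element all of whose coordinates are of the form `a / k`, `a ∈ {0, …, k}`. -/
def nodes (K : Cell d) (k : ℕ) : Set (Space d) :=
  {x | ∃ a : Fin d → ℕ, (fun j => (a j : ℝ) / k) ∈ K.kind.ref d ∧
    K.map (fun j => (a j : ℝ) / k) = x}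

/-- Value, at the point with reference coordinates `y`, of the element-wise linear (on a
parallelotope: multilinear) function that takes the values of `H` at the vertices of `K`. -/
def vertexInterp (K : Cell d) (H : Space d → ℝ) (y : Fin d → ℝ) : ℝ :=
  match K.kind with
  | .simplex => (1 - ∑ j, y j) * H K.origin + ∑ j, y j * H (K.origin + K.edge j)
  | .parallelotope => ∑ S : Finset (Fin d),
      ((∏ j ∈ S, y j) * ∏ j ∈ Sᶜ, (1 - y j)) * H (K.origin + ∑ j ∈ S, K.edge j)

end Cell

/-! ### Meshes -/

/-- A conforming partition of `Ω` into simplices and/or parallelotopes: the elements have pairwise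
disjoint interiors, the intersection of any two of them is empty or a common face of both (a face
of a convex polytope being a set where a linear functional attains its maximum over it), and `Ω` is
the interior of their union. -/
structure Mesh {d : ℕ} (Ω : Set (Space d)) where
  cells : Finset (Cell d)
  disjoint : ∀ K ∈ cells, ∀ K' ∈ cells, K ≠ K' → Disjoint (interior K.carrier) (interior K'.carrier)
  conforming : ∀ K ∈ cells, ∀ K' ∈ cells, IsExposed ℝ K.carrier (K.carrier ∩ K'.carrier)
  interior_eq : interior (⋃ K ∈ cells, K.carrier) = Ω

namespace Mesh

variable {d : ℕ} {Ω : Set (Space d)}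

/-- The elements containing a given point. -/
def cellsAt (P : Mesh Ω) (x : Space d) : Finset (Cell d) :=
  open Classical in P.cells.filter (fun K => x ∈ K.carrier)

/-- The arithmetic mean of the diameters `h_K` of the elements containing `x`. -/
def meanDiam (P : Mesh Ω) (x : Space d) : ℝ :=
  (∑ K ∈ P.cellsAt x, Metric.diam K.carrier) / (P.cellsAt x).card

/-- The mesh function: the continuous element-wise (multi)linear function whose value at each vertex
of the mesh is the mean of the diameters of the elements that contain this vertex. (The value
at `x` may be computed in any element that contains `x`.) -/
def meshFun (P : Mesh Ω) (x : Space d) : ℝ :=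
  Classical.epsilon fun r : ℝ =>
    ∃ K ∈ P.cells, ∃ y ∈ K.kind.ref d, K.map y = x ∧ r = K.vertexInterp P.meanDiam y

/-- The patch `ω` of a node: the union of the elements that contain it. -/
def patch (P : Mesh Ω) (x : Space d) : Set (Space d) := ⋃ K ∈ P.cellsAt x, K.carrier

/-- The ordered pairs of distinct elements whose intersection is a facet (a common face of dimension
`d - 1`). Every internal facet of the mesh comes from exactly two such pairs, `(K, K')` and
`(K', K)`. -/
def facetPairs (P : Mesh Ω) : Finset (Cell d × Cell d) :=
  open Classical in (P.cells ×ˢ P.cells).filter fun KK =>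
    KK.1 ≠ KK.2 ∧ Module.finrank ℝ (vectorSpan ℝ (KK.1.carrier ∩ KK.2.carrier)) = d - 1

/-- The finite element space `V_P` of degree `k`: functions that are continuous on the closure of
`Ω`, are element-wise in `ℙ_k(K)` / `ℚ_k(K)`, and belong to `H^1_0(Ω)`, that is, to `H^1(Ω)` with
zero boundary values. Functions on the closure of `Ω` are identified with their extensions
by zero to the whole space. -/
def space (P : Mesh Ω) (k : ℕ) : Set (Space d → ℝ) :=
  {v | ContinuousOn v (closure Ω) ∧ (∀ K ∈ P.cells, K.IsShape k v) ∧
    MemW1 Ω 2 v ∧ (∀ x ∈ frontier Ω, v x = 0) ∧ ∀ x ∉ closure Ω, v x = 0}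

/-- The internal Lagrange nodes of degree `k` of the mesh. -/
def nodeSet (P : Mesh Ω) (k : ℕ) : Set (Space d) := (⋃ K ∈ P.cells, K.nodes k) ∩ Ω

/-- The Lagrange basis function attached to the internal node `x`: the element of `V_P` that is `1`
at `x` and `0` at all other internal nodes. -/
def basisFun (P : Mesh Ω) (k : ℕ) (x : Space d) : Space d → ℝ :=
  Classical.epsilon fun φ : Space d → ℝ =>
    φ ∈ P.space k ∧ φ x = 1 ∧ ∀ y ∈ P.nodeSet k, y ≠ x → φ y = 0

end Mesh

/-- If the degree is positive, an element has finitely many nodes. -/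
theorem Cell.finite_nodes {d : ℕ} (K : Cell d) {k : ℕ} (hk : 1 ≤ k) : (K.nodes k).Finite := by
  have hk0 : (0 : ℝ) < k := by exact_mod_cast hk
  have hfin : (Set.pi Set.univ fun _ : Fin d => Set.Iic k).Finite :=
    Set.Finite.pi fun _ => Set.finite_Iic k
  refine (hfin.image fun a : Fin d → ℕ => K.map fun j => (a j : ℝ) / k).subset ?_
  rintro x ⟨a, ha, rfl⟩
  refine ⟨a, ?_, rfl⟩
  have key : ∀ j, (a j : ℝ) / k ≤ 1 := by
    intro j
    cases hkind : K.kind with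
    | simplex =>
      rw [hkind] at ha
      have h1 := Finset.single_le_sum (f := fun j => (a j : ℝ) / k) (fun i _ => ha.1 i)
        (Finset.mem_univ j)
      exact h1.trans ha.2
    | parallelotope =>
      rw [hkind] at ha
      exact (ha j).2
  intro j _
  have h := key j
  rw [div_le_one hk0] at h
  exact_mod_cast h

theorem Mesh.finite_nodeSet {d : ℕ} {Ω : Set (Space d)} (P : Mesh Ω) {k : ℕ} (hk : 1 ≤ k) :
    (P.nodeSet k).Finite :=
  (P.cells.finite_toSet.biUnion fun K _ => K.finite_nodes hk).inter_of_left _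

namespace Mesh

variable {d : ℕ} {Ω : Set (Space d)}

/-- The admissible set `V_P^+` for the upper bound `c`. -/
def admissible (P : Mesh Ω) (k : ℕ) (c : ℝ) : Set (Space d → ℝ) :=
  {v | v ∈ P.space k ∧ ∀ x ∈ P.nodeSet k, v x ∈ Icc 0 c}

/-- The constrained part `v^+ = ∑ i, max {0, min {v(x_i), c}} φ_i` (a finite sum over the internal
nodes). -/
def constrained (P : Mesh Ω) (k : ℕ) (c : ℝ) (v : Space d → ℝ) : Space d → ℝ :=
  fun z => ∑ᶠ x ∈ P.nodeSet k, max 0 (min (v x) c) * P.basisFun k x z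

/-- The complementary part `v^- = v - v^+`. -/
def complementary (P : Mesh Ω) (k : ℕ) (c : ℝ) (v : Space d → ℝ) : Space d → ℝ :=
  v - P.constrained k c v

end Mesh

/-! ### The forms -/

/-- The `L²(Ω)` inner product of scalar functions. -/
def l2 {d : ℕ} (Ω : Set (Space d)) (w v : Space d → ℝ) : ℝ := ∫ x in Ω, w x * v x

/-- `(∇w, ∇v)_Ω`. -/
def gradForm {d : ℕ} (Ω : Set (Space d)) (w v : Space d → ℝ) : ℝ :=
  ∫ x in Ω, inner ℝ (gradient w x) (gradient v x)

/-- `(b · ∇w, v)_Ω`. -/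
def convForm {d : ℕ} (Ω : Set (Space d)) (b : Space d → Space d) (w v : Space d → ℝ) : ℝ :=
  ∫ x in Ω, inner ℝ (b x) (gradient w x) * v x

/-- The norm `‖b‖_{0,∞}` with respect to a measure (the volume of a set, or the surface measure
of a facet). -/
def supNorm {d : ℕ} (m : Measure (Space d)) (b : Space d → Space d) : ℝ := (eLpNorm b ∞ m).toReal

/-- Surface measure on a facet: the `(d-1)`-dimensional Hausdorff measure, normalised to be
the Euclidean surface measure. -/
def surface {d : ℕ} (F : Set (Space d)) : Measure (Space d) :=
  (Measure.euclideanHausdorffMeasure (d - 1) : Measure (Space d)).restrict F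

/-- The jump at `x` of `∇v` between the elements `K` and `K'`. -/
def gradJump {d : ℕ} (K K' : Cell d) (v : Space d → ℝ) (x : Space d) : Space d :=
  gradientWithin v K.carrier x - gradientWithin v K'.carrier x

/-- The continuous interior penalty form
`J(w,v) = γ ∑_F ∫_F ‖b‖_{0,∞,F} h_F² ⟦∇w⟧·⟦∇v⟧ ds`, the sum being over the internal facets. Each
facet occurs twice in `facetPairs`, whence the factor `1/2`. -/
def cip {d : ℕ} {Ω : Set (Space d)} (P : Mesh Ω) (γ : ℝ) (b : Space d → Space d)
    (w v : Space d → ℝ) : ℝ :=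
  γ * ((1 / 2) * ∑ KK ∈ P.facetPairs,
    ∫ x, supNorm (surface (KK.1.carrier ∩ KK.2.carrier)) b
        * Metric.diam (KK.1.carrier ∩ KK.2.carrier) ^ 2
        * inner ℝ (gradJump KK.1 KK.2 w x) (gradJump KK.1 KK.2 v x)
      ∂(surface (KK.1.carrier ∩ KK.2.carrier)))

/-- The data of the problem and of its discretisation: diffusion `ε`, reaction `μ`, convection
`β(t)(x)`, source `f(t)(x)`, upper bound `κ(t)`, final time `T`, number `N` of time steps, parameter
`θ` of the scheme, polynomial degree `k`, and stabilisation parameters `γ`, `α`. -/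
structure Data (d : ℕ) where
  ε : ℝ
  μ : ℝ
  β : ℝ → Space d → Space d
  f : ℝ → Space d → ℝ
  κ : ℝ → ℝ
  T : ℝ
  N : ℕ
  θ : ℝ
  k : ℕ
  γ : ℝ
  α : ℝ

namespace Data

variable {d : ℕ} {Ω : Set (Space d)}

/-- The time step `Δt`. -/
def dt (p : Data d) : ℝ := p.T / p.N

/-- The discrete time `t_n`. -/
def time (p : Data d) (n : ℕ) : ℝ := n * p.dt

/-- `a_J(w,v) = ε(∇w,∇v) + (β·∇w,v) + μ(w,v) + J(w,v)` at time `t`. -/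
def aJ (p : Data d) (P : Mesh Ω) (t : ℝ) (w v : Space d → ℝ) : ℝ :=
  p.ε * gradForm Ω w v + convForm Ω (p.β t) w v + p.μ * l2 Ω w v + cip P p.γ (p.β t) w v

/-- The stabilisation form `s` at the time level `n`. -/
def s (p : Data d) (P : Mesh Ω) (n : ℕ) (v w : Space d → ℝ) : ℝ :=
  p.α * ∑ᶠ x ∈ P.nodeSet p.k,
    (p.ε * P.meshFun x ^ (d - 2)
      + supNorm (volume.restrict (P.patch x)) (p.β (p.time n)) * P.meshFun x ^ (d - 1)
      + (1 / p.dt + p.μ) * P.meshFun x ^ d) * v x * w x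

/-- `V_P`. -/
def V (p : Data d) (P : Mesh Ω) : Set (Space d → ℝ) := P.space p.k

/-- `V_P^+` at the time level `n`. -/
def Vplus (p : Data d) (P : Mesh Ω) (n : ℕ) : Set (Space d → ℝ) :=
  P.admissible p.k (p.κ (p.time n))

/-- `v^+` at the time level `n`. -/
def plus (p : Data d) (P : Mesh Ω) (n : ℕ) (v : Space d → ℝ) : Space d → ℝ :=
  P.constrained p.k (p.κ (p.time n)) v

/-- `v^-` at the time level `n`. -/
def minus (p : Data d) (P : Mesh Ω) (n : ℕ) (v : Space d → ℝ) : Space d → ℝ :=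
  P.complementary p.k (p.κ (p.time n)) v

/-- `f^{n-1+θ} = θ f(t_n) + (1-θ) f(t_{n-1})`. -/
def source (p : Data d) (n : ℕ) (x : Space d) : ℝ :=
  p.θ * p.f (p.time n) x + (1 - p.θ) * p.f (p.time (n - 1)) x

/-- The functional `F^n`, which depends on the previous iterate `u' = u_h^{n-1}` through its
constrained part. -/
def F (p : Data d) (P : Mesh Ω) (n : ℕ) (u' v : Space d → ℝ) : ℝ :=
  p.dt * l2 Ω (p.source n) v
    - p.dt * (1 - p.θ) * p.ε * gradForm Ω (p.plus P (n - 1) u') v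
    - p.dt * (1 - p.θ) * convForm Ω (p.β (p.time (n - 1))) (p.plus P (n - 1) u') v
    - (p.μ * p.dt * (1 - p.θ) - 1) * l2 Ω (p.plus P (n - 1) u') v
    - p.dt * (1 - p.θ) * cip P p.γ (p.β (p.time (n - 1))) (p.plus P (n - 1) u') v

/-- `u` solves the nonlinear problem of the `n`-th time step with previous iterate `u'`. -/
def IsSolution (p : Data d) (P : Mesh Ω) (n : ℕ) (u' u : Space d → ℝ) : Prop :=
  u ∈ p.V P ∧ ∀ v ∈ p.V P,
    l2 Ω (p.plus P n u) v + p.dt * p.θ * p.aJ P (p.time n) (p.plus P n u) v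
      + p.dt * p.s P n (p.minus P n u) v = p.F P n u' v

end Data

end BPFEM

end

/-! In nodal coordinates problem (1) reads `B (clip u) v + ∑ i, D i * (u i - clip u i) * v i = l v`
for all `v`. Here `B` is the form of one implicit step, `D` collects the weights of `Δt s`, and
`clip` truncates each nodal value to `[0, κ]`. With `w = clip u` this says `u = w + D⁻¹ (l - B w)`,
so the problem reduces to solving `clip (w + D⁻¹ (l - B w)) = w`. At each node this only says that
the residual vanishes, or that `w` sits at the bound towards which the residual points. The scale of
the residual is therefore irrelevant (`clip_add_of_clip_add_mul`): `D⁻¹` may be replaced by a single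
small `ρ`. For such `ρ` the map `w ↦ clip (w + ρ (l - B w))` is a contraction, because `B` is
coercive and `clip` is nonexpansive (`exists_projected_fixedPoint`, `exists_box_solution`).

For uniqueness, the difference of two solutions is tested with the difference of their truncations.
As `r ↦ clip r` and `r ↦ r - clip r` are both nondecreasing, positivity of `B` forces equal
truncations, and then the diagonal term forces equal complements (`box_solution_unique`). The
variational inequality (b) holds because `(r - clip r) (v - clip r) ≤ 0` at every node for `v` in
the interval, and (c) because `s` is diagonal with positive weights.

Two facts about the finite element space are needed. First, `B` must be positive definite, which
rests on `(β · ∇w, w) = 0` (`convForm_self`). Solenoidality is only available against smooth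
compactly supported functions. The identity is therefore reached in two limits: Lipschitz test
functions are mollified, and `w ^ 2 / 2`, whose support may touch the boundary, is replaced by
`(soft δ w) ^ 2 / 2`.

Second, the nodal basis must exist and nodal values must determine functions. Conformity only says
that two cells meet in an exposed face of both. Since nodes are exactly the means of vertices with
weights in `ℕ / k`, and extreme points of a common face are vertices of both cells, the nodes on
that face agree (`Cell.mem_nodes_of_mem_inter`). Shape functions agreeing at these nodes agree on
the face (`Cell.shape_eq_on_inter`), so local Lagrange functions glue (`Mesh.exists_basisFun`). They
vanish on the boundary of the domain because a boundary point of a cell always lies on a facet of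
that cell which misses the given interior node (`Mesh.exists_local_lagrange`). -/

noncomputable section

namespace BPFEM

/-! ### A finite-dimensional problem with a box constraint -/

/-- A positive definite linear map on a finite-dimensional space is coercive. -/
theorem exists_coercive {E : Type*} [NormedAddCommGroup E] [InnerProductSpace ℝ E]
    [FiniteDimensional ℝ E] (A : E →L[ℝ] E) (hA : ∀ w, w ≠ 0 → 0 < inner ℝ (A w) w) :
    ∃ c > 0, ∀ w, c * ‖w‖ ^ 2 ≤ inner ℝ (A w) w := by
  rcases subsingleton_or_nontrivial E with hE | hE
  · exact ⟨1, one_pos, fun w => by simp [Subsingleton.elim w 0]⟩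
  have hcont : Continuous fun w : E => inner ℝ (A w) w := by fun_prop
  obtain ⟨w₀, hw₀, hmin⟩ := (isCompact_sphere (0 : E) 1).exists_isMinOn
    (NormedSpace.sphere_nonempty.2 zero_le_one) hcont.continuousOn
  have hw₀1 : ‖w₀‖ = 1 := by simpa using hw₀
  refine ⟨_, hA w₀ (by rintro rfl; simp at hw₀1), fun w => ?_⟩
  rcases eq_or_ne w 0 with rfl | hw
  · simp
  have hn : 0 < ‖w‖ := norm_pos_iff.2 hw
  have h := hmin (show ‖w‖⁻¹ • w ∈ Metric.sphere (0 : E) 1 by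
    simp [norm_smul, hn.ne'])
  simp only [mem_ofPred_eq, map_smul, inner_smul_left, inner_smul_right] at h
  simp only [map_inv₀, conj_trivial] at h
  calc inner ℝ (A w₀) w₀ * ‖w‖ ^ 2
      ≤ (‖w‖⁻¹ * (‖w‖⁻¹ * inner ℝ (A w) w)) * ‖w‖ ^ 2 := by gcongr
    _ = inner ℝ (A w) w := by field_simp

/-- The projected Richardson iteration for a coercive operator has a fixed point. -/
theorem exists_projected_fixedPoint {E : Type*} [NormedAddCommGroup E] [InnerProductSpace ℝ E]
    [FiniteDimensional ℝ E] (A : E →L[ℝ] E) (hA : ∀ w, w ≠ 0 → 0 < inner ℝ (A w) w)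
    (C : E → E) (hC : LipschitzWith 1 C) (r : E) :
    ∃ ρ : ℝ, 0 < ρ ∧ ∃ w, C (w + ρ • (r - A w)) = w := by
  obtain ⟨c, hc, hcoer⟩ := exists_coercive A hA
  set M : ℝ := ‖A‖ + c + 1 with hM
  have hM0 : 0 < M := by positivity
  have hcM : c < M := by have := norm_nonneg A; linarith
  -- Expanding the square gives `‖e - ρ A e‖² ≤ (1 - 2ρc + ρ²M²) ‖e‖²`. This `ρ` minimises the
  -- bracket, and the minimum is `q`; `c < M` keeps it nonnegative.
  set ρ : ℝ := c / M ^ 2 with hρ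
  have hρ0 : 0 < ρ := by positivity
  set q : ℝ := 1 - c ^ 2 / M ^ 2 with hq
  have hq1 : q < 1 := by
    have : 0 < c ^ 2 / M ^ 2 := by positivity
    linarith
  have hq0 : 0 ≤ q := by
    have : c ^ 2 / M ^ 2 ≤ 1 := by
      rw [div_le_one (by positivity)]
      gcongr
    linarith
  have key : ∀ e : E, ‖e - ρ • A e‖ ≤ Real.sqrt q * ‖e‖ := by
    intro e
    refine le_of_sq_le_sq ?_ (by positivity)
    rw [mul_pow, Real.sq_sqrt hq0, norm_sub_sq_real, inner_smul_right, norm_smul,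
      Real.norm_of_nonneg hρ0.le, real_inner_comm]
    have h1 := hcoer e
    have h2 : ‖A e‖ ≤ M * ‖e‖ := (A.le_opNorm e).trans (by gcongr; linarith)
    have h3 : (ρ * ‖A e‖) ^ 2 ≤ (ρ * (M * ‖e‖)) ^ 2 := by gcongr
    have h4 : ρ * (c * ‖e‖ ^ 2) ≤ ρ * inner ℝ (A e) e := by gcongr
    have h5 : ρ * c = c ^ 2 / M ^ 2 := by rw [hρ]; ring
    have h6 : (ρ * (M * ‖e‖)) ^ 2 = c ^ 2 / M ^ 2 * ‖e‖ ^ 2 := by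
      rw [hρ]; field_simp
    rw [h6] at h3
    rw [← mul_assoc, h5] at h4
    rw [hq]
    nlinarith
  let Φ : E → E := fun w => C (w + ρ • (r - A w))
  have hΦ : ContractingWith (Real.sqrt q).toNNReal Φ := by
    refine ⟨?_, LipschitzWith.of_dist_le_mul fun x y => ?_⟩
    · rw [← NNReal.coe_lt_coe, Real.coe_toNNReal _ (Real.sqrt_nonneg q), NNReal.coe_one,
        Real.sqrt_lt' one_pos]
      simpa using hq1
    · refine (hC.dist_le_mul _ _).trans ?_
      rw [NNReal.coe_one, one_mul, dist_eq_norm, dist_eq_norm]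
      have h : x + ρ • (r - A x) - (y + ρ • (r - A y)) = (x - y) - ρ • A (x - y) := by
        rw [map_sub, smul_sub, smul_sub, smul_sub]; abel
      rw [h, Real.coe_toNNReal _ (Real.sqrt_nonneg q)]
      exact key _
  exact ⟨ρ, hρ0, _, hΦ.fixedPoint_isFixedPt⟩

/-! ### Truncation of real numbers -/

/-- Truncation of a real number to `[0, c]`. -/
def clip (c r : ℝ) : ℝ := max 0 (min r c)

theorem clip_mem {c : ℝ} (hc : 0 ≤ c) (r : ℝ) : clip c r ∈ Icc 0 c :=
  ⟨le_max_left _ _, max_le hc (min_le_right _ _)⟩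

theorem clip_nonexpansive (c r r' : ℝ) : |clip c r - clip c r'| ≤ |r - r'| := by
  unfold clip
  rw [max_comm 0, max_comm 0]
  refine (abs_max_sub_max_le_abs _ _ _).trans ?_
  refine (abs_min_sub_min_le_max _ _ _ _).trans ?_
  simp

/-- Both `r ↦ clip c r` and `r ↦ r - clip c r` are nondecreasing, so their increments have the same
sign. This monotonicity drives uniqueness. -/
theorem clip_mul_nonneg (c r r' : ℝ) :
    0 ≤ (r - clip c r - (r' - clip c r')) * (clip c r - clip c r') := by
  unfold clip
  rcases le_total r c with h1 | h1 <;> rcases le_total r' c with h2 | h2 <;>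
    simp only [h1, h2, min_eq_left, min_eq_right] <;>
    rcases le_total 0 r with h3 | h3 <;> rcases le_total 0 r' with h4 | h4 <;>
    rcases le_total 0 c with h5 | h5 <;>
    simp only [h3, h4, h5, max_eq_left, max_eq_right] <;> nlinarith

/-- The variational inequality on the interval, componentwise. -/
theorem sub_clip_mul_le {c r v : ℝ} (hv : v ∈ Icc 0 c) :
    (r - clip c r) * (v - clip c r) ≤ 0 := by
  have hc : 0 ≤ c := hv.1.trans hv.2
  unfold clip
  rcases le_total r c with h1 | h1 <;> simp only [h1, min_eq_left, min_eq_right] <;>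
    rcases le_total 0 r with h3 | h3 <;>
    simp only [h3, hc, max_eq_left, max_eq_right] <;> nlinarith [hv.1, hv.2]

/-- The fixed point equation depends only on the sign of `r`: `w = 0` if `r < 0`, `w = c` if `r >
0`, and `w ∈ [0, c]` if `r = 0`. Any positive factor may thus replace `ρ`, even a different one at
each node. -/
theorem clip_add_of_clip_add_mul {c w r ρ D : ℝ} (hc : 0 < c) (hρ : 0 < ρ) (hD : 0 < D)
    (h : clip c (w + ρ * r) = w) : clip c (w + r / D) = w := by
  have hw : w ∈ Icc 0 c := h ▸ clip_mem hc.le _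
  unfold clip at *
  rcases lt_trichotomy r 0 with hr | rfl | hr
  · have h1 : ρ * r < 0 := mul_neg_of_pos_of_neg hρ hr
    have h0 : w = 0 := by
      by_contra hne
      have hwp : 0 < w := lt_of_le_of_ne hw.1 (Ne.symm hne)
      have : max 0 (min (w + ρ * r) c) < w := max_lt hwp ((min_le_left _ _).trans_lt (by linarith))
      linarith
    have h2 : r / D < 0 := div_neg_of_neg_of_pos hr hD
    subst h0
    rw [max_eq_left ((min_le_left _ _).trans (by linarith))]
  · rw [zero_div]
    simpa using h
  · have h1 : 0 < ρ * r := mul_pos hρ hr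
    have h0 : w = c := by
      by_contra hne
      have hwp : w < c := lt_of_le_of_ne hw.2 hne
      have : w < max 0 (min (w + ρ * r) c) := lt_max_of_lt_right (lt_min (by linarith) hwp)
      linarith
    have h2 : 0 < r / D := div_pos hr hD
    subst h0
    rw [min_eq_right (by linarith), max_eq_right hc.le]

/-! ### The box-constrained problem in coordinates -/

section Box

variable {ι : Type*} [Fintype ι]

/-- Existence for the box-constrained problem in complementarity form. -/
theorem exists_box_solution (B : (ι → ℝ) →ₗ[ℝ] (ι → ℝ) →ₗ[ℝ] ℝ) (hB : ∀ w, w ≠ 0 → 0 < B w w)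
    (D : ι → ℝ) (hD : ∀ i, 0 < D i) (l : (ι → ℝ) →ₗ[ℝ] ℝ) {c : ℝ} (hc : 0 < c) :
    ∃ u : ι → ℝ, ∀ v : ι → ℝ,
      B (fun i => clip c (u i)) v + ∑ i, D i * (u i - clip c (u i)) * v i = l v := by
  classical
  let A₀ : EuclideanSpace ℝ ι →ₗ[ℝ] EuclideanSpace ℝ ι :=
    { toFun := fun w => WithLp.toLp 2 fun i => B w.ofLp (Pi.single i 1)
      map_add' := fun x y => by ext i; simp
      map_smul' := fun r x => by ext i; simp }
  let A : EuclideanSpace ℝ ι →L[ℝ] EuclideanSpace ℝ ι := LinearMap.toContinuousLinearMap A₀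
  have expand : ∀ (f : (ι → ℝ) →ₗ[ℝ] ℝ) (v : ι → ℝ), f v = ∑ i, f (Pi.single i 1) * v i := by
    intro f v
    conv_lhs => rw [← Finset.univ_sum_single v, map_sum]
    refine Finset.sum_congr rfl fun i _ => ?_
    have : (Pi.single i (v i) : ι → ℝ) = v i • Pi.single i 1 := by
      rw [← Pi.single_smul]; simp
    rw [this, map_smul, smul_eq_mul, mul_comm]
  have hAi : ∀ w v : EuclideanSpace ℝ ι, inner ℝ (A w) v = B w.ofLp v.ofLp := by
    intro w v
    rw [PiLp.inner_apply, expand (B w.ofLp)]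
    refine Finset.sum_congr rfl fun i _ => ?_
    change inner ℝ (B w.ofLp (Pi.single i 1)) (v i) = _
    simp [mul_comm]
  have hApos : ∀ w : EuclideanSpace ℝ ι, w ≠ 0 → 0 < inner ℝ (A w) w := by
    intro w hw
    rw [hAi]
    exact hB _ fun h => hw (by ext i; exact congrFun h i)
  let C : EuclideanSpace ℝ ι → EuclideanSpace ℝ ι := fun w => WithLp.toLp 2 fun i => clip c (w i)
  have hC : LipschitzWith 1 C := by
    refine LipschitzWith.of_dist_le_mul fun x y => ?_
    rw [NNReal.coe_one, one_mul, EuclideanSpace.dist_eq, EuclideanSpace.dist_eq]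
    refine Real.sqrt_le_sqrt (Finset.sum_le_sum fun i _ => ?_)
    rw [Real.dist_eq, Real.dist_eq]
    have := clip_nonexpansive c (x i) (y i)
    gcongr
  let r : EuclideanSpace ℝ ι := WithLp.toLp 2 fun i => l (Pi.single i 1)
  obtain ⟨ρ, hρ, w, hw⟩ := exists_projected_fixedPoint A hApos C hC r
  have hwi : ∀ i, clip c (w i + (l (Pi.single i 1) - B w.ofLp (Pi.single i 1)) / D i) = w i := by
    intro i
    refine clip_add_of_clip_add_mul hc hρ (hD i) ?_
    exact congrArg (fun x : EuclideanSpace ℝ ι => x i) hw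
  -- The unknown is recovered by adding to `w` the residual divided by the weight: by `hwi` its
  -- truncation is `w`, so the diagonal term equals the residual.
  refine ⟨fun i => w i + (l (Pi.single i 1) - B w.ofLp (Pi.single i 1)) / D i, fun v => ?_⟩
  simp only [hwi]
  have hs : ∀ i, D i * (w i + (l (Pi.single i 1) - B w.ofLp (Pi.single i 1)) / D i - w i) * v i
      = l (Pi.single i 1) * v i - B w.ofLp (Pi.single i 1) * v i := by
    intro i
    have := (hD i).ne'
    field_simp
    ring
  simp only [hs, Finset.sum_sub_distrib]
  rw [← expand l v, ← expand (B w.ofLp) v]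
  change B w.ofLp v + _ = _
  ring

/-- Testing the difference of the equations with `w - w'` gives zero as a sum of `B (w - w') (w -
w')` and nonnegative diagonal terms, so `w = w'`. Unit vectors then compare the complements one
index at a time. -/
theorem box_solution_unique (B : (ι → ℝ) →ₗ[ℝ] (ι → ℝ) →ₗ[ℝ] ℝ) (hB : ∀ w, w ≠ 0 → 0 < B w w)
    (D : ι → ℝ) (hD : ∀ i, 0 < D i) (l : (ι → ℝ) →ₗ[ℝ] ℝ) {c : ℝ} {u u' : ι → ℝ}
    (hu : ∀ v : ι → ℝ,
      B (fun i => clip c (u i)) v + ∑ i, D i * (u i - clip c (u i)) * v i = l v)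
    (hu' : ∀ v : ι → ℝ,
      B (fun i => clip c (u' i)) v + ∑ i, D i * (u' i - clip c (u' i)) * v i = l v) :
    u = u' := by
  classical
  set w : ι → ℝ := fun i => clip c (u i) with hw
  set w' : ι → ℝ := fun i => clip c (u' i) with hw'
  have hsub : ∀ v : ι → ℝ, B (w - w') v
      + ∑ i, D i * ((u i - clip c (u i)) - (u' i - clip c (u' i))) * v i = 0 := by
    intro v
    have h1 := hu v
    have h2 := hu' v
    rw [map_sub, LinearMap.sub_apply]
    have : ∑ i, D i * ((u i - clip c (u i)) - (u' i - clip c (u' i))) * v i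
        = ∑ i, D i * (u i - clip c (u i)) * v i - ∑ i, D i * (u' i - clip c (u' i)) * v i := by
      rw [← Finset.sum_sub_distrib]
      exact Finset.sum_congr rfl fun i _ => by ring
    rw [this]
    linarith
  have hww : w = w' := by
    by_contra hne
    have h1 := hB (w - w') (sub_ne_zero.2 hne)
    have h2 := hsub (w - w')
    have h3 : 0 ≤ ∑ i, D i * ((u i - clip c (u i)) - (u' i - clip c (u' i))) * (w - w') i :=
      Finset.sum_nonneg fun i _ => by
        rw [mul_assoc]
        exact mul_nonneg (hD i).le (clip_mul_nonneg c (u i) (u' i))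
    linarith
  funext i
  have h := hsub (Pi.single i 1)
  rw [hww, sub_self, map_zero, LinearMap.zero_apply, zero_add,
    Finset.sum_eq_single i (fun j _ hj => by simp [hj]) (by simp)] at h
  simp only [Pi.single_eq_same, mul_one] at h
  have h' := (mul_eq_zero.1 h).resolve_left (hD i).ne'
  have hwi : clip c (u i) = clip c (u' i) := congrFun hww i
  linarith

end Box

/-! ### Solenoidal fields tested with Lipschitz functions -/

section Lipschitz

open Filter Topology ContinuousLinearMap
open scoped Convolution NNReal

variable {d : ℕ} {Ω : Set (Space d)}

theorem real_inner_gradient_right (g : Space d → ℝ) (x y : Space d) :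
    inner ℝ y (gradient g x) = fderiv ℝ g x y := by
  rw [real_inner_comm]; exact inner_gradient_left

theorem norm_gradient (g : Space d → ℝ) (x : Space d) : ‖gradient g x‖ = ‖fderiv ℝ g x‖ :=
  (InnerProductSpace.toDual ℝ (Space d)).symm.norm_map _

theorem measurable_gradient (g : Space d → ℝ) : Measurable (gradient g) :=
  (InnerProductSpace.toDual ℝ (Space d)).symm.continuous.measurable.comp (measurable_fderiv ℝ g)

theorem norm_gradient_le_of_lipschitz {C : ℝ≥0} {g : Space d → ℝ} (hg : LipschitzWith C g)
    (x : Space d) : ‖gradient g x‖ ≤ C := by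
  rw [norm_gradient]; exact norm_fderiv_le_of_lipschitz ℝ hg

/-- The derivative falls on the Lipschitz factor of a convolution. -/
theorem fderiv_convolution_apply {C : ℝ≥0} {g ρ : Space d → ℝ} (hg : LipschitzWith C g)
    (hρ : ContDiff ℝ 1 ρ) (hρc : HasCompactSupport ρ) (hgc : HasCompactSupport g) (x v : Space d) :
    fderiv ℝ (ρ ⋆[lsmul ℝ ℝ, volume] g) x v = ∫ t, ρ t * lineDeriv ℝ g (x - t) v := by
  have hloc : LocallyIntegrable g volume := hg.continuous.locallyIntegrable
  rw [(hρc.hasFDerivAt_convolution_left (lsmul ℝ ℝ) hρ hloc x).fderiv]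
  have hint : ConvolutionExistsAt (fderiv ℝ ρ) g x ((lsmul ℝ ℝ).precompL (Space d)) volume :=
    (hρc.fderiv ℝ).convolutionExists_left _ (hρ.continuous_fderiv one_ne_zero) hloc x
  rw [convolution, ContinuousLinearMap.integral_apply hint]
  simp only [precompL_apply, lsmul_apply, smul_eq_mul]
  obtain ⟨D, hD⟩ := hρ.lipschitzWith_of_hasCompactSupport hρc one_ne_zero
  have hg' : LipschitzWith C fun t => g (x - t) := by
    refine LipschitzWith.of_dist_le_mul fun s t => ?_
    rw [← dist_sub_left x s t]
    exact hg.dist_le_mul (x - s) (x - t)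
  have hgc' : HasCompactSupport fun t => g (x - t) :=
    hgc.comp_homeomorph (Homeomorph.subLeft x)
  -- Integration by parts differentiates the other factor in direction `-v`; the reflection `t ↦ x -
  -- t` turns this back into `v`.
  have h := LipschitzWith.integral_lineDeriv_mul_eq (μ := volume) hD hg' hgc' v
  have h1 : ∀ t, lineDeriv ℝ ρ t v = fderiv ℝ ρ t v := fun t =>
    (hρ.differentiable one_ne_zero t).lineDeriv_eq_fderiv
  have h2 : ∀ t, lineDeriv ℝ (fun t => g (x - t)) t (-v) = lineDeriv ℝ g (x - t) v := by
    intro t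
    simp only [lineDeriv]
    congr 1
    funext s
    congr 1
    module
  simp only [h1, h2] at h
  rw [h]
  exact integral_congr_ae (Eventually.of_forall fun t => mul_comm _ _)

theorem exists_bound_of_continuousOn_closure (hΩ : Bornology.IsBounded Ω) {b : Space d → Space d}
    (hb : ContinuousOn b (closure Ω)) : ∃ M, 0 ≤ M ∧ ∀ x ∈ Ω, ‖b x‖ ≤ M := by
  obtain ⟨M, hM⟩ := (hΩ.isCompact_closure).exists_bound_of_continuousOn hb
  exact ⟨max M 0, le_max_right _ _, fun x hx => (hM x (subset_closure hx)).trans (le_max_left _ _)⟩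

/-- A solenoidal field is orthogonal to the gradients of Lipschitz functions of compact support. -/
theorem IsSolenoidal.integral_inner_gradient (hΩo : IsOpen Ω) (hΩ : Bornology.IsBounded Ω)
    {b : Space d → Space d} (hb : ContinuousOn b (closure Ω)) (hsol : IsSolenoidal Ω b)
    {C : ℝ≥0} {g : Space d → ℝ} (hg : LipschitzWith C g) (hgc : HasCompactSupport g)
    (hgΩ : tsupport g ⊆ Ω) : ∫ x in Ω, inner ℝ (b x) (gradient g x) = 0 := by
  have hfin : volume Ω < ⊤ := hΩ.measure_lt_top
  have : IsFiniteMeasure (volume.restrict Ω) := ⟨by simpa using hfin⟩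
  obtain ⟨M, hM0, hM⟩ := exists_bound_of_continuousOn_closure hΩ hb
  -- The outer radius tends to zero while its ratio to the inner one stays 2. This bounded ratio is
  -- what the almost everywhere convergence of the mollified derivatives requires.
  let φ : ℕ → ContDiffBump (0 : Space d) := fun n =>
    ⟨1 / ((n : ℝ) + 1) / 2, 1 / ((n : ℝ) + 1), by positivity, half_lt_self (by positivity)⟩
  have hφ : Tendsto (fun n => (φ n).rOut) atTop (𝓝 0) := tendsto_one_div_add_atTop_nhds_zero_nat
  let ψ : ℕ → Space d → ℝ := fun n => (φ n).normed volume ⋆[lsmul ℝ ℝ, volume] g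
  have hρ : ∀ n, ContDiff ℝ ∞ ((φ n).normed volume) := fun n => (φ n).contDiff_normed
  have hρc : ∀ n, HasCompactSupport ((φ n).normed volume) := fun n =>
    (φ n).hasCompactSupport_normed
  have hloc : LocallyIntegrable g volume := hg.continuous.locallyIntegrable
  have hψs : ∀ n, ContDiff ℝ ∞ (ψ n) := fun n =>
    (hρc n).contDiff_convolution_left (lsmul ℝ ℝ) (hρ n) hloc
  obtain ⟨δ, hδ, hδΩ⟩ := hgc.isCompact.exists_cthickening_subset_open hΩo hgΩ
  have hsupp : ∀ᶠ n in atTop, IsTestFunction Ω (ψ n) := by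
    filter_upwards [hφ.eventually (gt_mem_nhds hδ)] with n hn
    refine ⟨hψs n, (hρc n).convolution _ hgc, ?_⟩
    refine (closure_minimal ?_ Metric.isClosed_cthickening).trans hδΩ
    refine (support_convolution_subset (lsmul ℝ ℝ)).trans ?_
    rw [(φ n).support_normed_eq]
    rintro _ ⟨a, ha, y, hy, rfl⟩
    refine Metric.mem_cthickening_of_dist_le _ y δ _ (subset_closure hy) ?_
    rw [mem_ball_zero_iff] at ha
    simpa using (ha.trans hn).le
  have hderiv : ∀ n x v, fderiv ℝ (ψ n) x v
      = ∫ t, (φ n).normed volume t * lineDeriv ℝ g (x - t) v := fun n x v =>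
    fderiv_convolution_apply hg ((hρ n).of_le (by simp)) (hρc n) hgc x v
  have hbound : ∀ n x v, ‖fderiv ℝ (ψ n) x v‖ ≤ C * ‖v‖ := by
    intro n x v
    rw [hderiv]
    have hi : Integrable (fun t => (φ n).normed volume t * (C * ‖v‖)) volume :=
      (((φ n).continuous_normed).integrable_of_hasCompactSupport (hρc n)).mul_const _
    refine (norm_integral_le_of_norm_le hi (Eventually.of_forall fun t => ?_)).trans ?_
    · rw [norm_mul, Real.norm_of_nonneg ((φ n).nonneg_normed t)]
      exact mul_le_mul_of_nonneg_left (norm_lineDeriv_le_of_lipschitz ℝ hg)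
        ((φ n).nonneg_normed t)
    · rw [integral_mul_const, (φ n).integral_normed, one_mul]
  -- The exceptional null set depends on the direction. Only the finitely many coordinate directions
  -- are therefore used, and `b x` is expanded along them in `hsum`.
  have hlim : ∀ᵐ x : Space d, ∀ i : Fin d,
      Tendsto (fun n => fderiv ℝ (ψ n) x (EuclideanSpace.single i 1)) atTop
        (𝓝 (fderiv ℝ g x (EuclideanSpace.single i 1))) := by
    rw [ae_all_iff]
    intro i
    have hl := ContDiffBump.ae_convolution_tendsto_right_of_locallyIntegrable (φ := φ) (K := 2)
      (μ := volume) hφ (Eventually.of_forall fun n => by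
        change 1 / ((n : ℝ) + 1) ≤ 2 * (1 / ((n : ℝ) + 1) / 2); linarith)
      (hg.locallyIntegrable_lineDeriv (μ := volume) (EuclideanSpace.single i (1 : ℝ)))
    filter_upwards [hl, hg.ae_differentiableAt] with x hx hdx
    rw [← hdx.lineDeriv_eq_fderiv]
    refine hx.congr fun n => ?_
    rw [hderiv]
    simp only [convolution, lsmul_apply, smul_eq_mul]
  have hsum : ∀ (f : Space d → ℝ) x, inner ℝ (b x) (gradient f x)
      = ∑ i, b x i * fderiv ℝ f x (EuclideanSpace.single i 1) := by
    intro f x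
    rw [real_inner_gradient_right]
    have hbx : b x = ∑ i, b x i • EuclideanSpace.single i (1 : ℝ) := by
      ext j
      simp [Finset.sum_apply, Pi.single_apply]
    conv_lhs => rw [hbx, map_sum]
    simp only [map_smul, smul_eq_mul]
  have hbm : AEStronglyMeasurable b (volume.restrict Ω) :=
    (hb.mono subset_closure).aestronglyMeasurable hΩo.measurableSet
  have hT : Tendsto (fun n => ∫ x in Ω, inner ℝ (b x) (gradient (ψ n) x)) atTop
      (𝓝 (∫ x in Ω, inner ℝ (b x) (gradient g x))) := by
    refine tendsto_integral_of_dominated_convergence (fun _ => C * M)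
      (fun n => hbm.inner (measurable_gradient _).aestronglyMeasurable)
      (integrable_const _) (fun n => ?_) ?_
    · filter_upwards [ae_restrict_mem hΩo.measurableSet] with x hx
      rw [real_inner_gradient_right]
      exact (hbound n x (b x)).trans (by gcongr; exact hM x hx)
    · filter_upwards [ae_restrict_of_ae hlim] with x hx
      simp only [hsum]
      exact tendsto_finsetSum _ fun i _ => (hx i).const_mul _
  refine tendsto_nhds_unique hT (tendsto_const_nhds.congr' ?_)
  filter_upwards [hsupp] with n hn
  exact (hsol _ hn).symm

end Lipschitz

/-! ### Lipschitz functions vanishing outside the domain, and the volume forms -/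

section LipZero

open Filter Topology
open scoped NNReal

variable {d : ℕ} {Ω : Set (Space d)}

/-- Lipschitz functions that vanish outside `Ω`. -/
def IsLipZero (Ω : Set (Space d)) (v : Space d → ℝ) : Prop :=
  (∃ C : ℝ≥0, LipschitzWith C v) ∧ ∀ x ∉ Ω, v x = 0

namespace IsLipZero

variable {v w u : Space d → ℝ}

theorem continuous (hv : IsLipZero Ω v) : Continuous v := hv.1.choose_spec.continuous

theorem ae_differentiableAt (hv : IsLipZero Ω v) : ∀ᵐ x, DifferentiableAt ℝ v x :=
  hv.1.choose_spec.ae_differentiableAt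

theorem hasCompactSupport (hΩ : Bornology.IsBounded Ω) (hv : IsLipZero Ω v) :
    HasCompactSupport v :=
  HasCompactSupport.intro hΩ.isCompact_closure fun x hx => hv.2 x fun h => hx (subset_closure h)

theorem exists_norm_gradient_le (hv : IsLipZero Ω v) : ∃ C, ∀ x, ‖gradient v x‖ ≤ C :=
  ⟨_, norm_gradient_le_of_lipschitz hv.1.choose_spec⟩

theorem exists_bound (hΩ : Bornology.IsBounded Ω) (hv : IsLipZero Ω v) : ∃ C, ∀ x, ‖v x‖ ≤ C :=
  hv.continuous.bounded_above_of_compact_support (hv.hasCompactSupport hΩ)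

theorem memLp (hΩ : Bornology.IsBounded Ω) (hv : IsLipZero Ω v) (p : ℝ≥0∞) :
    MemLp v p (volume.restrict Ω) :=
  (hv.continuous.memLp_of_hasCompactSupport (hv.hasCompactSupport hΩ)).restrict Ω

/-- The line derivatives are the weak partial derivatives: both factors vanish outside `Ω`, so the
integrals extend to the whole space, where Lipschitz functions can be integrated by parts. -/
theorem memW1 (hΩ : Bornology.IsBounded Ω) (hv : IsLipZero Ω v) :
    MemW1 Ω 2 v := by
  have : IsFiniteMeasure (volume.restrict Ω) := ⟨by simpa using hΩ.measure_lt_top⟩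
  obtain ⟨C, hC⟩ := hv.1
  refine ⟨hv.memLp hΩ 2, fun j => ⟨fun x => lineDeriv ℝ v x (EuclideanSpace.single j 1), ?_, ?_⟩⟩
  · exact (hC.memLp_lineDeriv _).mono_exponent le_top
  · rintro φ ⟨hφ, hφc, hφΩ⟩
    obtain ⟨D, hD⟩ := (hφ.of_le (m := 1) (by simp)).lipschitzWith_of_hasCompactSupport
      hφc one_ne_zero
    have hz : ∀ x ∉ Ω, φ x = 0 := fun x hx => image_eq_zero_of_notMem_tsupport fun h => hx (hφΩ h)
    rw [setIntegral_eq_integral_of_forall_compl_eq_zero fun x hx => by rw [hv.2 x hx, zero_mul],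
      setIntegral_eq_integral_of_forall_compl_eq_zero fun x hx => by rw [hz x hx, mul_zero],
      hC.integral_lineDeriv_mul_eq hD hφc, ← integral_neg]
    refine integral_congr_ae (Eventually.of_forall fun x => ?_)
    have hdx : DifferentiableAt ℝ φ x := (hφ.differentiable (by simp)) x
    simp only [hdx.lineDeriv_eq_fderiv, map_neg]
    ring

/-- By Rademacher both functions are differentiable off a null set. At the remaining points
`gradient` has its default value and additivity may fail. -/
theorem ae_gradient_add (hv : IsLipZero Ω v) (hw : IsLipZero Ω w) :
    ∀ᵐ x, gradient (v + w) x = gradient v x + gradient w x := by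
  filter_upwards [hv.ae_differentiableAt, hw.ae_differentiableAt] with x h1 h2
  simp only [gradient, fderiv_add h1 h2, map_add]

theorem ae_gradient_smul (hv : IsLipZero Ω v) (c : ℝ) :
    ∀ᵐ x, gradient (c • v) x = c • gradient v x := by
  filter_upwards [hv.ae_differentiableAt] with x h1
  simp only [gradient, fderiv_const_smul h1, map_smulₛₗ, conj_trivial]

theorem integrable_inner_gradient (hΩ : Bornology.IsBounded Ω) (hv : IsLipZero Ω v)
    (hw : IsLipZero Ω w) :
    Integrable (fun x => inner ℝ (gradient v x) (gradient w x)) (volume.restrict Ω) := by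
  have : IsFiniteMeasure (volume.restrict Ω) := ⟨by simpa using hΩ.measure_lt_top⟩
  obtain ⟨C, hC⟩ := hv.exists_norm_gradient_le
  obtain ⟨D, hD⟩ := hw.exists_norm_gradient_le
  refine Integrable.of_bound ((measurable_gradient v).inner
    (measurable_gradient w)).aestronglyMeasurable (C * D) (Eventually.of_forall fun x => ?_)
  exact (norm_inner_le_norm _ _).trans (mul_le_mul (hC x) (hD x) (norm_nonneg _)
    ((norm_nonneg _).trans (hC x)))

theorem integrable_conv (hΩo : IsOpen Ω) (hΩ : Bornology.IsBounded Ω) {b : Space d → Space d}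
    (hb : ContinuousOn b (closure Ω)) (hv : IsLipZero Ω v) (hw : IsLipZero Ω w) :
    Integrable (fun x => inner ℝ (b x) (gradient v x) * w x) (volume.restrict Ω) := by
  have : IsFiniteMeasure (volume.restrict Ω) := ⟨by simpa using hΩ.measure_lt_top⟩
  obtain ⟨M, hM0, hM⟩ := exists_bound_of_continuousOn_closure hΩ hb
  obtain ⟨C, hC⟩ := hv.exists_norm_gradient_le
  obtain ⟨D, hD⟩ := hw.exists_bound hΩ
  have hbm : AEStronglyMeasurable b (volume.restrict Ω) :=
    (hb.mono subset_closure).aestronglyMeasurable hΩo.measurableSet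
  refine Integrable.of_bound ((hbm.inner (measurable_gradient v).aestronglyMeasurable).mul
    hw.continuous.aestronglyMeasurable) (M * C * D) ?_
  filter_upwards [ae_restrict_mem hΩo.measurableSet] with x hx
  rw [norm_mul]
  have h0 : 0 ≤ C := (norm_nonneg _).trans (hC x)
  exact mul_le_mul ((norm_inner_le_norm _ _).trans
    (mul_le_mul (hM x hx) (hC x) (norm_nonneg _) hM0)) (hD x) (norm_nonneg _) (by positivity)

theorem integrable_mul_right {f : Space d → ℝ} (hΩ : Bornology.IsBounded Ω)
    (hf : MemLp f 2 (volume.restrict Ω)) (hw : IsLipZero Ω w) :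
    Integrable (fun x => f x * w x) (volume.restrict Ω) :=
  hf.integrable_mul (hw.memLp hΩ 2)

end IsLipZero

section Forms

variable {v w u : Space d → ℝ}

theorem l2_comm (w v : Space d → ℝ) : l2 Ω w v = l2 Ω v w := by simp only [l2, mul_comm]

theorem gradForm_comm (w v : Space d → ℝ) : gradForm Ω w v = gradForm Ω v w := by
  simp only [gradForm, real_inner_comm]

theorem l2_add_right {f : Space d → ℝ} (hΩ : Bornology.IsBounded Ω)
    (hf : MemLp f 2 (volume.restrict Ω)) (hv : IsLipZero Ω v) (hw : IsLipZero Ω w) :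
    l2 Ω f (v + w) = l2 Ω f v + l2 Ω f w := by
  simp only [l2, Pi.add_apply, mul_add]
  exact integral_add (hv.integrable_mul_right hΩ hf) (hw.integrable_mul_right hΩ hf)

theorem l2_smul_right (f : Space d → ℝ) (c : ℝ) : l2 Ω f (c • v) = c * l2 Ω f v := by
  simp only [l2, Pi.smul_apply, smul_eq_mul, mul_left_comm _ c, integral_const_mul]

theorem gradForm_add_right (hΩ : Bornology.IsBounded Ω) (hu : IsLipZero Ω u) (hv : IsLipZero Ω v)
    (hw : IsLipZero Ω w) : gradForm Ω u (v + w) = gradForm Ω u v + gradForm Ω u w := by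
  simp only [gradForm]
  rw [← integral_add (hu.integrable_inner_gradient hΩ hv) (hu.integrable_inner_gradient hΩ hw)]
  refine integral_congr_ae (ae_restrict_of_ae ?_)
  filter_upwards [hv.ae_gradient_add hw] with x hx
  rw [hx, inner_add_right]

theorem gradForm_smul_right (hv : IsLipZero Ω v) (c : ℝ) :
    gradForm Ω u (c • v) = c * gradForm Ω u v := by
  simp only [gradForm]
  rw [← integral_const_mul]
  refine integral_congr_ae (ae_restrict_of_ae ?_)
  filter_upwards [hv.ae_gradient_smul c] with x hx
  rw [hx, inner_smul_right]

section Conv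

variable {b : Space d → Space d}

theorem convForm_add_right (hΩo : IsOpen Ω) (hΩ : Bornology.IsBounded Ω)
    (hb : ContinuousOn b (closure Ω)) (hu : IsLipZero Ω u) (hv : IsLipZero Ω v)
    (hw : IsLipZero Ω w) : convForm Ω b u (v + w) = convForm Ω b u v + convForm Ω b u w := by
  simp only [convForm, Pi.add_apply, mul_add]
  exact integral_add (hu.integrable_conv hΩo hΩ hb hv) (hu.integrable_conv hΩo hΩ hb hw)

theorem convForm_smul_right (c : ℝ) : convForm Ω b u (c • v) = c * convForm Ω b u v := by
  simp only [convForm, Pi.smul_apply, smul_eq_mul, mul_left_comm _ c, integral_const_mul]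

theorem convForm_add_left (hΩo : IsOpen Ω) (hΩ : Bornology.IsBounded Ω)
    (hb : ContinuousOn b (closure Ω)) (hu : IsLipZero Ω u) (hv : IsLipZero Ω v)
    (hw : IsLipZero Ω w) : convForm Ω b (v + w) u = convForm Ω b v u + convForm Ω b w u := by
  simp only [convForm]
  rw [← integral_add (hv.integrable_conv hΩo hΩ hb hu) (hw.integrable_conv hΩo hΩ hb hu)]
  refine integral_congr_ae (ae_restrict_of_ae ?_)
  filter_upwards [hv.ae_gradient_add hw] with x hx
  rw [hx, inner_add_right, add_mul]

theorem convForm_smul_left (hv : IsLipZero Ω v) (c : ℝ) :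
    convForm Ω b (c • v) u = c * convForm Ω b v u := by
  simp only [convForm]
  rw [← integral_const_mul]
  refine integral_congr_ae (ae_restrict_of_ae ?_)
  filter_upwards [hv.ae_gradient_smul c] with x hx
  rw [hx, inner_smul_right, mul_assoc]

end Conv

end Forms

/-! ### Positivity of the forms and skew-symmetry of convection -/

theorem gradForm_self_nonneg (w : Space d → ℝ) : 0 ≤ gradForm Ω w w :=
  integral_nonneg fun _ => real_inner_self_nonneg

theorem l2_self_nonneg (w : Space d → ℝ) : 0 ≤ l2 Ω w w :=
  integral_nonneg fun _ => mul_self_nonneg _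

theorem l2_self_pos (hΩo : IsOpen Ω) (hΩ : Bornology.IsBounded Ω) {w : Space d → ℝ}
    (hw : IsLipZero Ω w) (hw0 : w ≠ 0) : 0 < l2 Ω w w := by
  refine lt_of_le_of_ne (l2_self_nonneg w) fun h => hw0 ?_
  have hi := hw.integrable_mul_right hΩ (hw.memLp hΩ 2)
  have h0 := (integral_eq_zero_iff_of_nonneg (fun x => mul_self_nonneg (w x)) hi).1 h.symm
  have h1 : w =ᵐ[volume.restrict Ω] 0 := by
    filter_upwards [h0] with x hx
    exact mul_self_eq_zero.1 hx
  have h2 := Measure.eqOn_open_of_ae_eq h1 hΩo hw.continuous.continuousOn continuousOn_const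
  funext x
  by_cases hx : x ∈ Ω
  · exact h2 hx
  · exact hw.2 x hx

/-- Soft thresholding of a real number at level `δ`. -/
def soft (δ s : ℝ) : ℝ := max (s - δ) 0 - max (-s - δ) 0

theorem soft_eq_zero {δ s : ℝ} (h : |s| ≤ δ) : soft δ s = 0 := by
  rw [abs_le] at h
  rw [soft, max_eq_right (by linarith), max_eq_right (by linarith), sub_zero]

theorem soft_of_lt {δ s : ℝ} (hδ : 0 ≤ δ) (h : δ < s) : soft δ s = s - δ := by
  rw [soft, max_eq_left (by linarith), max_eq_right (by linarith), sub_zero]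

theorem soft_of_lt_neg {δ s : ℝ} (hδ : 0 ≤ δ) (h : s < -δ) : soft δ s = s + δ := by
  rw [soft, max_eq_right (by linarith), max_eq_left (by linarith)]; ring

theorem abs_soft_sub_le {δ : ℝ} (hδ : 0 ≤ δ) (s : ℝ) : |soft δ s - s| ≤ δ := by
  rcases le_or_gt |s| δ with h | h
  · rw [soft_eq_zero h, zero_sub, abs_neg]; exact h
  · rcases lt_abs.1 h with h | h
    · rw [soft_of_lt hδ h]; simp [abs_of_nonneg hδ]
    · rw [soft_of_lt_neg hδ (by linarith)]; simp [abs_of_nonneg hδ]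

theorem abs_soft_le {δ : ℝ} (hδ : 0 ≤ δ) (s : ℝ) : |soft δ s| ≤ |s| := by
  rcases le_or_gt |s| δ with h | h
  · rw [soft_eq_zero h, abs_zero]; exact abs_nonneg _
  · rcases lt_abs.1 h with h | h
    · rw [soft_of_lt hδ h, abs_of_pos (by linarith), abs_of_pos (by linarith)]; linarith
    · rw [soft_of_lt_neg hδ (by linarith), abs_of_neg (by linarith), abs_of_neg (by linarith)]
      linarith

theorem lipschitzWith_soft (δ : ℝ) : LipschitzWith 2 (soft δ) := by
  refine LipschitzWith.of_dist_le_mul fun s t => ?_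
  rw [Real.dist_eq, Real.dist_eq]
  have h1 := abs_max_sub_max_le_abs (s - δ) (t - δ) 0
  have h2 := abs_max_sub_max_le_abs (-s - δ) (-t - δ) 0
  have e1 : |s - δ - (t - δ)| = |s - t| := by congr 1; ring
  have e2 : |-s - δ - (-t - δ)| = |s - t| := by rw [← abs_neg]; congr 1; ring
  rw [e1] at h1
  rw [e2] at h2
  have e3 : soft δ s - soft δ t = (max (s - δ) 0 - max (t - δ) 0)
      - (max (-s - δ) 0 - max (-t - δ) 0) := by unfold soft; ring
  rw [e3]
  have := abs_sub (max (s - δ) 0 - max (t - δ) 0) (max (-s - δ) 0 - max (-t - δ) 0)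
  push_cast
  linarith

theorem continuous_soft (δ : ℝ) : Continuous (soft δ) := (lipschitzWith_soft δ).continuous

/-- Where `|w| > δ`, the thresholded function is locally `w` plus a constant; elsewhere the
prefactor vanishes, so differentiability at the level `δ` does not matter. -/
theorem soft_smul_fderiv {w : Space d → ℝ} (hw : Continuous w) {δ : ℝ} (hδ : 0 < δ) (x : Space d) :
    soft δ (w x) • fderiv ℝ (fun y => soft δ (w y)) x = soft δ (w x) • fderiv ℝ w x := by
  rcases le_or_gt |w x| δ with h | h
  · rw [soft_eq_zero h, zero_smul, zero_smul]
  · congr 1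
    rcases lt_abs.1 h with h | h
    · have he : (fun y => soft δ (w y)) =ᶠ[𝓝 x] fun y => w y - δ := by
        filter_upwards [hw.continuousAt.eventually (lt_mem_nhds h)] with y hy
        exact soft_of_lt hδ.le hy
      rw [he.fderiv_eq, fderiv_sub_const]
    · have he : (fun y => soft δ (w y)) =ᶠ[𝓝 x] fun y => w y + δ := by
        filter_upwards [hw.continuousAt.eventually (gt_mem_nhds (lt_neg.1 h))] with y hy
        exact soft_of_lt_neg hδ.le hy
      rw [he.fderiv_eq, fderiv_add_const]

/-- With `t = soft δ w`, the integrand is almost everywhere `b · ∇(t² / 2)`. The function `t² / 2`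
is Lipschitz with support in `{δ ≤ |w|}`, a compact part of `Ω` because `w` vanishes outside `Ω`. -/
theorem integral_conv_soft (hΩo : IsOpen Ω) (hΩ : Bornology.IsBounded Ω) {b : Space d → Space d}
    (hb : ContinuousOn b (closure Ω)) (hsol : IsSolenoidal Ω b) {w : Space d → ℝ}
    (hw : IsLipZero Ω w) {δ : ℝ} (hδ : 0 < δ) :
    ∫ x in Ω, inner ℝ (b x) (gradient w x) * soft δ (w x) = 0 := by
  obtain ⟨C, hC⟩ := hw.1
  obtain ⟨M, hM⟩ := hw.exists_bound hΩ
  set t : Space d → ℝ := fun x => soft δ (w x) with ht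
  have htl : LipschitzWith (2 * C) t := (lipschitzWith_soft δ).comp hC
  have htM : ∀ x, |t x| ≤ M.toNNReal := fun x =>
    ((abs_soft_le hδ.le _).trans (hM x)).trans (Real.le_coe_toNNReal M)
  set g : Space d → ℝ := fun x => t x ^ 2 / 2 with hgdef
  have hg : LipschitzWith (M.toNNReal * (2 * C)) g := by
    refine LipschitzWith.of_dist_le_mul fun x y => ?_
    have h1 := htl.dist_le_mul x y
    rw [Real.dist_eq] at h1 ⊢
    have e : g x - g y = (t x + t y) / 2 * (t x - t y) := by simp only [hgdef]; ring
    have h2 : |(t x + t y) / 2| ≤ M.toNNReal := by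
      rw [abs_div, abs_two, div_le_iff₀ two_pos]
      linarith [abs_add_le (t x) (t y), htM x, htM y]
    rw [e, abs_mul, NNReal.coe_mul, mul_assoc]
    exact mul_le_mul h2 h1 (abs_nonneg _) (NNReal.coe_nonneg _)
  have hsub : tsupport g ⊆ {x | δ ≤ |w x|} := by
    refine closure_minimal (fun x hx => ?_) (isClosed_le continuous_const hw.continuous.abs)
    by_contra hlt
    rw [mem_ofPred_eq, not_le] at hlt
    exact hx (by simp [hgdef, ht, soft_eq_zero hlt.le])
  have hsubΩ : {x | δ ≤ |w x|} ⊆ Ω := fun x hx => by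
    by_contra hxΩ
    rw [mem_ofPred_eq, hw.2 x hxΩ, abs_zero] at hx
    linarith
  have hgc : HasCompactSupport g :=
    hΩ.isCompact_closure.of_isClosed_subset (isClosed_tsupport g)
      ((hsub.trans hsubΩ).trans subset_closure)
  rw [← hsol.integral_inner_gradient hΩo hΩ hb hg hgc (hsub.trans hsubΩ)]
  refine integral_congr_ae (ae_restrict_of_ae ?_)
  filter_upwards [htl.ae_differentiableAt] with x hx
  rw [real_inner_gradient_right, real_inner_gradient_right]
  have h1 : HasFDerivAt g (t x • fderiv ℝ t x) x := by
    have := (hx.hasFDerivAt.pow 2).mul_const (1 / 2 : ℝ)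
    convert! this using 1
    · ext y; simp [hgdef]; ring
    · ext y; simp; ring
  rw [h1.fderiv, soft_smul_fderiv hw.continuous hδ]
  simp [mul_comm]

/-- Convection by a solenoidal field is skew-symmetric. -/
theorem convForm_self (hΩo : IsOpen Ω) (hΩ : Bornology.IsBounded Ω) {b : Space d → Space d}
    (hb : ContinuousOn b (closure Ω)) (hsol : IsSolenoidal Ω b) {w : Space d → ℝ}
    (hw : IsLipZero Ω w) : convForm Ω b w w = 0 := by
  -- The thresholds `δ = 1 / (n + 1)` tend to zero; `|soft δ s| ≤ |s|` supplies the dominating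
  -- function.
  have hT : Tendsto (fun n : ℕ => ∫ x in Ω,
      inner ℝ (b x) (gradient w x) * soft (1 / ((n : ℝ) + 1)) (w x)) atTop
      (𝓝 (convForm Ω b w w)) := by
    have hbm : AEStronglyMeasurable b (volume.restrict Ω) :=
      (hb.mono subset_closure).aestronglyMeasurable hΩo.measurableSet
    refine tendsto_integral_of_dominated_convergence
      (fun x => ‖inner ℝ (b x) (gradient w x) * w x‖)
      (fun n => (hbm.inner (measurable_gradient w).aestronglyMeasurable).mul
        ((continuous_soft _).comp hw.continuous).aestronglyMeasurable)
      (hw.integrable_conv hΩo hΩ hb hw).norm (fun n => Eventually.of_forall fun x => ?_)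
      (Eventually.of_forall fun x => ?_)
    · rw [norm_mul, norm_mul]
      exact mul_le_mul_of_nonneg_left (abs_soft_le (by positivity) _) (norm_nonneg _)
    · refine Tendsto.const_mul _ ?_
      rw [tendsto_iff_dist_tendsto_zero]
      exact squeeze_zero (fun _ => dist_nonneg)
        (fun n => abs_soft_sub_le (by positivity) _) tendsto_one_div_add_atTop_nhds_zero_nat
  refine tendsto_nhds_unique hT (tendsto_const_nhds.congr fun n => ?_)
  exact (integral_conv_soft hΩo hΩ hb hsol hw (by positivity)).symm

end LipZero

/-! ### Geometry of the elements -/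

namespace CellKind

variable {d : ℕ}

/-- The affine functions whose nonnegativity describes the reference element. -/
def con (κ : CellKind) (i : Bool × Fin d) (y : Fin d → ℝ) : ℝ :=
  match κ, i with
  | _, (true, j) => y j
  | .simplex, (false, _) => 1 - ∑ l, y l
  | .parallelotope, (false, j) => 1 - y j

@[simp] theorem con_true (κ : CellKind) (j : Fin d) (y : Fin d → ℝ) : κ.con (true, j) y = y j := by
  cases κ <;> rfl

/-- No signs are imposed on the weights: prolonging a segment beyond its end uses a negative one. -/
theorem con_combination (κ : CellKind) (i : Bool × Fin d) (y w : Fin d → ℝ) {a b : ℝ}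
    (hab : a + b = 1) : κ.con i (a • y + b • w) = a * κ.con i y + b * κ.con i w := by
  obtain ⟨_ | _, j⟩ := i
  · cases κ
    · simp only [con, Pi.add_apply, Pi.smul_apply, smul_eq_mul, Finset.sum_add_distrib,
        ← Finset.mul_sum]
      linear_combination -hab
    · simp only [con, Pi.add_apply, Pi.smul_apply, smul_eq_mul]
      linear_combination -hab
  · simp

theorem continuous_con (κ : CellKind) (i : Bool × Fin d) : Continuous (κ.con i) := by
  obtain ⟨_ | _, j⟩ := i
  · cases κ
    · change Continuous fun y : Fin d → ℝ => 1 - ∑ l, y l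
      fun_prop
    · change Continuous fun y : Fin d → ℝ => 1 - y j
      fun_prop
  · have : κ.con (true, j) = fun y => y j := funext (κ.con_true j)
    rw [this]; fun_prop

theorem mem_ref_iff (κ : CellKind) (y : Fin d → ℝ) : y ∈ κ.ref d ↔ ∀ i, 0 ≤ κ.con i y := by
  constructor
  · rintro h ⟨_ | _, j⟩
    · cases κ
      · exact sub_nonneg.2 h.2
      · exact sub_nonneg.2 (h j).2
    · rw [con_true]
      cases κ
      · exact h.1 j
      · exact (h j).1
  · intro h
    cases κ
    · refine ⟨fun j => by simpa using h (true, j), ?_⟩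
      -- In dimension 0 no index carries the sum constraint, but it then reads `0 ≤ 1`.
      rcases isEmpty_or_nonempty (Fin d) with hd | ⟨⟨j⟩⟩
      · simp
      · exact sub_nonneg.1 (h (false, j))
    · exact fun j => ⟨by simpa using h (true, j), sub_nonneg.1 (h (false, j))⟩

theorem le_one_of_mem_ref (κ : CellKind) {y : Fin d → ℝ} (hy : y ∈ κ.ref d) (j : Fin d) :
    y j ≤ 1 := by
  cases κ
  · exact (Finset.single_le_sum (fun i _ => hy.1 i) (Finset.mem_univ j)).trans hy.2
  · exact (hy j).2

theorem nonneg_of_mem_ref (κ : CellKind) {y : Fin d → ℝ} (hy : y ∈ κ.ref d) (j : Fin d) :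
    0 ≤ y j := by simpa using (κ.mem_ref_iff y).1 hy (true, j)

theorem convex_ref (κ : CellKind) : Convex ℝ (κ.ref d) := by
  intro y hy w hw a b ha hb hab
  rw [mem_ref_iff] at *
  intro i
  rw [con_combination _ _ _ _ hab]
  exact add_nonneg (mul_nonneg ha (hy i)) (mul_nonneg hb (hw i))

theorem isCompact_ref (κ : CellKind) : IsCompact (κ.ref d) := by
  refine (isCompact_Icc (a := (0 : Fin d → ℝ)) (b := 1)).of_isClosed_subset ?_ fun y hy =>
    ⟨fun j => κ.nonneg_of_mem_ref hy j, fun j => κ.le_one_of_mem_ref hy j⟩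
  have : κ.ref d = ⋂ i, {y | 0 ≤ κ.con i y} := by
    ext y; simp [mem_ref_iff]
  rw [this]
  exact isClosed_iInter fun i => isClosed_le continuous_const (κ.continuous_con i)

theorem nonempty_interior_ref (κ : CellKind) : (interior (κ.ref d)).Nonempty := by
  have hopen : IsOpen (⋂ i, {y : Fin d → ℝ | 0 < κ.con i y}) :=
    isOpen_iInter_of_finite fun i => isOpen_lt continuous_const (κ.continuous_con i)
  refine ⟨fun _ => 1 / ((d : ℝ) + 1), mem_interior.2 ⟨_, ?_, hopen, ?_⟩⟩
  · intro y hy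
    rw [mem_ref_iff]
    exact fun i => (mem_iInter.1 hy i).le
  · refine mem_iInter.2 fun i => ?_
    have hd : (0 : ℝ) < (d : ℝ) + 1 := by positivity
    obtain ⟨_ | _, j⟩ := i
    · have hd1 : (0 : ℝ) < d := by exact_mod_cast j.pos
      cases κ
      · change 0 < 1 - ∑ _ : Fin d, 1 / ((d : ℝ) + 1)
        rw [Finset.sum_const, Finset.card_univ, Fintype.card_fin, nsmul_eq_mul, sub_pos,
          mul_one_div, div_lt_one hd]
        linarith
      · change 0 < 1 - 1 / ((d : ℝ) + 1)
        rw [sub_pos, div_lt_one hd]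
        linarith
    · change 0 < κ.con (true, j) _
      rw [con_true]
      positivity

/-- If `w` lies in every facet of the reference element that contains `y`, the segment from `w` to
`y` can be prolonged within the reference element. -/
theorem exists_prolongation (κ : CellKind) {y w : Fin d → ℝ} (hy : y ∈ κ.ref d)
    (h : ∀ i, κ.con i y = 0 → κ.con i w = 0) :
    ∃ w' ∈ κ.ref d, y ∈ openSegment ℝ w w' := by
  rw [mem_ref_iff] at hy
  -- The end point sought is `y + ε (y - w)`. A constraint that is zero at `y` is zero at `w`, hence
  -- on the whole line; one that is positive at `y` stays positive for small `ε`.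
  have hev : ∀ᶠ ε : ℝ in nhdsWithin 0 (Ioi 0), ∀ i, 0 ≤ κ.con i ((1 + ε) • y + (-ε) • w) := by
    rw [Filter.eventually_all]
    intro i
    rcases (hy i).eq_or_lt with h0 | hpos
    · filter_upwards with ε
      rw [con_combination _ _ _ _ (by ring), h i h0.symm, ← h0]
      simp
    · have hc : Continuous fun ε : ℝ => κ.con i ((1 + ε) • y + (-ε) • w) :=
        (κ.continuous_con i).comp (by fun_prop)
      have h0 : 0 < κ.con i ((1 + (0 : ℝ)) • y + (-(0 : ℝ)) • w) := by simpa using hpos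
      filter_upwards [(hc.tendsto 0).eventually (lt_mem_nhds h0) |>.filter_mono nhdsWithin_le_nhds]
        with ε hε using hε.le
  obtain ⟨ε, hε, hε0⟩ := (hev.and self_mem_nhdsWithin).exists
  refine ⟨_, (κ.mem_ref_iff _).2 hε, ε / (1 + ε), 1 / (1 + ε), by positivity, by positivity,
    by field_simp; ring, ?_⟩
  ext j
  simp only [Pi.add_apply, Pi.smul_apply, smul_eq_mul]
  field_simp
  ring

/-- The vertices of the reference elements. -/
def vertices (d : ℕ) : CellKind → Set (Fin d → ℝ)
  | .simplex => range fun o : Option (Fin d) => o.elim 0 fun j => Pi.single j 1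
  | .parallelotope => {y | ∀ j, y j = 0 ∨ y j = 1}

theorem vertices_subset_ref (κ : CellKind) : κ.vertices d ⊆ κ.ref d := by
  cases κ
  · rintro _ ⟨_ | j, rfl⟩
    · exact ⟨fun _ => le_rfl, by simp⟩
    · refine ⟨fun l => ?_, by simp⟩
      simp only [Option.elim]
      by_cases h : l = j
      · subst h; simp
      · simp [h]
  · intro y hy j
    rcases hy j with h | h <;> simp [h]

theorem eq_zero_or_one_of_mem_vertices (κ : CellKind) {y : Fin d → ℝ} (hy : y ∈ κ.vertices d)
    (j : Fin d) : y j = 0 ∨ y j = 1 := by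
  cases κ
  · obtain ⟨_ | l, rfl⟩ := hy
    · exact Or.inl rfl
    · simp only [Option.elim]
      by_cases h : j = l
      · subst h; simp
      · simp [h]
  · exact hy j

/-- The numbers 0 and 1 are extreme points of the unit interval. -/
theorem eq_zero_or_one_of_openSegment {a b s t : ℝ} (ha : 0 ≤ a) (ha1 : a ≤ 1) (hb : 0 ≤ b)
    (hb1 : b ≤ 1) (hs : 0 < s) (ht : 0 < t) (hst : s + t = 1)
    (h : s * a + t * b = 0 ∨ s * a + t * b = 1) : a = s * a + t * b := by
  rcases h with h | h
  · have h1 : 0 ≤ s * a := by positivity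
    have h2 : 0 ≤ t * b := by positivity
    have h3 : s * a = 0 := by linarith
    rw [h]
    exact (mul_eq_zero.1 h3).resolve_left hs.ne'
  · have h1 : 0 ≤ s * (1 - a) := mul_nonneg hs.le (by linarith)
    have h2 : 0 ≤ t * (1 - b) := mul_nonneg ht.le (by linarith)
    have h3 : s * (1 - a) = 0 := by nlinarith
    have := (mul_eq_zero.1 h3).resolve_left hs.ne'
    linarith

/-- A point of the simplex with `y j ≠ 0` lies inside a segment starting at the `j`-th unit vector;
a point of the cube with `y j` strictly between 0 and 1 lies inside one starting where this
coordinate is 0. Conversely, coordinates 0 and 1 are extreme one by one. -/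
theorem extremePoints_ref (κ : CellKind) : (κ.ref d).extremePoints ℝ = κ.vertices d := by
  refine Subset.antisymm ?_ fun y hy => ⟨κ.vertices_subset_ref hy, ?_⟩
  · rintro y ⟨hy, hext⟩
    cases κ
    · by_cases hz : ∃ j, y j ≠ 0
      · obtain ⟨j, hj⟩ := hz
        have hw : (Pi.single j 1 : Fin d → ℝ) ∈ ref d .simplex :=
          vertices_subset_ref .simplex ⟨some j, rfl⟩
        obtain ⟨w', hw', hseg⟩ := exists_prolongation .simplex (w := Pi.single j 1) hy (by
          rintro ⟨_ | _, l⟩ hi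
          · simp [con]
          · rw [con_true] at hi ⊢
            rcases eq_or_ne l j with rfl | hl
            · exact absurd hi hj
            · simp [hl])
        exact ⟨some j, hext hw hw' hseg⟩
      · push Not at hz
        exact ⟨none, funext fun j => (hz j).symm⟩
    · intro j
      by_contra! hj
      have hw : Function.update y j 0 ∈ ref d .parallelotope := fun l => by
        rcases eq_or_ne l j with rfl | hl
        · simp
        · simpa [hl] using hy l
      obtain ⟨w', hw', hseg⟩ := exists_prolongation .parallelotope
        (w := Function.update y j 0) hy (by
        rintro ⟨_ | _, l⟩ hi
        · simp only [con] at hi ⊢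
          rcases eq_or_ne l j with rfl | hl
          · exact absurd (by linarith) hj.2
          · simpa [hl] using hi
        · rw [con_true] at hi ⊢
          rcases eq_or_ne l j with rfl | hl
          · exact absurd hi hj.1
          · simpa [hl] using hi)
      have := congrFun (hext hw hw' hseg) j
      exact hj.1 (by simpa using this.symm)
  · rintro a ha b hb ⟨s, t, hs, ht, hst, rfl⟩
    ext j
    exact eq_zero_or_one_of_openSegment (κ.nonneg_of_mem_ref ha j) (κ.le_one_of_mem_ref ha j)
      (κ.nonneg_of_mem_ref hb j) (κ.le_one_of_mem_ref hb j) hs ht hst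
      (κ.eq_zero_or_one_of_mem_vertices hy j)

end CellKind

namespace Cell

variable {d : ℕ}

/-- The edges of a cell as a basis. -/
def basis (K : Cell d) : Module.Basis (Fin d) ℝ (Space d) :=
  basisOfLinearIndependentOfCardEqFinrank' K.edge K.indep (by simp)

theorem basis_apply (K : Cell d) (j : Fin d) : K.basis j = K.edge j := by
  simp [basis]

/-- The parametrisation of a cell as an affine equivalence. -/
def aff (K : Cell d) : (Fin d → ℝ) ≃ᵃ[ℝ] Space d :=
  K.basis.equivFun.symm.toAffineEquiv.trans (AffineEquiv.constVAdd ℝ (Space d) K.origin)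

@[simp] theorem aff_apply (K : Cell d) (y : Fin d → ℝ) : K.aff y = K.map y := by
  simp [aff, map, Module.Basis.equivFun_symm_apply, basis_apply]

/-- Reference coordinates. -/
def coord (K : Cell d) (x : Space d) : Fin d → ℝ := K.aff.symm x

@[simp] theorem coord_map (K : Cell d) (y : Fin d → ℝ) : K.coord (K.map y) = y := by
  rw [← aff_apply, coord, AffineEquiv.symm_apply_apply]

@[simp] theorem map_coord (K : Cell d) (x : Space d) : K.map (K.coord x) = x := by
  rw [← aff_apply, coord, AffineEquiv.apply_symm_apply]

theorem continuous_map (K : Cell d) : Continuous K.map := by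
  unfold map; fun_prop

theorem continuous_coord (K : Cell d) : Continuous K.coord :=
  K.aff.symm.toAffineMap.continuous_of_finiteDimensional

theorem contDiff_coord (K : Cell d) : ContDiff ℝ ∞ K.coord :=
  (⟨K.aff.symm.toAffineMap, K.continuous_coord⟩ : Space d →ᴬ[ℝ] (Fin d → ℝ)).contDiff

theorem map_combination (K : Cell d) (y w : Fin d → ℝ) {a b : ℝ} (hab : a + b = 1) :
    K.map (a • y + b • w) = a • K.map y + b • K.map w := by
  rw [← aff_apply, ← aff_apply, ← aff_apply]
  exact Convex.combo_affine_apply (f := K.aff.toAffineMap) hab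

theorem coord_combination (K : Cell d) (x z : Space d) {a b : ℝ} (hab : a + b = 1) :
    K.coord (a • x + b • z) = a • K.coord x + b • K.coord z :=
  Convex.combo_affine_apply (f := K.aff.symm.toAffineMap) hab

theorem mem_carrier_iff (K : Cell d) (x : Space d) : x ∈ K.carrier ↔ K.coord x ∈ K.kind.ref d := by
  constructor
  · rintro ⟨y, hy, rfl⟩; simpa using hy
  · exact fun h => ⟨_, h, K.map_coord x⟩

theorem map_mem_carrier {K : Cell d} {y : Fin d → ℝ} (hy : y ∈ K.kind.ref d) :
    K.map y ∈ K.carrier := ⟨y, hy, rfl⟩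

theorem map_mem_openSegment (K : Cell d) {y a b : Fin d → ℝ} (h : y ∈ openSegment ℝ a b) :
    K.map y ∈ openSegment ℝ (K.map a) (K.map b) := by
  obtain ⟨s, t, hs, ht, hst, rfl⟩ := h
  exact ⟨s, t, hs, ht, hst, (K.map_combination _ _ hst).symm⟩

theorem coord_mem_openSegment (K : Cell d) {x a b : Space d} (h : x ∈ openSegment ℝ a b) :
    K.coord x ∈ openSegment ℝ (K.coord a) (K.coord b) := by
  obtain ⟨s, t, hs, ht, hst, rfl⟩ := h
  exact ⟨s, t, hs, ht, hst, (K.coord_combination _ _ hst).symm⟩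

theorem isCompact_carrier (K : Cell d) : IsCompact K.carrier :=
  K.kind.isCompact_ref.image K.continuous_map

theorem convex_carrier (K : Cell d) : Convex ℝ K.carrier := by
  rw [carrier, show K.map = K.aff.toAffineMap from funext fun y => (K.aff_apply y).symm]
  exact K.kind.convex_ref.affine_image _

theorem nonempty_interior_carrier (K : Cell d) : (interior K.carrier).Nonempty := by
  obtain ⟨y, hy⟩ := K.kind.nonempty_interior_ref (d := d)
  let e : (Fin d → ℝ) ≃ₜ Space d :=
    ⟨K.aff.toEquiv, by
      change Continuous fun y => K.aff y
      simpa only [aff_apply] using K.continuous_map,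
      K.continuous_coord⟩
  have he : ⇑e = K.map := funext fun y => K.aff_apply y
  refine ⟨K.map y, ?_⟩
  rw [carrier, ← he, ← e.image_interior]
  exact mem_image_of_mem _ hy

theorem closure_interior_carrier (K : Cell d) : closure (interior K.carrier) = K.carrier := by
  rw [K.convex_carrier.closure_interior_eq_closure_of_nonempty_interior K.nonempty_interior_carrier,
    K.isCompact_carrier.isClosed.closure_eq]

theorem extremePoints_carrier (K : Cell d) :
    K.carrier.extremePoints ℝ = {x | K.coord x ∈ K.kind.vertices d} := by
  rw [← K.kind.extremePoints_ref]
  ext x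
  constructor
  · rintro ⟨hx, h⟩
    refine ⟨(K.mem_carrier_iff x).1 hx, fun a ha b hb hseg => ?_⟩
    rw [← K.coord_map a, ← h (map_mem_carrier ha) (map_mem_carrier hb)
      (by simpa using K.map_mem_openSegment hseg)]
  · rintro ⟨hx, h⟩
    refine ⟨(K.mem_carrier_iff x).2 hx, fun a ha b hb hseg => ?_⟩
    rw [← K.map_coord a, h ((K.mem_carrier_iff a).1 ha) ((K.mem_carrier_iff b).1 hb)
      (K.coord_mem_openSegment hseg), K.map_coord]

theorem coord_sum (K : Cell d) {ι : Type*} (s : Finset ι) (w : ι → ℝ) (hw : ∑ i ∈ s, w i = 1)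
    (W : ι → Space d) : K.coord (∑ i ∈ s, w i • W i) = ∑ i ∈ s, w i • K.coord (W i) := by
  rw [← Finset.affineCombination_eq_linear_combination _ _ _ hw,
    ← Finset.affineCombination_eq_linear_combination _ _ _ hw]
  exact s.map_affineCombination W w hw K.aff.symm.toAffineMap

/-- A weighted mean of vertices whose weights are multiples of `1 / k` is a node. -/
theorem sum_mem_nodes (K : Cell d) {k : ℕ} (hk : 1 ≤ k) {ι : Type*} [Fintype ι] (c : ι → ℕ)
    (W : ι → Space d) (hW : ∀ i, c i ≠ 0 → W i ∈ K.carrier.extremePoints ℝ) (hc : ∑ i, c i = k) :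
    ∑ i, ((c i : ℝ) / k) • W i ∈ K.nodes k := by
  have hk0 : (k : ℝ) ≠ 0 := by positivity
  have hw : ∑ i, (c i : ℝ) / k = 1 := by
    rw [← Finset.sum_div, ← Nat.cast_sum, hc, div_self hk0]
  -- Vertices have coordinates 0 or 1, so the numerators over `k` are integers.
  have hint : ∀ i j, ∃ m : ℕ, (m : ℝ) = c i * K.coord (W i) j := by
    intro i j
    by_cases hi : c i = 0
    · exact ⟨0, by simp [hi]⟩
    · have := hW i hi
      rw [extremePoints_carrier] at this
      rcases K.kind.eq_zero_or_one_of_mem_vertices this j with h | h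
      · exact ⟨0, by simp [h]⟩
      · exact ⟨c i, by simp [h]⟩
  choose m hm using hint
  have hco : K.coord (∑ i, ((c i : ℝ) / k) • W i) = fun j => ((∑ i, m i j : ℕ) : ℝ) / k := by
    rw [K.coord_sum _ _ hw]
    ext j
    simp only [Finset.sum_apply, Pi.smul_apply, smul_eq_mul, Nat.cast_sum, hm, Finset.sum_div]
    exact Finset.sum_congr rfl fun i _ => by ring
  refine ⟨fun j => ∑ i, m i j, ?_, by rw [← hco, K.map_coord]⟩
  rw [← hco, K.coord_sum _ _ hw]
  -- Points of weight zero need not lie in the cell; they are dropped before convexity is used.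
  have hsupp : ∑ i, ((c i : ℝ) / k) • K.coord (W i)
      = ∑ i with c i ≠ 0, ((c i : ℝ) / k) • K.coord (W i) := by
    refine (Finset.sum_filter_of_ne (p := fun i => c i ≠ 0) fun i _ hi h => hi ?_).symm
    simp [h]
  have hw' : ∑ i with c i ≠ 0, (c i : ℝ) / k = 1 := by
    rw [← hw]
    refine Finset.sum_filter_of_ne (p := fun i => c i ≠ 0) fun i _ hi h => hi ?_
    simp [h]
  rw [hsupp]
  refine K.kind.convex_ref.sum_mem (fun i _ => by positivity) hw' fun i hi => ?_
  exact (K.mem_carrier_iff _).1 (hW i (Finset.mem_filter.1 hi).2).1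

/-- The vertices of a simplex. -/
def vertex (K : Cell d) (o : Option (Fin d)) : Space d :=
  K.map (o.elim 0 fun j => Pi.single j 1)

theorem vertex_mem_extremePoints {K : Cell d} (hK : K.kind = .simplex) (o : Option (Fin d)) :
    K.vertex o ∈ K.carrier.extremePoints ℝ := by
  rw [extremePoints_carrier]
  change K.coord (K.vertex o) ∈ K.kind.vertices d
  rw [vertex, coord_map, hK]
  exact ⟨o, rfl⟩

theorem map_eq_sum_vertex (K : Cell d) (y : Fin d → ℝ) :
    K.map y = (1 - ∑ j, y j) • K.vertex none + ∑ j, y j • K.vertex (some j) := by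
  have h : ∀ j, K.vertex (some j) = K.origin + K.edge j := by
    intro j
    simp [vertex, map, Pi.single_apply, ite_smul]
  have h0 : K.vertex none = K.origin := by simp [vertex, map]
  simp only [h, h0, map, smul_add, Finset.sum_add_distrib, ← Finset.sum_smul, sub_smul, one_smul]
  abel

/-- Every node is such a mean. -/
theorem exists_sum_of_mem_nodes (K : Cell d) {k : ℕ} (hk : 1 ≤ k) {x : Space d}
    (hx : x ∈ K.nodes k) : ∃ (n : ℕ) (c : Fin n → ℕ) (W : Fin n → Space d),
      (∀ i, W i ∈ K.carrier.extremePoints ℝ) ∧ ∑ i, c i = k ∧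
      x = ∑ i, ((c i : ℝ) / k) • W i := by
  have hk0 : (0 : ℝ) < k := by positivity
  suffices ∃ (ι : Type) (_ : Fintype ι) (c : ι → ℕ) (W : ι → Space d),
      (∀ i, W i ∈ K.carrier.extremePoints ℝ) ∧ ∑ i, c i = k ∧
      x = ∑ i, ((c i : ℝ) / k) • W i by
    obtain ⟨ι, _, c, W, hW, hc, hx⟩ := this
    let e := (Fintype.equivFin ι).symm
    exact ⟨_, c ∘ e, W ∘ e, fun i => hW _, by rw [← hc]; exact e.sum_comp c,
      by rw [hx]; exact (e.sum_comp fun i => ((c i : ℝ) / k) • W i).symm⟩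
  obtain ⟨a, ha, rfl⟩ := hx
  cases hK : K.kind
  · rw [hK] at ha
    have hle : ∑ j, a j ≤ k := by
      have h := ha.2
      rw [← Finset.sum_div, div_le_one hk0] at h
      exact_mod_cast h
    refine ⟨Option (Fin d), inferInstance, fun o => o.elim (k - ∑ j, a j) a, K.vertex,
      vertex_mem_extremePoints hK, ?_, ?_⟩
    · rw [Fintype.sum_option]
      simp only [Option.elim]
      omega
    · rw [Fintype.sum_option, map_eq_sum_vertex]
      simp only [Option.elim]
      rw [← Finset.sum_div, Nat.cast_sub hle, sub_div, div_self hk0.ne', Nat.cast_sum]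
  · rw [hK] at ha
    have hak : ∀ j, a j ≤ k := fun j => by
      have h := (ha j).2
      rw [div_le_one hk0] at h
      exact_mod_cast h
    -- The node is cut into `k` layers: the `i`-th vertex has coordinate 1 in direction `j` exactly
    -- when `i < a j`. Averaging the layers gives `a j / k`.
    refine ⟨Fin k, inferInstance, fun _ => 1,
      fun i => K.map fun j => if (i : ℕ) < a j then 1 else 0, fun i => ?_, by simp, ?_⟩
    · rw [extremePoints_carrier]
      change K.coord _ ∈ K.kind.vertices d
      rw [coord_map, hK]
      intro j
      by_cases h : (i : ℕ) < a j <;> simp [h]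
    · have hw : ∑ _ : Fin k, ((1 : ℕ) : ℝ) / k = 1 := by simp [hk0.ne']
      refine K.aff.symm.injective ?_
      change K.coord _ = K.coord _
      rw [K.coord_sum _ _ hw]
      ext j
      simp only [coord_map, Finset.sum_apply, Pi.smul_apply, smul_eq_mul, mul_ite, mul_one,
        mul_zero, Nat.cast_one]
      rw [Fin.sum_univ_eq_sum_range (fun i => if i < a j then 1 / (k : ℝ) else 0) k,
        ← Finset.sum_filter]
      have : (Finset.range k).filter (fun i => i < a j) = Finset.range (a j) := by
        ext i; simp only [Finset.mem_filter, Finset.mem_range]; have := hak j; omega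
      rw [this, Finset.sum_const, Finset.card_range, nsmul_eq_mul]
      ring

/-- If a weighted mean of points of `A` lies in an exposed face, so do the points. -/
theorem mem_of_sum_mem_isExposed {E : Type*} [NormedAddCommGroup E] [NormedSpace ℝ E]
    {A B : Set E} (hAB : IsExposed ℝ A B) {ι : Type*} (s : Finset ι) (w : ι → ℝ) (W : ι → E)
    (hw : ∀ i ∈ s, 0 ≤ w i) (hw1 : ∑ i ∈ s, w i = 1) (hW : ∀ i ∈ s, W i ∈ A)
    (hB : ∑ i ∈ s, w i • W i ∈ B) {i : ι} (hi : i ∈ s) (hpos : w i ≠ 0) : W i ∈ B := by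
  obtain ⟨l, rfl⟩ := hAB ⟨_, hB⟩
  obtain ⟨_, hmax⟩ := hB
  set m := l (∑ i ∈ s, w i • W i) with hm
  have hsum : ∑ i ∈ s, w i * (m - l (W i)) = 0 := by
    simp only [mul_sub, Finset.sum_sub_distrib, ← Finset.sum_mul, hw1, one_mul]
    rw [hm, map_sum]
    simp
  have h0 := (Finset.sum_eq_zero_iff_of_nonneg fun i hi =>
    mul_nonneg (hw i hi) (sub_nonneg.2 (hmax _ (hW i hi)))).1 hsum i hi
  have h1 : m = l (W i) := sub_eq_zero.1 ((mul_eq_zero.1 h0).resolve_left hpos)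
  exact ⟨hW i hi, fun y hy => (hmax y hy).trans h1.le⟩

/-- The nodes on a common face of two cells are the same for both cells. -/
theorem mem_nodes_of_mem_inter {K K' : Cell d}
    (h : IsExposed ℝ K.carrier (K.carrier ∩ K'.carrier))
    (h' : IsExposed ℝ K'.carrier (K.carrier ∩ K'.carrier)) {k : ℕ} (hk : 1 ≤ k) {x : Space d}
    (hx : x ∈ K.nodes k) (hx' : x ∈ K'.carrier) : x ∈ K'.nodes k := by
  have hk0 : (0 : ℝ) < k := by positivity
  have hxK : x ∈ K.carrier := by
    obtain ⟨a, ha, rfl⟩ := hx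
    exact map_mem_carrier ha
  obtain ⟨n, c, W, hW, hc, rfl⟩ := K.exists_sum_of_mem_nodes hk hx
  refine K'.sum_mem_nodes hk c W (fun i hi => ?_) hc
  have hw1 : ∑ i, (c i : ℝ) / k = 1 := by
    rw [← Finset.sum_div, ← Nat.cast_sum, hc, div_self hk0.ne']
  have hF : W i ∈ K.carrier ∩ K'.carrier :=
    mem_of_sum_mem_isExposed h Finset.univ (fun i => (c i : ℝ) / k) W
      (fun i _ => by positivity) hw1 (fun i _ => (hW i).1) ⟨hxK, hx'⟩ (Finset.mem_univ i)
      (by positivity)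
  -- A vertex of `K` on the common face is extreme in the face, and extreme points of a face of `K'`
  -- are extreme in `K'`.
  have h1 : W i ∈ (K.carrier ∩ K'.carrier).extremePoints ℝ := by
    rw [h.isExtreme.extremePoints_eq]
    exact ⟨hF, hW i⟩
  exact h'.isExtreme.extremePoints_subset_extremePoints h1

theorem nodes_subset_carrier (K : Cell d) (k : ℕ) : K.nodes k ⊆ K.carrier := by
  rintro _ ⟨a, ha, rfl⟩
  exact map_mem_carrier ha

end Cell

/-! ### Topology of the meshed domain -/

namespace Mesh

variable {d : ℕ} {Ω : Set (Space d)}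

theorem isOpen (P : Mesh Ω) : IsOpen Ω := P.interior_eq ▸ isOpen_interior

theorem isClosed_iUnion (P : Mesh Ω) : IsClosed (⋃ K ∈ P.cells, K.carrier) :=
  P.cells.finite_toSet.isClosed_biUnion fun K _ => K.isCompact_carrier.isClosed

/-- Each cell is the closure of its interior, which is contained in `Ω`; the union of the cells is
closed. Together with `interior_eq` this makes `Ω` the interior of its closure. -/
theorem closure_eq (P : Mesh Ω) : closure Ω = ⋃ K ∈ P.cells, K.carrier := by
  refine Subset.antisymm ?_ (iUnion₂_subset fun K hK => ?_)
  · refine closure_minimal ?_ P.isClosed_iUnion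
    conv_lhs => rw [← P.interior_eq]
    exact interior_subset
  · rw [← K.closure_interior_carrier]
    refine closure_mono ?_
    conv_rhs => rw [← P.interior_eq]
    exact interior_mono (subset_biUnion_of_mem (u := fun K : Cell d => K.carrier) hK)

theorem exists_cell (P : Mesh Ω) {x : Space d} (hx : x ∈ closure Ω) :
    ∃ K ∈ P.cells, x ∈ K.carrier := by
  rw [P.closure_eq] at hx
  simpa using hx

theorem carrier_subset (P : Mesh Ω) {K : Cell d} (hK : K ∈ P.cells) : K.carrier ⊆ closure Ω := by
  rw [P.closure_eq]
  exact subset_biUnion_of_mem (u := fun K : Cell d => K.carrier) hK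

theorem isBounded (P : Mesh Ω) : Bornology.IsBounded Ω := by
  refine Bornology.IsBounded.subset ?_ subset_closure
  rw [P.closure_eq]
  exact (Bornology.isBounded_biUnion P.cells.finite_toSet).2
    fun K _ => K.isCompact_carrier.isBounded

theorem isExposed_left (P : Mesh Ω) {K K' : Cell d} (hK : K ∈ P.cells) (hK' : K' ∈ P.cells) :
    IsExposed ℝ K'.carrier (K.carrier ∩ K'.carrier) := by
  rw [inter_comm]; exact P.conforming K' hK' K hK

/-- From an interior point of the domain one does not meet its boundary within an element, unless
at the end of a maximal segment. -/
theorem mem_of_mem_openSegment (P : Mesh Ω) {K : Cell d} (hK : K ∈ P.cells) {x w z : Space d}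
    (hx : x ∈ Ω) (hxK : x ∈ K.carrier) (hw : w ∈ K.carrier) (hz : z ∈ openSegment ℝ x w) :
    z ∈ Ω := by
  obtain ⟨s, t, hs, ht, hst, rfl⟩ := hz
  have hs' : s = 1 - t := by linarith
  subst hs'
  have hline : Filter.Tendsto (fun r : ℝ => (1 - r) • x + r • w) (nhdsWithin 0 (Ioi 0))
      (nhds x) := by
    have : Continuous fun r : ℝ => (1 - r) • x + r • w := by fun_prop
    simpa using (this.tendsto 0).mono_left nhdsWithin_le_nhds
  obtain ⟨r, ⟨hrΩ, hrt⟩, hr0⟩ := ((hline.eventually (P.isOpen.mem_nhds hx)).and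
    ((gt_mem_nhds ht).filter_mono nhdsWithin_le_nhds) |>.and self_mem_nhdsWithin).exists
  replace hr0 : 0 < r := hr0
  set z' := (1 - r) • x + r • w with hz'
  have hr1 : r < 1 := by linarith
  have hz'seg : z' ∈ openSegment ℝ x w := ⟨1 - r, r, by linarith, hr0, by ring, rfl⟩
  have hz'K : z' ∈ K.carrier := K.convex_carrier hxK hw (by linarith) hr0.le (by ring)
  -- The point `z'` lies between `x` and `z`, close enough to `x` to belong to `Ω`. It is inside the
  -- segment from `x` to `w`, so by extremality any cell through `z'` contains `w`.
  have hwmem : ∀ K' ∈ P.cells, z' ∈ K'.carrier → w ∈ K'.carrier := fun K' hK' hzK' =>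
    ((P.conforming K hK K' hK').isExtreme.right_mem_of_mem_openSegment hxK hw ⟨hz'K, hzK'⟩
      hz'seg).2
  have hev : ∀ᶠ p in nhds z', ∀ K' ∈ P.cells, p ∈ K'.carrier → z' ∈ K'.carrier := by
    rw [Filter.eventually_all_finset]
    intro K' _
    by_cases h : z' ∈ K'.carrier
    · exact Filter.Eventually.of_forall fun _ _ => h
    · filter_upwards [K'.isCompact_carrier.isClosed.isOpen_compl.mem_nhds h] with p hp hp'
      exact absurd hp' hp
  have hpos : 0 < 1 - r := by linarith
  -- With this value the homothety of centre `w` and ratio `1 - η` maps `z'` to `z`.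
  set η := (t - r) / (1 - r) with hη
  have hη0 : 0 < η := div_pos (by linarith) hpos
  have hη1 : 0 < 1 - η := by
    rw [hη, sub_pos, div_lt_one hpos]; linarith
  have hzz : (1 - η) • z' + η • w = (1 - t) • x + t • w := by
    have e1 : (1 - η) * (1 - r) = 1 - t := by rw [hη]; field_simp; ring
    have e2 : (1 - η) * r + η = t := by rw [hη]; field_simp; ring
    rw [hz', smul_add, smul_smul, smul_smul, add_assoc, ← add_smul, e1, e2]
  -- Points near `z'` lie in cells containing both `z'` and `w`, and convexity keeps their images
  -- under the homothety in the same cell. A neighbourhood of `z` is thus covered by cells.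
  have hcover : ∀ᶠ p in nhds z', (1 - η) • p + η • w ∈ closure Ω := by
    filter_upwards [hev, P.isOpen.mem_nhds hrΩ] with p hp hpΩ
    obtain ⟨K', hK', hpK'⟩ := P.exists_cell (subset_closure hpΩ)
    exact P.carrier_subset hK' (K'.convex_carrier hpK' (hwmem K' hK' (hp K' hK' hpK'))
      hη1.le hη0.le (by ring))
  have hint : (1 - t) • x + t • w ∈ interior (closure Ω) := by
    rw [mem_interior_iff_mem_nhds]
    have hinv : Filter.Tendsto (fun q : Space d => (1 - η)⁻¹ • (q - η • w))
        (nhds ((1 - t) • x + t • w)) (nhds z') := by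
      have hc : Continuous fun q : Space d => (1 - η)⁻¹ • (q - η • w) := by fun_prop
      have h := hc.tendsto ((1 - t) • x + t • w)
      rwa [← hzz, add_sub_cancel_right, smul_smul, inv_mul_cancel₀ hη1.ne', one_smul, hzz] at h
    filter_upwards [hinv.eventually hcover] with q hq
    rwa [smul_smul, mul_inv_cancel₀ hη1.ne', one_smul, sub_add_cancel] at hq
  rwa [P.closure_eq, P.interior_eq] at hint

end Mesh

/-! ### Polynomials -/

section Polynomials

open MvPolynomial

/-- The restriction of a polynomial to a line. -/
theorem exists_line_polynomial {σ : Type*} [Fintype σ] (q : MvPolynomial σ ℝ) (c u : σ → ℝ) {k : ℕ}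
    (h : ∀ m ∈ q.support, ∑ i, (if u i = 0 then 0 else m i) ≤ k) :
    ∃ p : Polynomial ℝ, p.natDegree ≤ k ∧ ∀ t : ℝ, p.eval t = eval (c + t • u) q := by
  refine ⟨∑ m ∈ q.support, Polynomial.C (q.coeff m)
    * ∏ i, (Polynomial.C (c i) + Polynomial.C (u i) * Polynomial.X) ^ m i, ?_, fun t => ?_⟩
  · refine Polynomial.natDegree_sum_le_of_forall_le _ _ fun m hm => ?_
    refine (Polynomial.natDegree_C_mul_le _ _).trans ((Polynomial.natDegree_prod_le _ _).trans
      ((Finset.sum_le_sum fun i _ => ?_).trans (h m hm)))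
    refine (Polynomial.natDegree_pow_le).trans ?_
    split_ifs with hi
    · simp [hi]
    · have : (Polynomial.C (c i) + Polynomial.C (u i) * Polynomial.X).natDegree ≤ 1 := by
        rw [add_comm]; exact Polynomial.natDegree_linear_le
      calc m i * _ ≤ m i * 1 := Nat.mul_le_mul_left _ this
        _ = m i := mul_one _
  · rw [eval_eq', Polynomial.eval_finsetSum]
    refine Finset.sum_congr rfl fun m _ => ?_
    simp only [Polynomial.eval_mul, Polynomial.eval_C, Polynomial.eval_prod, Polynomial.eval_pow,
      Polynomial.eval_add, Polynomial.eval_X, Pi.add_apply, Pi.smul_apply, smul_eq_mul, mul_comm t]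

theorem exists_line_polynomial_of_totalDegree {σ : Type*} [Fintype σ] (q : MvPolynomial σ ℝ)
    (c u : σ → ℝ) {k : ℕ} (h : q.totalDegree ≤ k) :
    ∃ p : Polynomial ℝ, p.natDegree ≤ k ∧ ∀ t : ℝ, p.eval t = eval (c + t • u) q := by
  refine exists_line_polynomial q c u fun m hm => ?_
  have hm' := (le_totalDegree hm).trans h
  rw [Finsupp.sum_fintype _ _ (fun _ => rfl)] at hm'
  refine (Finset.sum_le_sum fun i _ => ?_).trans hm'
  split_ifs <;> simp

/-- By `hu` at most one coordinate varies along the line, so the degree in that single variable is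
the bound. On a general line the degrees in the moving variables would add up. -/
theorem exists_line_polynomial_of_degreeOf {σ : Type*} [Fintype σ] (q : MvPolynomial σ ℝ)
    (c u : σ → ℝ) {k : ℕ} (h : ∀ j, q.degreeOf j ≤ k) (hu : ∀ i j, u i ≠ 0 → u j ≠ 0 → i = j) :
    ∃ p : Polynomial ℝ, p.natDegree ≤ k ∧ ∀ t : ℝ, p.eval t = eval (c + t • u) q := by
  refine exists_line_polynomial q c u fun m hm => ?_
  by_cases hex : ∃ i, u i ≠ 0
  · obtain ⟨i, hi⟩ := hex
    rw [Finset.sum_eq_single i (fun j _ hj => ?_) (by simp), if_neg hi]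
    · exact (monomial_le_degreeOf i hm).trans (h i)
    · rw [if_pos]
      by_contra hne
      exact hj (hu j i hne hi)
  · push Not at hex
    simp [hex]

/-- The pull-back of a polynomial by an affine map. -/
theorem exists_comp_affine {σ τ : Type*} [Fintype σ] [Fintype τ] (q : MvPolynomial σ ℝ)
    (f : (τ → ℝ) →ᵃ[ℝ] (σ → ℝ)) :
    ∃ q' : MvPolynomial τ ℝ, q'.totalDegree ≤ q.totalDegree ∧
      ∀ y, eval y q' = eval (f y) q := by
  classical
  let A : σ → MvPolynomial τ ℝ := fun i => C (f 0 i) + ∑ l, C (f.linear (Pi.single l 1) i) * X l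
  have hA : ∀ i, (A i).totalDegree ≤ 1 := fun i => by
    refine (totalDegree_add _ _).trans (max_le (by simp) ?_)
    refine totalDegree_finsetSum_le fun l _ => ?_
    refine (totalDegree_mul _ _).trans ?_
    simp
  have hAe : ∀ y i, eval y (A i) = f y i := by
    intro y i
    have h1 : f y = f.linear y + f 0 := congrFun (AffineMap.decomp f) y
    have h2 : f.linear y = ∑ l, y l • f.linear (Pi.single l 1) := by
      conv_lhs => rw [← Finset.univ_sum_single y, map_sum]
      refine Finset.sum_congr rfl fun l _ => ?_
      rw [← map_smul, ← Pi.single_smul, smul_eq_mul, mul_one]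
    rw [h1, h2]
    simp [A, Finset.sum_apply, add_comm, mul_comm]
  refine ⟨∑ m ∈ q.support, C (q.coeff m) * ∏ i, A i ^ m i, ?_, fun y => ?_⟩
  · refine totalDegree_finsetSum_le fun m hm => ?_
    refine (totalDegree_mul _ _).trans ?_
    rw [totalDegree_C, zero_add]
    refine (totalDegree_finsetProd _ _).trans (le_trans ?_ (le_totalDegree hm))
    rw [Finsupp.sum_fintype _ _ (fun _ => rfl)]
    refine Finset.sum_le_sum fun i _ => (totalDegree_pow _ _).trans ?_
    calc m i * _ ≤ m i * 1 := Nat.mul_le_mul_left _ (hA i)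
      _ = m i := mul_one _
  · rw [eval_eq' (f y) q, map_sum]
    refine Finset.sum_congr rfl fun m _ => ?_
    simp [hAe]

/-- A polynomial of degree at most `k` that vanishes on the principal lattice of order `k` of the
unit simplex is zero. -/
theorem eq_zero_of_vanishes_on_lattice {σ : Type*} [Fintype σ] (q : MvPolynomial σ ℝ) {k : ℕ}
    (hk : 1 ≤ k) (hq : q.totalDegree ≤ k)
    (h : ∀ a : σ → ℕ, ∑ i, a i ≤ k → eval (fun i => (a i : ℝ) / k) q = 0) : q = 0 := by
  classical
  by_contra hne
  have hk0 : (k : ℝ) ≠ 0 := by positivity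
  obtain ⟨t, ht, htd⟩ : ∃ t ∈ q.support, q.totalDegree = t.degree := by
    obtain ⟨t, ht, htd⟩ := Finset.exists_mem_eq_sup q.support
      (support_nonempty.2 hne) (fun s => s.sum fun _ e => e)
    exact ⟨t, ht, htd⟩
  have hinj : Function.Injective fun m : ℕ => (m : ℝ) / k := fun m m' hm => by
    have : (m : ℝ) / k = m' / k := hm
    rw [div_left_inj' hk0] at this
    exact_mod_cast this
  -- Combinatorial Nullstellensatz at a monomial `t` of top degree, on the grid `{0, …, t i} / k`:
  -- its points have coordinate sum at most `|t| / k ≤ 1`, so they belong to the lattice.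
  obtain ⟨s, hs, hs0⟩ := combinatorial_nullstellensatz_exists_eval_nonzero q t
    (mem_support_iff.1 ht) htd (fun i => (Finset.range (t i + 1)).image fun m : ℕ => (m : ℝ) / k)
    (fun i => by rw [Finset.card_image_of_injective _ hinj, Finset.card_range]; omega)
  have hs' : ∀ i, ∃ a : ℕ, a ≤ t i ∧ (a : ℝ) / k = s i := fun i => by
    obtain ⟨a, ha, has⟩ := Finset.mem_image.1 (hs i)
    exact ⟨a, Nat.lt_succ_iff.1 (Finset.mem_range.1 ha), has⟩
  choose a ha has using hs'
  refine hs0 ?_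
  rw [← funext has]
  refine h a ?_
  have : ∑ i, t i = t.degree := by rw [Finsupp.degree_eq_sum]
  calc ∑ i, a i ≤ ∑ i, t i := Finset.sum_le_sum fun i _ => ha i
    _ ≤ k := by rw [this, ← htd]; exact hq

/-- A univariate polynomial of degree at most `k` with zeros at `0, 1/k, …, 1` vanishes. -/
theorem polynomial_eq_zero_of_lattice {p : Polynomial ℝ} {k : ℕ} (hk : 1 ≤ k)
    (hp : p.natDegree ≤ k) (h : ∀ m : ℕ, m ≤ k → p.eval ((m : ℝ) / k) = 0) : p = 0 := by
  have hk0 : (k : ℝ) ≠ 0 := by positivity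
  refine Polynomial.eq_zero_of_natDegree_lt_card_of_eval_eq_zero p
    (f := fun m : Fin (k + 1) => ((m : ℕ) : ℝ) / k) (fun m m' hm => ?_)
    (fun m => h m (Nat.lt_succ_iff.1 m.2)) (by simpa using Nat.lt_succ_iff.2 hp)
  have : ((m : ℕ) : ℝ) / k = (m' : ℕ) / k := hm
  rw [div_left_inj' hk0] at this
  exact Fin.ext (by exact_mod_cast this)

end Polynomials

/-! ### Unisolvence on common faces -/

namespace Cell

variable {d : ℕ}

/-- The degree restriction in the definition of the shape functions. -/
def IsAdmissiblePoly (κ : CellKind) (k : ℕ) (q : MvPolynomial (Fin d) ℝ) : Prop :=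
  match κ with
  | .simplex => q.totalDegree ≤ k
  | .parallelotope => ∀ j, q.degreeOf j ≤ k

theorem isShape_iff (K : Cell d) (k : ℕ) (v : Space d → ℝ) :
    K.IsShape k v ↔ ∃ q : MvPolynomial (Fin d) ℝ, IsAdmissiblePoly K.kind k q ∧
      ∀ x ∈ K.carrier, v x = MvPolynomial.eval (K.coord x) q := by
  refine exists_congr fun q => and_congr Iff.rfl ⟨fun h x hx => ?_, fun h y hy => ?_⟩
  · have := h (K.coord x) ((K.mem_carrier_iff x).1 hx)
    rwa [map_coord] at this
  · rw [h _ (map_mem_carrier hy), coord_map]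

/-- The change of coordinates between two cells. -/
def trans (K K' : Cell d) : (Fin d → ℝ) →ᵃ[ℝ] (Fin d → ℝ) := (K.aff.trans K'.aff.symm).toAffineMap

theorem trans_apply (K K' : Cell d) (y : Fin d → ℝ) : K.trans K' y = K'.coord (K.map y) := by
  rw [← aff_apply]; rfl

theorem trans_add_smul (K K' : Cell d) (y u : Fin d → ℝ) (t : ℝ) :
    K.trans K' (y + t • u) = K.trans K' y + t • (K.trans K').linear u := by
  rw [add_comm y, ← vadd_eq_add, AffineMap.map_vadd, map_smul, vadd_eq_add, add_comm]

/-- The point `y` is inside a segment of `K` that starts at `w`, and the intersection is extreme in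
`K`. Hence the smallest face of `K` through `y` lies in `K'`. -/
theorem mem_of_con {K K' : Cell d} (h : IsExposed ℝ K.carrier (K.carrier ∩ K'.carrier))
    {y w : Fin d → ℝ} (hy : y ∈ K.kind.ref d) (hw : w ∈ K.kind.ref d)
    (hy' : K.map y ∈ K'.carrier) (hc : ∀ i, K.kind.con i y = 0 → K.kind.con i w = 0) :
    K.map w ∈ K'.carrier := by
  obtain ⟨w', hw', hseg⟩ := K.kind.exists_prolongation hy hc
  exact (h.isExtreme.left_mem_of_mem_openSegment (map_mem_carrier hw) (map_mem_carrier hw')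
    ⟨map_mem_carrier hy, hy'⟩ (K.map_mem_openSegment hseg)).2

/-- An edge direction of a common face of two parallelotopes is an edge direction of both. -/
theorem edge_parallel {K K' : Cell d} (hK : K.kind = .parallelotope)
    (hK' : K'.kind = .parallelotope) (h : IsExposed ℝ K.carrier (K.carrier ∩ K'.carrier))
    (h' : IsExposed ℝ K'.carrier (K.carrier ∩ K'.carrier)) {y : Fin d → ℝ}
    (hy : y ∈ K.kind.ref d) (hy' : K.map y ∈ K'.carrier) {j : Fin d} (hj0 : y j ≠ 0)
    (hj1 : y j ≠ 1) (i₁ i₂ : Fin d) (h₁ : (K.trans K').linear (Pi.single j 1) i₁ ≠ 0)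
    (h₂ : (K.trans K').linear (Pi.single j 1) i₂ ≠ 0) : i₁ = i₂ := by
  by_contra hne
  set u := (K.trans K').linear (Pi.single j 1) with hu
  -- An edge of `K` in direction `j`: rounding the other coordinates of `y` keeps it in every facet
  -- through `y`, so the whole edge lies in the common face.
  let p : ℝ → Fin d → ℝ := fun t i => if i = j then t else if y i = 1 then 1 else 0
  have hpref : ∀ t, 0 ≤ t → t ≤ 1 → p t ∈ K.kind.ref d := by
    intro t h0 h1
    rw [hK]
    intro i
    simp only [p]
    split_ifs <;> simp [h0, h1]
  have hp : ∀ t, 0 ≤ t → t ≤ 1 → K.map (p t) ∈ K'.carrier := by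
    intro t h0 h1
    refine mem_of_con h hy (hpref t h0 h1) hy' ?_
    rw [hK]
    rintro ⟨_ | _, l⟩ hl
    · simp only [CellKind.con, p] at hl ⊢
      have hl1 : y l = 1 := by linarith
      rw [if_neg (by rintro rfl; exact hj1 hl1), if_pos hl1, sub_self]
    · rw [CellKind.con_true] at hl ⊢
      simp only [p]
      rw [if_neg (by rintro rfl; exact hj0 hl), if_neg (by rw [hl]; norm_num)]
  have hpt : ∀ t, p t = p 0 + t • (Pi.single j 1 : Fin d → ℝ) := by
    intro t
    ext i
    by_cases hi : i = j
    · subst hi; simp [p]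
    · simp [p, hi]
  set a := K.trans K' (p 0) with ha
  have hψ : ∀ t, K.trans K' (p t) = a + t • u := fun t => by rw [hpt, trans_add_smul]
  have hcube : ∀ t : ℝ, 0 ≤ t → t ≤ 1 → ∀ i, 0 ≤ (a + t • u) i ∧ (a + t • u) i ≤ 1 := by
    intro t h0 h1
    have := (K'.mem_carrier_iff _).1 (hp t h0 h1)
    rw [← trans_apply, hψ, hK'] at this
    exact this
  have ha01 : ∀ i, 0 ≤ a i ∧ a i ≤ 1 := by simpa using hcube 0 le_rfl zero_le_one
  have hb01 : ∀ i, 0 ≤ a i + u i ∧ a i + u i ≤ 1 := by simpa using hcube 1 zero_le_one le_rfl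
  -- In the coordinates of `K'` the edge runs from `a` to `a + u`. Exchanging the `i₁`-th
  -- coordinates of its ends gives `r` and `r'`, still in the cube and with the same midpoint; by
  -- extremality both lie in the common face.
  set r := Function.update a i₁ (a i₁ + u i₁) with hr
  set r' := Function.update (a + u) i₁ (a i₁) with hr'
  have hrref : r ∈ K'.kind.ref d := by
    rw [hK']; intro i
    rcases eq_or_ne i i₁ with rfl | hi
    · simpa [hr] using hb01 i
    · simpa [hr, hi] using ha01 i
  have hrref' : r' ∈ K'.kind.ref d := by
    rw [hK']; intro i
    rcases eq_or_ne i i₁ with rfl | hi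
    · simpa [hr'] using ha01 i
    · simpa [hr', hi] using hb01 i
  have hmid : K.map (p (1 / 2)) ∈ openSegment ℝ (K'.map r) (K'.map r') := by
    have hm : (1 / 2 : ℝ) • r + (1 / 2 : ℝ) • r' = K.trans K' (p (1 / 2)) := by
      rw [hψ]
      ext i
      rcases eq_or_ne i i₁ with rfl | hi
      · simp [hr, hr']; ring
      · simp [hr, hr', hi]; ring
    refine ⟨1 / 2, 1 / 2, by norm_num, by norm_num, by norm_num, ?_⟩
    rw [← K'.map_combination _ _ (by norm_num), hm, trans_apply, map_coord]
  have hmF : K.map (p (1 / 2)) ∈ K.carrier ∩ K'.carrier :=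
    ⟨map_mem_carrier (hpref _ (by norm_num) (by norm_num)), hp _ (by norm_num) (by norm_num)⟩
  have hrF := h'.isExtreme.left_mem_of_mem_openSegment (map_mem_carrier hrref)
    (map_mem_carrier hrref') hmF hmid
  have hrF' := h'.isExtreme.right_mem_of_mem_openSegment (map_mem_carrier hrref)
    (map_mem_carrier hrref') hmF hmid
  have hs := (K.mem_carrier_iff _).1 hrF.1
  have hs' := (K.mem_carrier_iff _).1 hrF'.1
  set s := K.coord (K'.map r) with hsdef
  obtain ⟨σ, τ, hσ, hτ, hστ, hsum⟩ := K.coord_mem_openSegment hmid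
  rw [coord_map] at hsum
  -- At the midpoint all coordinates but the `j`-th are 0 or 1, so `r` shares them and lies on the
  -- edge itself. Then `r = a + s j • u`, which fails if `u` is nonzero at both `i₁` and `i₂`.
  have hsi : ∀ i, i ≠ j → s i = p 0 i := by
    intro i hi
    have h1 : (p (1 / 2) i) = p 0 i := by simp [p, hi]
    have h2 : σ * s i + τ * K.coord (K'.map r') i = p 0 i := by
      rw [← h1, ← hsum]; rfl
    rw [← h2]
    refine CellKind.eq_zero_or_one_of_openSegment (K.kind.nonneg_of_mem_ref hs i)
      (K.kind.le_one_of_mem_ref hs i) (K.kind.nonneg_of_mem_ref hs' i)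
      (K.kind.le_one_of_mem_ref hs' i) hσ hτ hστ ?_
    rw [h2]
    simp only [p, if_neg hi]
    split_ifs <;> simp
  have hsp : s = p (s j) := by
    ext i
    by_cases hi : i = j
    · subst hi; simp [p]
    · rw [hsi i hi]; simp [p, hi]
  have hrs : r = a + s j • u := by
    rw [← hψ, ← hsp, trans_apply, hsdef, map_coord, coord_map]
  have e2 := congrFun hrs i₂
  have e1 := congrFun hrs i₁
  simp only [hr, Pi.add_apply, Pi.smul_apply, smul_eq_mul,
    Function.update_of_ne (Ne.symm hne), Function.update_self] at e1 e2
  have hsj : s j = 0 := (mul_eq_zero.1 (by linarith)).resolve_right h₂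
  rw [hsj] at e1
  exact h₁ (by linarith)

/-- Unisolvence on the faces of a parallelotope. -/
theorem shape_eq_of_parallelotope {K K' : Cell d} (hK : K.kind = .parallelotope)
    (h : IsExposed ℝ K.carrier (K.carrier ∩ K'.carrier))
    (h' : IsExposed ℝ K'.carrier (K.carrier ∩ K'.carrier)) {k : ℕ} (hk : 1 ≤ k)
    {v v' : Space d → ℝ} (hv : K.IsShape k v) (hv' : K'.IsShape k v')
    (hn : ∀ x ∈ K.nodes k, x ∈ K'.carrier → v x = v' x) {x : Space d} (hx : x ∈ K.carrier)
    (hx' : x ∈ K'.carrier) : v x = v' x := by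
  have hk0 : (0 : ℝ) < k := by positivity
  obtain ⟨q, hq, hvq⟩ := (K.isShape_iff k v).1 hv
  obtain ⟨q', hq', hvq'⟩ := (K'.isShape_iff k v').1 hv'
  rw [hK] at hq
  -- Induction on the set `T` of coordinates allowed off the grid. Freeing one coordinate compares
  -- two univariate polynomials of degree at most `k` that agree at `k + 1` grid values.
  have main : ∀ T : Finset (Fin d), ∀ y ∈ K.kind.ref d, K.map y ∈ K'.carrier →
      (∀ j ∉ T, ∃ m : ℕ, m ≤ k ∧ y j = m / k) →
      MvPolynomial.eval y q = MvPolynomial.eval (K.trans K' y) q' := by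
    intro T
    induction T using Finset.induction_on with
    | empty =>
      intro y hy hy' hl
      choose m hm hmy using fun j => hl j (Finset.notMem_empty j)
      have hnode : K.map y ∈ K.nodes k := by
        have hye : y = fun j => (m j : ℝ) / k := funext hmy
        exact ⟨m, by rw [← hye]; exact hy, by rw [← hye]⟩
      have e := hn _ hnode hy'
      rwa [hvq _ (map_mem_carrier hy), hvq' _ hy', coord_map, ← trans_apply] at e
    | insert j T hjT ih =>
      intro y hy hy' hl
      have hl' : ∀ i ∉ T, i ≠ j → ∃ m : ℕ, m ≤ k ∧ y i = m / k := fun i hi hij =>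
        hl i (by simp [hi, hij])
      -- If `y j` is 0 or 1, the line in direction `j` may leave the common face, but the coordinate
      -- is already a grid value.
      by_cases hj0 : y j = 0
      · refine ih y hy hy' fun i hi => ?_
        rcases eq_or_ne i j with rfl | hij
        · exact ⟨0, Nat.zero_le _, by simp [hj0]⟩
        · exact hl' i hi hij
      by_cases hj1 : y j = 1
      · refine ih y hy hy' fun i hi => ?_
        rcases eq_or_ne i j with rfl | hij
        · exact ⟨k, le_rfl, by rw [hj1, div_self hk0.ne']⟩
        · exact hl' i hi hij
      set c := Function.update y j 0 with hc
      have hline : ∀ t : ℝ, c + t • (Pi.single j 1 : Fin d → ℝ) = Function.update y j t := by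
        intro t
        ext i
        rcases eq_or_ne i j with rfl | hij
        · simp [hc]
        · simp [hc, hij]
      have hlref : ∀ t : ℝ, 0 ≤ t → t ≤ 1 → Function.update y j t ∈ K.kind.ref d := by
        intro t h0 h1
        rw [hK] at hy ⊢
        intro i
        rcases eq_or_ne i j with rfl | hij
        · simp [h0, h1]
        · simpa [hij] using hy i
      have hlK' : ∀ t : ℝ, 0 ≤ t → t ≤ 1 → K.map (Function.update y j t) ∈ K'.carrier := by
        intro t h0 h1
        refine mem_of_con h hy (hlref t h0 h1) hy' ?_
        rw [hK]
        rintro ⟨_ | _, l⟩ hcon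
        · simp only [CellKind.con] at hcon ⊢
          rcases eq_or_ne l j with rfl | hlj
          · exact absurd (by linarith) hj1
          · simpa [hlj] using hcon
        · rw [CellKind.con_true] at hcon ⊢
          rcases eq_or_ne l j with rfl | hlj
          · exact absurd hcon hj0
          · simpa [hlj] using hcon
      obtain ⟨p₁, hp₁, he₁⟩ := exists_line_polynomial_of_degreeOf q c (Pi.single j 1) hq
        (fun i i' hi hi' => by
          have e : ∀ l, (Pi.single j 1 : Fin d → ℝ) l ≠ 0 → l = j := fun l hl => by
            by_contra hne
            exact hl (by simp [hne])
          rw [e i hi, e i' hi'])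
      -- On a simplex the total degree bounds the degree along any line; on a parallelotope
      -- `edge_parallel` is needed to know that the line is a coordinate line of `K'` too.
      obtain ⟨p₂, hp₂, he₂⟩ : ∃ p : Polynomial ℝ, p.natDegree ≤ k ∧ ∀ t : ℝ, p.eval t
          = MvPolynomial.eval (K.trans K' c + t • (K.trans K').linear (Pi.single j 1)) q' := by
        cases hK' : K'.kind
        · rw [hK'] at hq'
          exact exists_line_polynomial_of_totalDegree q' _ _ hq'
        · rw [hK'] at hq'
          exact exists_line_polynomial_of_degreeOf q' _ _ hq'
            (edge_parallel hK hK' h h' hy hy' hj0 hj1)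
      have hev : ∀ t, (p₁ - p₂).eval t = MvPolynomial.eval (Function.update y j t) q
          - MvPolynomial.eval (K.trans K' (Function.update y j t)) q' := by
        intro t
        rw [Polynomial.eval_sub, he₁, he₂, ← trans_add_smul, hline]
      have hzero : p₁ - p₂ = 0 := by
        refine polynomial_eq_zero_of_lattice hk
          ((Polynomial.natDegree_sub_le _ _).trans (max_le hp₁ hp₂)) fun m hm => ?_
        have h0 : 0 ≤ (m : ℝ) / k := by positivity
        have h1 : (m : ℝ) / k ≤ 1 := by rw [div_le_one hk0]; exact_mod_cast hm
        rw [hev, sub_eq_zero]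
        refine ih _ (hlref _ h0 h1) (hlK' _ h0 h1) fun i hi => ?_
        rcases eq_or_ne i j with rfl | hij
        · exact ⟨m, hm, by simp⟩
        · simpa [hij] using hl' i hi hij
      have hfin := hev (y j)
      rw [hzero, Polynomial.eval_zero, Function.update_eq_self] at hfin
      linarith
  rw [hvq x hx, hvq' x hx', main Finset.univ (K.coord x) ((K.mem_carrier_iff x).1 hx)
    (by rwa [map_coord]) (fun j hj => absurd (Finset.mem_univ j) hj), trans_apply, map_coord]

/-- Unisolvence on the common faces of simplices. -/
theorem shape_eq_of_simplex {K K' : Cell d} (hK : K.kind = .simplex) (hK' : K'.kind = .simplex)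
    (h : IsExposed ℝ K.carrier (K.carrier ∩ K'.carrier)) {k : ℕ} (hk : 1 ≤ k)
    {v v' : Space d → ℝ} (hv : K.IsShape k v) (hv' : K'.IsShape k v')
    (hn : ∀ x ∈ K.nodes k, x ∈ K'.carrier → v x = v' x) {x : Space d} (hx : x ∈ K.carrier)
    (hx' : x ∈ K'.carrier) : v x = v' x := by
  have hk0 : (0 : ℝ) < k := by positivity
  obtain ⟨q, hq, hvq⟩ := (K.isShape_iff k v).1 hv
  obtain ⟨q', hq', hvq'⟩ := (K'.isShape_iff k v').1 hv'
  rw [hK] at hq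
  rw [hK'] at hq'
  let lam : Option (Fin d) → ℝ := fun o => o.elim (1 - ∑ j, K.coord x j) (K.coord x)
  have hlam1 : ∑ o, lam o = 1 := by simp [Fintype.sum_option, lam]
  have hlam0 : ∀ o, 0 ≤ lam o := by
    have := (K.mem_carrier_iff x).1 hx
    rw [hK] at this
    rintro (_ | j)
    · exact sub_nonneg.2 this.2
    · exact this.1 j
  have hxsum : x = ∑ o, lam o • K.vertex o := by
    conv_lhs => rw [← K.map_coord x, map_eq_sum_vertex]
    rw [Fintype.sum_option]
    rfl
  have hV : ∀ o, lam o ≠ 0 → K.vertex o ∈ K.carrier ∩ K'.carrier := fun o ho =>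
    mem_of_sum_mem_isExposed h Finset.univ lam K.vertex (fun i _ => hlam0 i) hlam1
      (fun i _ => (vertex_mem_extremePoints hK i).1) (by rw [← hxsum]; exact ⟨hx, hx'⟩)
      (Finset.mem_univ o) ho
  obtain ⟨o₀, -, ho₀⟩ := Finset.exists_ne_zero_of_sum_ne_zero (by rw [hlam1]; exact one_ne_zero)
  classical
  -- Vertices of weight zero are replaced by `o₀`, so every `W o` lies on the common face. The
  -- resulting parametrisation `f` need not be injective: only lattice points mapping to nodes and
  -- `f lam = x` are needed.
  let W : Option (Fin d) → Space d := fun o => if lam o ≠ 0 then K.vertex o else K.vertex o₀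
  have hWF : ∀ o, W o ∈ K.carrier ∩ K'.carrier := fun o => by
    simp only [W]; split_ifs with ho
    · exact hV o ho
    · exact hV o₀ ho₀
  have hWext : ∀ o, W o ∈ K.carrier.extremePoints ℝ := fun o => by
    simp only [W]; split_ifs <;> exact vertex_mem_extremePoints hK _
  let V₀ := K.vertex o₀
  let f : (Option (Fin d) → ℝ) →ᵃ[ℝ] Space d :=
    (Fintype.linearCombination ℝ fun o => W o - V₀).toAffineMap + AffineMap.const ℝ _ V₀
  have hf : ∀ t, f t = (1 - ∑ o, t o) • V₀ + ∑ o, t o • W o := by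
    intro t
    simp only [f, AffineMap.coe_add, Pi.add_apply, LinearMap.coe_toAffineMap,
      AffineMap.coe_const, Function.const_apply, Fintype.linearCombination_apply, smul_sub,
      Finset.sum_sub_distrib, ← Finset.sum_smul, sub_smul, one_smul]
    abel
  obtain ⟨Q, hQ, hQe⟩ := exists_comp_affine q (K.aff.symm.toAffineMap.comp f)
  obtain ⟨Q', hQ', hQe'⟩ := exists_comp_affine q' (K'.aff.symm.toAffineMap.comp f)
  have hzero : Q - Q' = 0 := by
    refine eq_zero_of_vanishes_on_lattice _ hk ((MvPolynomial.totalDegree_sub _ _).trans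
      (max_le (hQ.trans hq) (hQ'.trans hq'))) fun a ha => ?_
    set t : Option (Fin d) → ℝ := fun o => (a o : ℝ) / k with ht
    have hft : f t = ∑ o : Option (Option (Fin d)),
        (((o.elim (k - ∑ i, a i) a : ℕ) : ℝ) / k) • o.elim V₀ W := by
      rw [hf]
      refine Eq.trans ?_ (Fintype.sum_option _).symm
      simp only [Option.elim, ht]
      rw [← Finset.sum_div, Nat.cast_sub ha, sub_div, div_self hk0.ne', Nat.cast_sum]
    have hc : ∑ o : Option (Option (Fin d)), (o.elim (k - ∑ i, a i) a : ℕ) = k := by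
      rw [Fintype.sum_option]
      simp only [Option.elim]
      omega
    have hnode : f t ∈ K.nodes k := by
      rw [hft]
      refine K.sum_mem_nodes hk _ _ (fun o _ => ?_) hc
      cases o
      · exact vertex_mem_extremePoints hK _
      · exact hWext _
    have hF : f t ∈ K'.carrier := by
      rw [hft]
      refine K'.convex_carrier.sum_mem (fun o _ => by positivity) ?_ fun o _ => ?_
      · rw [← Finset.sum_div, ← Nat.cast_sum, hc, div_self hk0.ne']
      · cases o
        · exact (hV o₀ ho₀).2
        · exact (hWF _).2
    have e := hn _ hnode hF
    rw [hvq _ (K.nodes_subset_carrier k hnode), hvq' _ hF] at e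
    rw [map_sub, hQe, hQe', sub_eq_zero]
    exact e
  have hflam : f lam = x := by
    rw [hf, hlam1, sub_self, zero_smul, zero_add, hxsum]
    refine Finset.sum_congr rfl fun o _ => ?_
    simp only [W]
    split_ifs with ho
    · rfl
    · push Not at ho
      rw [ho, zero_smul, zero_smul]
  have e : MvPolynomial.eval lam (Q - Q') = 0 := by rw [hzero, map_zero]
  rw [map_sub, hQe, hQe', sub_eq_zero] at e
  have e' : MvPolynomial.eval (K.coord (f lam)) q = MvPolynomial.eval (K'.coord (f lam)) q' := e
  rw [hflam] at e'
  rw [hvq x hx, hvq' x hx', e']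

/-- Shape functions of two cells that agree at the nodes on a common face agree on this face. -/
theorem shape_eq_on_inter {K K' : Cell d} (h : IsExposed ℝ K.carrier (K.carrier ∩ K'.carrier))
    (h' : IsExposed ℝ K'.carrier (K.carrier ∩ K'.carrier)) {k : ℕ} (hk : 1 ≤ k)
    {v v' : Space d → ℝ} (hv : K.IsShape k v) (hv' : K'.IsShape k v')
    (hn : ∀ x ∈ K.nodes k, x ∈ K'.carrier → v x = v' x) {x : Space d} (hx : x ∈ K.carrier)
    (hx' : x ∈ K'.carrier) : v x = v' x := by
  cases hK : K.kind
  · cases hK' : K'.kind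
    · exact shape_eq_of_simplex hK hK' h hk hv hv' hn hx hx'
    -- In the mixed case the parallelotope takes the first role, and the nodal agreement is
    -- transferred to its nodes.
    · rw [inter_comm] at h h'
      exact (shape_eq_of_parallelotope hK' h' h hk hv' hv (fun z hz hzK =>
        (hn z (mem_nodes_of_mem_inter h' h hk hz hzK) (K'.nodes_subset_carrier k hz)).symm)
        hx' hx).symm
  · exact shape_eq_of_parallelotope hK h h' hk hv hv' hn hx hx'

end Cell

/-! ### Local Lagrange functions and regularity of shape functions -/

namespace Cell

variable {d : ℕ}

open MvPolynomial in
/-- The local Lagrange functions; they vanish on all facets that do not contain their node. -/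
theorem exists_lagrange (K : Cell d) {k : ℕ} (hk : 1 ≤ k) {x : Space d} (hx : x ∈ K.nodes k) :
    ∃ v : Space d → ℝ, K.IsShape k v ∧ v x = 1 ∧ (∀ y ∈ K.nodes k, y ≠ x → v y = 0) ∧
      ∀ z ∈ K.carrier, (∃ i, K.kind.con i (K.coord z) = 0 ∧ K.kind.con i (K.coord x) ≠ 0) →
        v z = 0 := by
  have hk0 : (k : ℝ) ≠ 0 := by positivity
  obtain ⟨a, ha, rfl⟩ := hx
  rw [coord_map]
  suffices ∃ q : MvPolynomial (Fin d) ℝ, IsAdmissiblePoly K.kind k q ∧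
      eval (fun j => (a j : ℝ) / k) q = 1 ∧
      (∀ b : Fin d → ℕ, (fun j => (b j : ℝ) / k) ∈ K.kind.ref d → b ≠ a →
        eval (fun j => (b j : ℝ) / k) q = 0) ∧
      ∀ y : Fin d → ℝ, (∃ i, K.kind.con i y = 0 ∧
        K.kind.con i (fun j => (a j : ℝ) / k) ≠ 0) → eval y q = 0 by
    obtain ⟨q, hq, h1, h0, hb⟩ := this
    refine ⟨fun z => eval (K.coord z) q, (K.isShape_iff _ _).2 ⟨q, hq, fun _ _ => rfl⟩,
      by simpa using h1, ?_, fun z _ hz => hb _ hz⟩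
    rintro _ ⟨b, hbr, rfl⟩ hne
    simp only [coord_map]
    refine h0 b hbr ?_
    rintro rfl
    exact hne rfl
  cases hK : K.kind
  · rw [hK] at ha
    have hle : ∀ b : Fin d → ℕ, (fun j => (b j : ℝ) / k) ∈ CellKind.ref d .simplex →
        ∑ j, b j ≤ k := fun b hb => by
      have h := hb.2
      rw [← Finset.sum_div, div_le_one (by positivity)] at h
      exact_mod_cast h
    let L : Option (Fin d) → MvPolynomial (Fin d) ℝ := fun o => o.elim (1 - ∑ j, X j) X
    let ext : (Fin d → ℕ) → Option (Fin d) → ℕ := fun b o => o.elim (k - ∑ j, b j) b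
    have hext : ∀ b : Fin d → ℕ, ∑ j, b j ≤ k → ∑ o, ext b o = k := fun b hb => by
      rw [Fintype.sum_option]; simp only [ext, Option.elim]; omega
    have hLe : ∀ b : Fin d → ℕ, ∑ j, b j ≤ k → ∀ o,
        eval (fun j => (b j : ℝ) / k) (L o) = ext b o / k := by
      rintro b hb (_ | j)
      · simp only [L, ext, Option.elim, map_sub, map_one, map_sum, eval_X]
        rw [← Finset.sum_div, Nat.cast_sub hb, sub_div, div_self hk0, Nat.cast_sum]
      · simp [L, ext]
    have hLd : ∀ o, (L o).totalDegree ≤ 1 := by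
      rintro (_ | j)
      · refine (totalDegree_sub _ _).trans (max_le (by simp) ?_)
        exact totalDegree_finsetSum_le fun j _ => by simp
      · simp [L]
    -- In barycentric coordinates `L o`, the factor for `o` kills the levels below `ext a o`. These
    -- numbers sum to `k`, which bounds the total degree.
    let fac : Option (Fin d) → MvPolynomial (Fin d) ℝ := fun o => ∏ m ∈ Finset.range (ext a o),
      (C (((ext a o : ℝ) - m)⁻¹) * (C (k : ℝ) * L o - C (m : ℝ)))
    have hfz : ∀ (y : Fin d → ℝ) (o) (m : ℕ), m < ext a o → k * eval y (L o) = m →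
        eval y (∏ o, fac o) = 0 := by
      intro y o m hm hy
      rw [map_prod]
      refine Finset.prod_eq_zero (Finset.mem_univ o) ?_
      rw [map_prod]
      refine Finset.prod_eq_zero (Finset.mem_range.2 hm) ?_
      simp [hy]
    refine ⟨∏ o, fac o, ?_, ?_, ?_, ?_⟩
    · refine (totalDegree_finsetProd _ _).trans ?_
      rw [← hext a (hle a ha)]
      refine Finset.sum_le_sum fun o _ => (totalDegree_finsetProd _ _).trans ?_
      calc _ ≤ ∑ m ∈ Finset.range (ext a o), 1 := Finset.sum_le_sum fun m _ => by
            refine (totalDegree_mul _ _).trans ?_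
            rw [totalDegree_C, zero_add]
            refine (totalDegree_sub _ _).trans (max_le ((totalDegree_mul _ _).trans ?_)
              (by rw [totalDegree_C]; exact Nat.zero_le _))
            rw [totalDegree_C, zero_add]
            exact hLd o
        _ = ext a o := by simp
    · rw [map_prod]
      refine Finset.prod_eq_one fun o _ => ?_
      rw [map_prod]
      refine Finset.prod_eq_one fun m hm => ?_
      have hm' : (m : ℝ) < ext a o := by exact_mod_cast Finset.mem_range.1 hm
      simp only [map_mul, map_sub, eval_C, hLe a (hle a ha)]
      rw [mul_div_cancel₀ _ hk0, inv_mul_cancel₀ (sub_ne_zero.2 hm'.ne')]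
    · intro b hb hne
      -- The extended exponents of both nodes sum to `k`, so distinct nodes must differ downwards in
      -- some coordinate, where a factor vanishes.
      obtain ⟨o, ho⟩ : ∃ o, ext b o < ext a o := by
        by_contra! hge
        have hall : ∀ o ∈ Finset.univ, ext a o = ext b o :=
          (Finset.sum_eq_sum_iff_of_le fun o _ => hge o).1
            ((hext a (hle a ha)).trans (hext b (hle b hb)).symm)
        exact hne (funext fun j => (hall (some j) (Finset.mem_univ _)).symm)
      refine hfz _ o (ext b o) ho ?_
      rw [hLe b (hle b hb), mul_div_cancel₀ _ hk0]
    · rintro y ⟨⟨_ | _, j⟩, hy, hne⟩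
      · refine hfz y none 0 (Nat.pos_of_ne_zero fun h0 => hne ?_) ?_
        · have := hLe a (hle a ha) none
          rw [h0, Nat.cast_zero, zero_div] at this
          simpa [L, CellKind.con] using this
        · have : eval y (L none) = 0 := by simpa [L, CellKind.con] using hy
          rw [this]; simp
      · rw [CellKind.con_true] at hy hne
        refine hfz y (some j) 0 (Nat.pos_of_ne_zero fun h0 => hne ?_) ?_
        · have h0' : a j = 0 := h0
          simp [h0']
        · simp [L, hy]
  · rw [hK] at ha
    have hle : ∀ b : Fin d → ℕ, (fun j => (b j : ℝ) / k) ∈ CellKind.ref d .parallelotope →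
        ∀ j, b j ≤ k := fun b hb j => by
      have h := (hb j).2
      rw [div_le_one (by positivity)] at h
      exact_mod_cast h
    -- Tensor product of univariate Lagrange polynomials. The factors `m = 0` and `m = k` give the
    -- vanishing on facets that miss the node.
    let fac : Fin d → MvPolynomial (Fin d) ℝ := fun j => ∏ m ∈ (Finset.range (k + 1)).erase (a j),
      (C (((a j : ℝ) - m)⁻¹) * (C (k : ℝ) * X j - C (m : ℝ)))
    have hfz : ∀ (y : Fin d → ℝ) (j) (m : ℕ), m ≤ k → m ≠ a j → k * y j = m →
        eval y (∏ j, fac j) = 0 := by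
      intro y j m hm hma hy
      rw [map_prod]
      refine Finset.prod_eq_zero (Finset.mem_univ j) ?_
      rw [map_prod]
      refine Finset.prod_eq_zero (Finset.mem_erase.2 ⟨hma, Finset.mem_range.2
        (Nat.lt_succ_iff.2 hm)⟩) ?_
      simp [hy]
    refine ⟨∏ j, fac j, fun i => ?_, ?_, ?_, ?_⟩
    · refine (degreeOf_prod_le _ _ _).trans ?_
      calc _ ≤ ∑ j, (if i = j then k else 0) := Finset.sum_le_sum fun j _ => by
            refine (degreeOf_prod_le _ _ _).trans ?_
            calc _ ≤ ∑ m ∈ (Finset.range (k + 1)).erase (a j), (if i = j then 1 else 0) :=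
                  Finset.sum_le_sum fun m _ => by
                    refine (degreeOf_mul_le _ _ _).trans ?_
                    rw [degreeOf_C, zero_add]
                    refine (degreeOf_sub_le _ _ _).trans (max_le
                      ((degreeOf_mul_le _ _ _).trans ?_)
                      (by rw [degreeOf_C]; exact Nat.zero_le _))
                    rw [degreeOf_C, zero_add, degreeOf_X]
              _ ≤ if i = j then k else 0 := by
                  rw [Finset.sum_const, Finset.card_erase_of_mem (Finset.mem_range.2
                    (Nat.lt_succ_iff.2 (hle a ha j))), Finset.card_range]
                  split_ifs <;> simp
        _ = k := by simp
    · rw [map_prod]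
      refine Finset.prod_eq_one fun j _ => ?_
      rw [map_prod]
      refine Finset.prod_eq_one fun m hm => ?_
      have hm' : (a j : ℝ) ≠ m := by exact_mod_cast (Finset.mem_erase.1 hm).1.symm
      simp only [map_mul, map_sub, eval_C, eval_X]
      rw [mul_div_cancel₀ _ hk0, inv_mul_cancel₀ (sub_ne_zero.2 hm')]
    · intro b hb hne
      obtain ⟨j, hj⟩ := Function.ne_iff.1 hne
      exact hfz _ j (b j) (hle b hb j) hj (mul_div_cancel₀ _ hk0)
    · rintro y ⟨⟨_ | _, j⟩, hy, hne⟩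
      · simp only [CellKind.con] at hy hne
        refine hfz y j k le_rfl (fun h => hne ?_) (by rw [← sub_eq_zero.1 hy, mul_one])
        rw [← h, div_self hk0, sub_self]
      · rw [CellKind.con_true] at hy hne
        refine hfz y j 0 (Nat.zero_le _) (fun h => hne ?_) (by simp [hy])
        simp [← h]

theorem isShape_zero (K : Cell d) (k : ℕ) : K.IsShape k 0 :=
  (K.isShape_iff k 0).2 ⟨0, by cases h : K.kind <;> simp [IsAdmissiblePoly],
    fun _ _ => by simp⟩

theorem IsShape.add {K : Cell d} {k : ℕ} {v w : Space d → ℝ} (hv : K.IsShape k v)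
    (hw : K.IsShape k w) : K.IsShape k (v + w) := by
  obtain ⟨q, hq, hvq⟩ := (K.isShape_iff k v).1 hv
  obtain ⟨r, hr, hwr⟩ := (K.isShape_iff k w).1 hw
  refine (K.isShape_iff k _).2 ⟨q + r, ?_, fun x hx => by simp [hvq x hx, hwr x hx]⟩
  cases h : K.kind <;> rw [h] at hq hr
  · exact (MvPolynomial.totalDegree_add _ _).trans (max_le hq hr)
  · exact fun j => (MvPolynomial.degreeOf_add_le _ _ _).trans (max_le (hq j) (hr j))

theorem IsShape.smul {K : Cell d} {k : ℕ} {v : Space d → ℝ} (hv : K.IsShape k v) (c : ℝ) :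
    K.IsShape k (c • v) := by
  obtain ⟨q, hq, hvq⟩ := (K.isShape_iff k v).1 hv
  refine (K.isShape_iff k _).2 ⟨MvPolynomial.C c * q, ?_, fun x hx => by simp [hvq x hx]⟩
  cases h : K.kind <;> rw [h] at hq
  · exact (MvPolynomial.totalDegree_mul _ _).trans
      (by rw [MvPolynomial.totalDegree_C, zero_add]; exact hq)
  · exact fun j => (MvPolynomial.degreeOf_mul_le _ _ _).trans (by simpa using hq j)

theorem IsShape.congr {K : Cell d} {k : ℕ} {v w : Space d → ℝ} (hv : K.IsShape k v)
    (h : ∀ x ∈ K.carrier, w x = v x) : K.IsShape k w := by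
  obtain ⟨q, hq, hvq⟩ := (K.isShape_iff k v).1 hv
  exact (K.isShape_iff k w).2 ⟨q, hq, fun x hx => (h x hx).trans (hvq x hx)⟩

theorem IsShape.exists_contDiff {K : Cell d} {k : ℕ} {v : Space d → ℝ} (hv : K.IsShape k v) :
    ∃ f : Space d → ℝ, ContDiff ℝ ∞ f ∧ ∀ x ∈ K.carrier, v x = f x := by
  obtain ⟨q, -, hvq⟩ := (K.isShape_iff k v).1 hv
  refine ⟨fun x => MvPolynomial.eval (K.coord x) q, ?_, hvq⟩
  simp only [MvPolynomial.eval_eq']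
  refine ContDiff.sum fun m _ => contDiff_const.mul (contDiff_prod fun i _ => ?_)
  exact ((contDiff_apply ℝ ℝ i).comp K.contDiff_coord).pow _

theorem IsShape.exists_lipschitzOnWith {K : Cell d} {k : ℕ} {v : Space d → ℝ}
    (hv : K.IsShape k v) : ∃ C, LipschitzOnWith C v K.carrier := by
  obtain ⟨f, hf, hvf⟩ := hv.exists_contDiff
  have hf1 : ContDiff ℝ 1 f := hf.of_le (by simp)
  obtain ⟨M, hM⟩ := K.isCompact_carrier.exists_bound_of_continuousOn
    (hf1.continuous_fderiv one_ne_zero).continuousOn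
  have h := K.convex_carrier.lipschitzOnWith_of_nnnorm_fderiv_le (C := M.toNNReal)
    (fun x _ => hf1.differentiable one_ne_zero x) fun x hx => by
      rw [← NNReal.coe_le_coe, coe_nnnorm]
      exact (hM x hx).trans (Real.le_coe_toNNReal M)
  refine ⟨M.toNNReal, fun x hx y hy => ?_⟩
  rw [hvf x hx, hvf y hy]
  exact h hx hy

end Cell

/-! ### The finite element space -/

/-- A continuous function that is Lipschitz on each member of a finite closed cover is Lipschitz. -/
theorem lipschitzWith_of_finite_closed_cover {E : Type*} [NormedAddCommGroup E] [NormedSpace ℝ E]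
    {f : E → ℝ} (hf : Continuous f) {S : Set (Set E)} (hS : S.Finite)
    (hcl : ∀ A ∈ S, IsClosed A) (hcov : ∀ x, ∃ A ∈ S, x ∈ A) {C : NNReal}
    (hC : ∀ A ∈ S, LipschitzOnWith C f A) : LipschitzWith C f := by
  refine LipschitzWith.of_dist_le_mul fun y x => ?_
  let γ : ℝ → E := fun t => x + t • (y - x)
  have hγ : Continuous γ := by fun_prop
  have hγd : ∀ t t', t ≤ t' → dist (γ t') (γ t) = (t' - t) * dist y x := by
    intro t t' h
    rw [dist_eq_norm, dist_eq_norm, show γ t' - γ t = (t' - t) • (y - x) by simp only [γ]; module,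
      norm_smul, Real.norm_of_nonneg (by linarith)]
  let s : Set ℝ := {t | dist (f (γ t)) (f x) ≤ C * (t * dist y x)}
  have hs : IsClosed s := isClosed_le (by fun_prop) (by fun_prop)
  have h1 : (1 : ℝ) ∈ s := by
    refine (hs.inter isClosed_Icc).mem_of_ge_of_forall_exists_gt (a := 0)
      (by simp [s, γ]) zero_le_one ?_
    rintro t ⟨ht, ht0, ht1⟩
    -- Shortly after `t` the segment meets only closed members that contain `γ t`, so a small step
    -- stays within one member. Continuous induction then carries the estimate from 0 to 1.
    have hev : ∀ᶠ t' in nhdsWithin t (Ioi t), ∀ A ∈ S, γ t' ∈ A → γ t ∈ A := by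
      rw [hS.eventually_all]
      intro A hA
      by_cases h : γ t ∈ A
      · exact Filter.Eventually.of_forall fun _ _ => h
      · have : ∀ᶠ t' in nhds t, γ t' ∈ Aᶜ :=
          hγ.continuousAt.eventually ((hcl A hA).isOpen_compl.mem_nhds h)
        filter_upwards [this.filter_mono nhdsWithin_le_nhds] with t' h1 h2
        exact absurd h2 h1
    obtain ⟨t', hA, ht'⟩ := (hev.and (Ioc_mem_nhdsGT ht1)).exists
    obtain ⟨A, hAS, hAt'⟩ := hcov (γ t')
    refine ⟨t', ?_, ht'⟩
    have h2 := (hC A hAS).dist_le_mul _ hAt' _ (hA A hAS hAt')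
    rw [hγd t t' ht'.1.le] at h2
    calc dist (f (γ t')) (f x) ≤ dist (f (γ t')) (f (γ t)) + dist (f (γ t)) (f x) :=
          dist_triangle _ _ _
      _ ≤ C * ((t' - t) * dist y x) + C * (t * dist y x) := add_le_add h2 ht
      _ = C * (t' * dist y x) := by ring
  simpa [s, γ] using h1

theorem IsLipZero.add {d : ℕ} {Ω : Set (Space d)} {v w : Space d → ℝ} (hv : IsLipZero Ω v)
    (hw : IsLipZero Ω w) : IsLipZero Ω (v + w) := by
  obtain ⟨⟨C, hC⟩, hv0⟩ := hv
  obtain ⟨⟨D, hD⟩, hw0⟩ := hw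
  exact ⟨⟨C + D, hC.add hD⟩, fun x hx => by simp [hv0 x hx, hw0 x hx]⟩

theorem IsLipZero.smul {d : ℕ} {Ω : Set (Space d)} {v : Space d → ℝ} (hv : IsLipZero Ω v) (c : ℝ) :
    IsLipZero Ω (c • v) := by
  obtain ⟨⟨C, hC⟩, hv0⟩ := hv
  exact ⟨⟨‖c‖₊ * C, (lipschitzWith_smul c).comp hC⟩, fun x hx => by simp [hv0 x hx]⟩

theorem isLipZero_zero {d : ℕ} {Ω : Set (Space d)} : IsLipZero Ω 0 :=
  ⟨⟨0, LipschitzWith.const 0⟩, fun _ _ => rfl⟩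

namespace Mesh

variable {d : ℕ} {Ω : Set (Space d)}

/-- The cells and the complement of `Ω` form a finite closed cover, on each member of which the
function is Lipschitz. -/
theorem isLipZero_of_isShape (P : Mesh Ω) {k : ℕ} {v : Space d → ℝ}
    (hc : ContinuousOn v (closure Ω)) (hv : ∀ K ∈ P.cells, K.IsShape k v) (h0 : ∀ x ∉ Ω, v x = 0) :
    IsLipZero Ω v := by
  refine ⟨?_, h0⟩
  have hcont : Continuous v := by
    have h2 : ContinuousOn v Ωᶜ := continuousOn_const.congr fun x hx => h0 x hx
    have h3 := hc.union_of_isClosed h2 isClosed_closure P.isOpen.isClosed_compl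
    rwa [show closure Ω ∪ Ωᶜ = univ from eq_univ_of_forall fun x =>
      (em (x ∈ Ω)).imp (fun h => subset_closure h) id, continuousOn_univ] at h3
  choose! C hC using fun K hK => (hv K hK).exists_lipschitzOnWith
  refine ⟨∑ K ∈ P.cells, C K, lipschitzWith_of_finite_closed_cover hcont
    (S := insert Ωᶜ ((fun K : Cell d => K.carrier) '' P.cells))
    ((P.cells.finite_toSet.image _).insert _) ?_ ?_ ?_⟩
  · rintro A (rfl | ⟨K, -, rfl⟩)
    · exact P.isOpen.isClosed_compl
    · exact K.isCompact_carrier.isClosed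
  · intro x
    by_cases hx : x ∈ Ω
    · obtain ⟨K, hK, hxK⟩ := P.exists_cell (subset_closure hx)
      exact ⟨_, Or.inr ⟨K, hK, rfl⟩, hxK⟩
    · exact ⟨_, Or.inl rfl, hx⟩
  · rintro A (rfl | ⟨K, hK, rfl⟩)
    · intro x hx y hy
      simp [h0 x hx, h0 y hy]
    · exact (hC K hK).weaken (Finset.single_le_sum (fun _ _ => zero_le) hK)

/-- The Sobolev condition comes for free: a continuous piecewise polynomial with zero boundary
values, extended by zero, is globally Lipschitz. -/
theorem mem_space_iff (P : Mesh Ω) {k : ℕ} {v : Space d → ℝ} :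
    v ∈ P.space k ↔ IsLipZero Ω v ∧ ∀ K ∈ P.cells, K.IsShape k v := by
  constructor
  · rintro ⟨hc, hs, -, hf, ho⟩
    refine ⟨P.isLipZero_of_isShape hc hs fun x hx => ?_, hs⟩
    by_cases hxc : x ∈ closure Ω
    · exact hf x (by rw [P.isOpen.frontier_eq]; exact ⟨hxc, hx⟩)
    · exact ho x hxc
  · rintro ⟨hl, hs⟩
    refine ⟨hl.continuous.continuousOn, hs, hl.memW1 P.isBounded, fun x hx => hl.2 x ?_,
      fun x hx => hl.2 x fun h => hx (subset_closure h)⟩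
    rw [P.isOpen.frontier_eq] at hx
    exact hx.2

/-- The finite element space as a linear subspace. -/
def subspace (P : Mesh Ω) (k : ℕ) : Submodule ℝ (Space d → ℝ) where
  carrier := P.space k
  add_mem' hv hw := by
    rw [mem_space_iff] at *
    exact ⟨hv.1.add hw.1, fun K hK => (hv.2 K hK).add (hw.2 K hK)⟩
  zero_mem' := P.mem_space_iff.2 ⟨isLipZero_zero, fun K _ => K.isShape_zero k⟩
  smul_mem' c v hv := by
    rw [mem_space_iff] at *
    exact ⟨hv.1.smul c, fun K hK => (hv.2 K hK).smul c⟩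

/-- The Lagrange functions of the elements satisfy the homogeneous boundary condition. -/
theorem exists_local_lagrange (P : Mesh Ω) {k : ℕ} (hk : 1 ≤ k) {x : Space d} (hx : x ∈ Ω)
    {K : Cell d} (hK : K ∈ P.cells) : ∃ v : Space d → ℝ, K.IsShape k v ∧
      (x ∈ K.nodes k → v x = 1) ∧ (∀ y ∈ K.nodes k, y ≠ x → v y = 0) ∧
      ∀ z ∈ K.carrier, z ∉ Ω → v z = 0 := by
  by_cases hxn : x ∈ K.nodes k
  · obtain ⟨v, hv, h1, h0, hb⟩ := K.exists_lagrange hk hxn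
    refine ⟨v, hv, fun _ => h1, h0, fun z hz hzΩ => hb z hz ?_⟩
    -- If every facet of `K` through `z` contained `x`, then `z` would lie inside a segment of `K`
    -- starting at the interior point `x`, hence in `Ω`.
    by_contra! hcon
    have hxK := K.nodes_subset_carrier k hxn
    obtain ⟨w, hw, hseg⟩ := K.kind.exists_prolongation ((K.mem_carrier_iff z).1 hz)
      (w := K.coord x) hcon
    have h := K.map_mem_openSegment hseg
    rw [Cell.map_coord, Cell.map_coord] at h
    exact hzΩ (P.mem_of_mem_openSegment hK hx hxK (Cell.map_mem_carrier hw) h)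
  · exact ⟨0, K.isShape_zero k, fun h => absurd h hxn, fun _ _ _ => rfl, fun _ _ _ => rfl⟩

/-- The local functions of two cells agree at their common nodes, hence on the whole common face.
They therefore glue to a continuous function with zero boundary values. -/
theorem exists_basisFun (P : Mesh Ω) {k : ℕ} (hk : 1 ≤ k) {x : Space d} (hx : x ∈ P.nodeSet k) :
    ∃ φ ∈ P.space k, φ x = 1 ∧ ∀ y ∈ P.nodeSet k, y ≠ x → φ y = 0 := by
  classical
  choose! q hqs hq1 hq0 hqb using fun K hK => P.exists_local_lagrange hk hx.2 (K := K) hK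
  have hglue : ∀ K ∈ P.cells, ∀ K' ∈ P.cells, ∀ z ∈ K.carrier, z ∈ K'.carrier →
      q K z = q K' z := by
    intro K hK K' hK' z hz hz'
    refine Cell.shape_eq_on_inter (P.conforming K hK K' hK') (P.isExposed_left hK hK') hk
      (hqs K hK) (hqs K' hK') (fun y hy hy' => ?_) hz hz'
    have hyn := Cell.mem_nodes_of_mem_inter (P.conforming K hK K' hK') (P.isExposed_left hK hK')
      hk hy hy'
    by_cases hyx : y = x
    · subst hyx
      rw [hq1 K hK hy, hq1 K' hK' hyn]
    · rw [hq0 K hK y hy hyx, hq0 K' hK' y hyn hyx]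
  let φ : Space d → ℝ := fun z =>
    if h : ∃ K ∈ P.cells, z ∈ K.carrier then q h.choose z else 0
  have hφ : ∀ K ∈ P.cells, ∀ z ∈ K.carrier, φ z = q K z := by
    intro K hK z hz
    have h : ∃ K ∈ P.cells, z ∈ K.carrier := ⟨K, hK, hz⟩
    simp only [φ, dif_pos h]
    exact hglue _ h.choose_spec.1 K hK z h.choose_spec.2 hz
  have hshape : ∀ K ∈ P.cells, K.IsShape k φ := fun K hK => (hqs K hK).congr (hφ K hK)
  have hzero : ∀ z ∉ Ω, φ z = 0 := by
    intro z hz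
    by_cases h : ∃ K ∈ P.cells, z ∈ K.carrier
    · obtain ⟨K, hK, hzK⟩ := h
      rw [hφ K hK z hzK, hqb K hK z hzK hz]
    · simp only [φ, dif_neg h]
  have hcont : ContinuousOn φ (closure Ω) := by
    have hU : ⋃ K ∈ P.cells, K.carrier = ⋃ K : {K // K ∈ P.cells}, K.1.carrier := by
      ext z; simp
    rw [P.closure_eq, hU]
    refine LocallyFinite.continuousOn_iUnion (locallyFinite_of_finite _)
      (fun K => K.1.isCompact_carrier.isClosed) fun K => ?_
    obtain ⟨f, hf, hφf⟩ := (hshape K.1 K.2).exists_contDiff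
    exact hf.continuous.continuousOn.congr hφf
  refine ⟨φ, P.mem_space_iff.2 ⟨P.isLipZero_of_isShape hcont hshape hzero, hshape⟩, ?_, ?_⟩
  · obtain ⟨K, hK, hxK⟩ := mem_iUnion₂.1 hx.1
    rw [hφ K hK x (K.nodes_subset_carrier k hxK), hq1 K hK hxK]
  · intro y hy hyx
    obtain ⟨K, hK, hyK⟩ := mem_iUnion₂.1 hy.1
    rw [hφ K hK y (K.nodes_subset_carrier k hyK), hq0 K hK y hyK hyx]

theorem basisFun_spec (P : Mesh Ω) {k : ℕ} (hk : 1 ≤ k) {x : Space d} (hx : x ∈ P.nodeSet k) :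
    P.basisFun k x ∈ P.space k ∧ P.basisFun k x x = 1 ∧
      ∀ y ∈ P.nodeSet k, y ≠ x → P.basisFun k x y = 0 := by
  obtain ⟨φ, hφ⟩ := P.exists_basisFun hk hx
  exact Classical.epsilon_spec (p := fun φ : Space d → ℝ =>
    φ ∈ P.space k ∧ φ x = 1 ∧ ∀ y ∈ P.nodeSet k, y ≠ x → φ y = 0) ⟨φ, hφ⟩

/-- The values at the internal nodes determine a finite element function. -/
theorem eq_zero_of_nodes (P : Mesh Ω) {k : ℕ} (hk : 1 ≤ k) {v : Space d → ℝ} (hv : v ∈ P.space k)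
    (h : ∀ x ∈ P.nodeSet k, v x = 0) : v = 0 := by
  rw [mem_space_iff] at hv
  funext z
  by_cases hz : z ∈ Ω
  · obtain ⟨K, hK, hzK⟩ := P.exists_cell (subset_closure hz)
    -- Unisolvence of a single cell is the case `K' = K` of agreement on a common face.
    refine Cell.shape_eq_on_inter (P.conforming K hK K hK) (P.conforming K hK K hK) hk
      (hv.2 K hK) (K.isShape_zero k) (fun y hy _ => ?_) hzK hzK
    by_cases hyΩ : y ∈ Ω
    · exact h y ⟨mem_iUnion₂.2 ⟨K, hK, hy⟩, hyΩ⟩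
    · exact hv.1.2 y hyΩ
  · exact hv.1.2 z hz

end Mesh

/-! ### The interior penalty form -/

namespace Cell

variable {d : ℕ}

/-- One-sided gradients are thereby well defined, and linear in the function, on the boundary of a
cell, where the jumps are taken. -/
theorem uniqueDiffWithinAt (K : Cell d) {x : Space d} (hx : x ∈ K.carrier) :
    UniqueDiffWithinAt ℝ K.carrier x :=
  uniqueDiffOn_convex K.convex_carrier K.nonempty_interior_carrier x hx

namespace IsShape

variable {K : Cell d} {k : ℕ} {v w : Space d → ℝ}

theorem differentiableWithinAt (hv : K.IsShape k v) {x : Space d} (hx : x ∈ K.carrier) :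
    DifferentiableWithinAt ℝ v K.carrier x := by
  obtain ⟨f, hf, hvf⟩ := hv.exists_contDiff
  exact ((hf.differentiable (by simp)) x).differentiableWithinAt.congr hvf (hvf x hx)

theorem gradientWithin_add (hv : K.IsShape k v) (hw : K.IsShape k w) {x : Space d}
    (hx : x ∈ K.carrier) : gradientWithin (v + w) K.carrier x
      = gradientWithin v K.carrier x + gradientWithin w K.carrier x := by
  simp only [gradientWithin, fderivWithin_add (K.uniqueDiffWithinAt hx)
    (hv.differentiableWithinAt hx) (hw.differentiableWithinAt hx), map_add]

theorem gradientWithin_smul (hv : K.IsShape k v) (c : ℝ) {x : Space d} (hx : x ∈ K.carrier) :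
    gradientWithin (c • v) K.carrier x = c • gradientWithin v K.carrier x := by
  simp only [gradientWithin, fderivWithin_const_smul (K.uniqueDiffWithinAt hx)
    (hv.differentiableWithinAt hx), map_smulₛₗ, conj_trivial]

theorem continuousOn_gradientWithin (hv : K.IsShape k v) :
    ContinuousOn (gradientWithin v K.carrier) K.carrier := by
  obtain ⟨f, hf, hvf⟩ := hv.exists_contDiff
  have hf1 : ContDiff ℝ 1 f := hf.of_le (by simp)
  have hc : Continuous (gradient f) :=
    (InnerProductSpace.toDual ℝ (Space d)).symm.continuous.comp
      (hf1.continuous_fderiv one_ne_zero)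
  refine hc.continuousOn.congr fun x hx => ?_
  simp only [gradientWithin, gradient]
  rw [fderivWithin_congr hvf (hvf x hx),
    (hf1.differentiable one_ne_zero x).fderivWithin (K.uniqueDiffWithinAt hx)]

end IsShape

end Cell

/-- Bounded sets of the right dimension have finite surface measure. -/
theorem surface_lt_top {d : ℕ} {F : Set (Space d)} (hF : Bornology.IsBounded F)
    (hd : Module.finrank ℝ (vectorSpan ℝ F) = d - 1) :
    (Measure.euclideanHausdorffMeasure (d - 1) : Measure (Space d)) F < ⊤ := by
  rcases F.eq_empty_or_nonempty with rfl | ⟨p, hp⟩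
  · simp
  -- Translation by `p` is an isometry under which `F` becomes a bounded set of a `(d -
  -- 1)`-dimensional Euclidean space, where the Hausdorff measure is the volume.
  let g : vectorSpan ℝ F → Space d := fun w => (w : Space d) + p
  have hg : Isometry g := Isometry.of_dist_eq fun x y => by
    simp only [g, dist_add_right]; rfl
  have hFg : F = g '' (g ⁻¹' F) := by
    rw [image_preimage_eq_of_subset]
    intro x hx
    exact ⟨⟨x -ᵥ p, vsub_mem_vectorSpan ℝ hx hp⟩, by simp [g]⟩
  have hb : Bornology.IsBounded (g ⁻¹' F) := hg.antilipschitz.isBounded_preimage hF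
  rw [hFg, hg.euclideanHausdorffMeasure_image, ← hd,
    InnerProductSpace.euclideanHausdorffMeasure_eq_volume]
  exact hb.measure_lt_top

namespace Mesh

variable {d : ℕ} {Ω : Set (Space d)}

theorem mem_facetPairs (P : Mesh Ω) {KK : Cell d × Cell d} (h : KK ∈ P.facetPairs) :
    KK.1 ∈ P.cells ∧ KK.2 ∈ P.cells ∧
      Module.finrank ℝ (vectorSpan ℝ (KK.1.carrier ∩ KK.2.carrier)) = d - 1 := by
  classical
  rw [facetPairs, Finset.mem_filter, Finset.mem_product] at h
  exact ⟨h.1.1, h.1.2, h.2.2⟩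

end Mesh

section Jump

variable {d : ℕ} {Ω : Set (Space d)} {k : ℕ} {K K' : Cell d} {v w u : Space d → ℝ}

theorem gradJump_add (hv : K.IsShape k v) (hw : K.IsShape k w) (hv' : K'.IsShape k v)
    (hw' : K'.IsShape k w) {x : Space d} (hx : x ∈ K.carrier ∩ K'.carrier) :
    gradJump K K' (v + w) x = gradJump K K' v x + gradJump K K' w x := by
  simp only [gradJump, hv.gradientWithin_add hw hx.1, hv'.gradientWithin_add hw' hx.2]
  abel

theorem gradJump_smul (hv : K.IsShape k v) (hv' : K'.IsShape k v) (c : ℝ) {x : Space d}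
    (hx : x ∈ K.carrier ∩ K'.carrier) : gradJump K K' (c • v) x = c • gradJump K K' v x := by
  simp only [gradJump, hv.gradientWithin_smul c hx.1, hv'.gradientWithin_smul c hx.2, smul_sub]

theorem continuousOn_gradJump (hv : K.IsShape k v) (hv' : K'.IsShape k v) :
    ContinuousOn (gradJump K K' v) (K.carrier ∩ K'.carrier) :=
  (hv.continuousOn_gradientWithin.mono inter_subset_left).sub
    (hv'.continuousOn_gradientWithin.mono inter_subset_right)

theorem measurableSet_inter (K K' : Cell d) : MeasurableSet (K.carrier ∩ K'.carrier) :=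
  (K.isCompact_carrier.inter K'.isCompact_carrier).measurableSet

theorem integrable_gradJump (hv : K.IsShape k v) (hv' : K'.IsShape k v) (hw : K.IsShape k w)
    (hw' : K'.IsShape k w)
    (hd : Module.finrank ℝ (vectorSpan ℝ (K.carrier ∩ K'.carrier)) = d - 1) (c : ℝ) :
    Integrable (fun x => c * inner ℝ (gradJump K K' v x) (gradJump K K' w x))
      (surface (K.carrier ∩ K'.carrier)) := by
  have hcomp := K.isCompact_carrier.inter K'.isCompact_carrier
  have hcont : ContinuousOn (fun x => inner ℝ (gradJump K K' v x) (gradJump K K' w x))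
      (K.carrier ∩ K'.carrier) :=
    (continuousOn_gradJump hv hv').inner (continuousOn_gradJump hw hw')
  obtain ⟨M, hM⟩ := hcomp.exists_bound_of_continuousOn hcont
  refine Integrable.const_mul ?_ c
  refine IntegrableOn.of_bound (surface_lt_top hcomp.isBounded hd)
    (hcont.aestronglyMeasurable (measurableSet_inter K K')) M ?_
  filter_upwards [ae_restrict_mem (measurableSet_inter K K')] with x hx using hM x hx

theorem cip_comm (P : Mesh Ω) (γ : ℝ) (b : Space d → Space d) (w v : Space d → ℝ) :
    cip P γ b w v = cip P γ b v w := by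
  unfold cip
  congr 2
  refine Finset.sum_congr rfl fun KK _ =>
    integral_congr_ae (Filter.Eventually.of_forall fun x => ?_)
  simp only [real_inner_comm]

theorem cip_add_right (P : Mesh Ω) (γ : ℝ) (b : Space d → Space d) (hu : u ∈ P.space k)
    (hv : v ∈ P.space k) (hw : w ∈ P.space k) :
    cip P γ b u (v + w) = cip P γ b u v + cip P γ b u w := by
  rw [Mesh.mem_space_iff] at hu hv hw
  unfold cip
  rw [← mul_add, ← mul_add, ← Finset.sum_add_distrib]
  congr 2
  refine Finset.sum_congr rfl fun KK hKK => ?_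
  obtain ⟨h1, h2, hd⟩ := P.mem_facetPairs hKK
  rw [← integral_add (integrable_gradJump (hu.2 _ h1) (hu.2 _ h2) (hv.2 _ h1) (hv.2 _ h2) hd _)
    (integrable_gradJump (hu.2 _ h1) (hu.2 _ h2) (hw.2 _ h1) (hw.2 _ h2) hd _)]
  refine setIntegral_congr_fun (measurableSet_inter _ _) fun x hx => ?_
  simp only [gradJump_add (hv.2 _ h1) (hw.2 _ h1) (hv.2 _ h2) (hw.2 _ h2) hx, inner_add_right,
    mul_add]

theorem cip_smul_right (P : Mesh Ω) (γ : ℝ) (b : Space d → Space d) (c : ℝ)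
    (hv : v ∈ P.space k) : cip P γ b u (c • v) = c * cip P γ b u v := by
  rw [Mesh.mem_space_iff] at hv
  unfold cip
  rw [mul_left_comm c, mul_left_comm c, Finset.mul_sum _ _ c]
  congr 2
  refine Finset.sum_congr rfl fun KK hKK => ?_
  obtain ⟨h1, h2, -⟩ := P.mem_facetPairs hKK
  rw [← integral_const_mul]
  refine setIntegral_congr_fun (measurableSet_inter _ _) fun x hx => ?_
  simp only [gradJump_smul (hv.2 _ h1) (hv.2 _ h2) c hx, inner_smul_right]
  ring

theorem cip_self_nonneg (P : Mesh Ω) {γ : ℝ} (hγ : 0 ≤ γ) (b : Space d → Space d)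
    (w : Space d → ℝ) : 0 ≤ cip P γ b w w := by
  refine mul_nonneg hγ (mul_nonneg (by norm_num) (Finset.sum_nonneg fun KK _ => ?_))
  exact integral_nonneg fun x => mul_nonneg (mul_nonneg ENNReal.toReal_nonneg (sq_nonneg _))
    real_inner_self_nonneg

end Jump

/-! ### The mesh function -/

namespace Cell

variable {d : ℕ}

theorem diam_pos (hd : 0 < d) (K : Cell d) : 0 < Metric.diam K.carrier := by
  have hne : K.map 0 ≠ K.map (Pi.single ⟨0, hd⟩ 1) := fun h => by
    have := congrArg K.coord h
    rw [coord_map, coord_map] at this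
    simpa using congrFun this ⟨0, hd⟩
  have h0 : (0 : Fin d → ℝ) ∈ K.kind.ref d := by
    cases K.kind
    · exact ⟨fun _ => le_rfl, by simp⟩
    · exact fun j => ⟨le_rfl, zero_le_one⟩
  have h1 : (Pi.single ⟨0, hd⟩ 1 : Fin d → ℝ) ∈ K.kind.ref d := by
    refine CellKind.vertices_subset_ref _ ?_
    cases K.kind
    · exact ⟨some ⟨0, hd⟩, rfl⟩
    · intro j
      by_cases hj : j = ⟨0, hd⟩
      · subst hj; simp
      · simp [hj]
  exact (dist_pos.2 hne).trans_le (Metric.dist_le_diam_of_mem K.isCompact_carrier.isBounded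
    (map_mem_carrier h0) (map_mem_carrier h1))

/-- Interpolation of positive vertex values is positive. -/
theorem vertexInterp_pos (K : Cell d) {H : Space d → ℝ}
    (hH : ∀ x ∈ K.carrier, 0 < H x) {y : Fin d → ℝ} (hy : y ∈ K.kind.ref d) :
    0 < K.vertexInterp H y := by
  have hmem : ∀ S : Finset (Fin d), K.kind = .parallelotope →
      K.origin + ∑ j ∈ S, K.edge j ∈ K.carrier := by
    intro S hK
    have hw : (fun j => if j ∈ S then (1 : ℝ) else 0) ∈ K.kind.ref d := by
      rw [hK]; intro j
      by_cases hj : j ∈ S <;> simp [hj]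
    have : K.map (fun j => if j ∈ S then (1 : ℝ) else 0) = K.origin + ∑ j ∈ S, K.edge j := by
      simp [map, ite_smul]
    rw [← this]
    exact map_mem_carrier hw
  have hmem0 : K.kind = .simplex → K.origin ∈ K.carrier := fun hK => by
    have : K.map 0 = K.origin := by simp [map]
    rw [← this]
    exact map_mem_carrier (by rw [hK]; exact ⟨fun _ => le_rfl, by simp⟩)
  have hmem1 : K.kind = .simplex → ∀ j, K.origin + K.edge j ∈ K.carrier := fun hK j => by
    have : K.map (Pi.single j 1) = K.origin + K.edge j := by
      simp [map, Pi.single_apply, ite_smul]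
    rw [← this]
    refine map_mem_carrier (CellKind.vertices_subset_ref _ ?_)
    rw [hK]
    exact ⟨some j, rfl⟩
  unfold vertexInterp
  cases hK : K.kind
  · rw [hK] at hy
    have h0 : 0 ≤ 1 - ∑ j, y j := sub_nonneg.2 hy.2
    have hs : ∀ j ∈ Finset.univ, 0 ≤ y j * H (K.origin + K.edge j) := fun j _ =>
      mul_nonneg (hy.1 j) (hH _ (hmem1 hK j)).le
    have hH0 := hH _ (hmem0 hK)
    rcases h0.eq_or_lt with h | h
    · have hne : ∑ j, y j ≠ 0 := by linarith
      obtain ⟨j, hj, hyj⟩ := Finset.exists_ne_zero_of_sum_ne_zero hne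
      refine add_pos_of_nonneg_of_pos (mul_nonneg h0 hH0.le)
        (Finset.sum_pos' hs ⟨j, hj, mul_pos (lt_of_le_of_ne (hy.1 j) hyj.symm)
          (hH _ (hmem1 hK j))⟩)
    · exact add_pos_of_pos_of_nonneg (mul_pos h hH0) (Finset.sum_nonneg hs)
  · rw [hK] at hy
    classical
    have hnn : ∀ S : Finset (Fin d), 0 ≤ (∏ j ∈ S, y j) * ∏ j ∈ Sᶜ, (1 - y j) := fun S =>
      mul_nonneg (Finset.prod_nonneg fun j _ => (hy j).1)
        (Finset.prod_nonneg fun j _ => sub_nonneg.2 (hy j).2)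
    -- The weights are the terms in the expansion of `∏ j, (y j + (1 - y j))`.
    have hsum : ∑ S : Finset (Fin d), (∏ j ∈ S, y j) * ∏ j ∈ Sᶜ, (1 - y j) = 1 := by
      have h := Fintype.prod_add y (fun j => 1 - y j)
      simp only [add_sub_cancel, Finset.prod_const_one] at h
      exact h.symm
    obtain ⟨S, hS, hne⟩ := Finset.exists_ne_zero_of_sum_ne_zero
      (hsum.trans_ne one_ne_zero)
    exact Finset.sum_pos' (fun S _ => mul_nonneg (hnn S) (hH _ (hmem S hK)).le)
      ⟨S, hS, mul_pos (lt_of_le_of_ne (hnn S) (Ne.symm hne)) (hH _ (hmem S hK))⟩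

end Cell

namespace Mesh

variable {d : ℕ} {Ω : Set (Space d)}

theorem meanDiam_pos (hd : 0 < d) (P : Mesh Ω) {K : Cell d} (hK : K ∈ P.cells) {x : Space d}
    (hx : x ∈ K.carrier) : 0 < P.meanDiam x := by
  classical
  have hne : (P.cellsAt x).Nonempty := ⟨K, by simp [cellsAt, hK, hx]⟩
  exact div_pos (Finset.sum_pos (fun K _ => K.diam_pos hd) hne)
    (by exact_mod_cast Finset.card_pos.2 hne)

/-- Whichever cell `epsilon` selects, the value interpolates positive mean diameters; agreement
between cells is not needed. -/
theorem meshFun_pos (hd : 0 < d) (P : Mesh Ω) {x : Space d} (hx : x ∈ closure Ω) :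
    0 < P.meshFun x := by
  obtain ⟨K, hK, y, hy, hyx⟩ := P.exists_cell hx
  obtain ⟨K', hK', y', hy', -, hr⟩ := Classical.epsilon_spec (p := fun r : ℝ =>
    ∃ K ∈ P.cells, ∃ y ∈ K.kind.ref d, K.map y = x ∧ r = K.vertexInterp P.meanDiam y)
    ⟨_, K, hK, y, hy, hyx, rfl⟩
  rw [meshFun, hr]
  exact K'.vertexInterp_pos (fun z hz => P.meanDiam_pos hd hK' hz) hy'

/-! ### Nodal coordinates -/

/-- The finite element function with given nodal values. -/
def nodal (P : Mesh Ω) (k : ℕ) [Fintype (P.nodeSet k)] : (P.nodeSet k → ℝ) →ₗ[ℝ] Space d → ℝ :=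
  Fintype.linearCombination ℝ fun x => P.basisFun k x

section Nodal

variable (P : Mesh Ω) {k : ℕ} [Fintype (P.nodeSet k)]

theorem nodal_apply (a : P.nodeSet k → ℝ) : P.nodal k a = ∑ x, a x • P.basisFun k x := by
  simp [nodal, Fintype.linearCombination_apply]

theorem nodal_mem (hk : 1 ≤ k) (a : P.nodeSet k → ℝ) : P.nodal k a ∈ P.space k := by
  rw [nodal_apply]
  exact (P.subspace k).sum_mem fun x _ =>
    (P.subspace k).smul_mem _ (P.basisFun_spec hk x.2).1

theorem nodal_at (hk : 1 ≤ k) (a : P.nodeSet k → ℝ) (x : P.nodeSet k) :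
    P.nodal k a x = a x := by
  rw [nodal_apply, Finset.sum_apply, Finset.sum_eq_single x]
  · simp [(P.basisFun_spec hk x.2).2.1]
  · intro y _ hyx
    have := (P.basisFun_spec hk y.2).2.2 x x.2 fun h => hyx (Subtype.ext h.symm)
    simp [this]
  · simp

theorem nodal_values (hk : 1 ≤ k) {v : Space d → ℝ} (hv : v ∈ P.space k) :
    P.nodal k (fun x => v x) = v := by
  rw [← sub_eq_zero]
  refine P.eq_zero_of_nodes hk ((P.subspace k).sub_mem (P.nodal_mem hk _) hv) fun x hx => ?_
  rw [Pi.sub_apply, P.nodal_at hk _ ⟨x, hx⟩, sub_self]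

theorem finsum_nodeSet (f : Space d → ℝ) : ∑ᶠ x ∈ P.nodeSet k, f x = ∑ x : P.nodeSet k, f x := by
  rw [← finsum_set_coe_eq_finsum_mem, finsum_eq_sum_of_fintype]

theorem constrained_eq (c : ℝ) (v : Space d → ℝ) :
    P.constrained k c v = P.nodal k fun x => clip c (v x) := by
  funext z
  rw [constrained, finsum_nodeSet P fun x => max 0 (min (v x) c) * P.basisFun k x z, nodal_apply,
    Finset.sum_apply]
  rfl

end Nodal

end Mesh

/-! ### The discrete problem -/

namespace Data

variable {d : ℕ} {Ω : Set (Space d)} (p : Data d) (P : Mesh Ω)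

theorem dt_pos (hT : 0 < p.T) (hN : 0 < p.N) : 0 < p.dt :=
  div_pos hT (by exact_mod_cast hN)

theorem time_mem (hT : 0 < p.T) (hN : 0 < p.N) {m : ℕ} (hm : m ≤ p.N) : p.time m ∈ Icc 0 p.T := by
  have hN' : (0 : ℝ) < p.N := by exact_mod_cast hN
  refine ⟨mul_nonneg (Nat.cast_nonneg _) (p.dt_pos hT hN).le, ?_⟩
  have hm' : (m : ℝ) ≤ p.N := by exact_mod_cast hm
  calc (m : ℝ) * (p.T / p.N) ≤ p.N * (p.T / p.N) := by gcongr
    _ = p.T := by field_simp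

/-- The bilinear form of one implicit time step. -/
def stepForm (n : ℕ) (w v : Space d → ℝ) : ℝ :=
  l2 Ω w v + p.dt * p.θ * p.aJ P (p.time n) w v

section StepForm

variable {p P} {n : ℕ} {u v w : Space d → ℝ}

theorem stepForm_add_right (hβ : ContinuousOn (p.β (p.time n)) (closure Ω))
    (hu : u ∈ p.V P) (hv : v ∈ p.V P) (hw : w ∈ p.V P) :
    p.stepForm P n u (v + w) = p.stepForm P n u v + p.stepForm P n u w := by
  have lu := (P.mem_space_iff.1 hu).1
  have lv := (P.mem_space_iff.1 hv).1
  have lw := (P.mem_space_iff.1 hw).1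
  rw [stepForm, aJ, l2_add_right P.isBounded (lu.memLp P.isBounded 2) lv lw,
    gradForm_add_right P.isBounded lu lv lw,
    convForm_add_right P.isOpen P.isBounded hβ lu lv lw, cip_add_right P _ _ hu hv hw]
  simp only [stepForm, aJ]
  ring

theorem stepForm_smul_right (c : ℝ) (hv : v ∈ p.V P) :
    p.stepForm P n u (c • v) = c * p.stepForm P n u v := by
  have lv := (P.mem_space_iff.1 hv).1
  rw [stepForm, aJ, l2_smul_right, gradForm_smul_right lv, convForm_smul_right,
    cip_smul_right P _ _ c hv]
  simp only [stepForm, aJ]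
  ring

/-- All terms but convection are symmetric, so they follow from additivity on the right. -/
theorem stepForm_add_left (hβ : ContinuousOn (p.β (p.time n)) (closure Ω))
    (hu : u ∈ p.V P) (hv : v ∈ p.V P) (hw : w ∈ p.V P) :
    p.stepForm P n (v + w) u = p.stepForm P n v u + p.stepForm P n w u := by
  have lu := (P.mem_space_iff.1 hu).1
  have lv := (P.mem_space_iff.1 hv).1
  have lw := (P.mem_space_iff.1 hw).1
  rw [stepForm, aJ, l2_comm (v + w), gradForm_comm (v + w), cip_comm P _ _ (v + w),
    l2_add_right P.isBounded (lu.memLp P.isBounded 2) lv lw,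
    gradForm_add_right P.isBounded lu lv lw,
    convForm_add_left P.isOpen P.isBounded hβ lu lv lw, cip_add_right P _ _ hu hv hw,
    l2_comm u, l2_comm u, gradForm_comm u, gradForm_comm u, cip_comm P _ _ u, cip_comm P _ _ u]
  simp only [stepForm, aJ]
  ring

theorem stepForm_smul_left (c : ℝ) (hv : v ∈ p.V P) :
    p.stepForm P n (c • v) u = c * p.stepForm P n v u := by
  have lv := (P.mem_space_iff.1 hv).1
  rw [stepForm, aJ, l2_comm (c • v), gradForm_comm (c • v), cip_comm P _ _ (c • v),
    l2_smul_right, gradForm_smul_right lv, convForm_smul_left lv,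
    cip_smul_right P _ _ c hv, l2_comm u, gradForm_comm u, cip_comm P _ _ u]
  simp only [stepForm, aJ]
  ring

/-- Convection drops out on the diagonal, the mass term is strictly positive, and the remaining
terms are nonnegative. -/
theorem stepForm_self_pos (hε : 0 < p.ε) (hμ : 0 ≤ p.μ) (hγ : 0 ≤ p.γ) (hdt : 0 < p.dt)
    (hθ : 0 ≤ p.θ) (hβ : IsConvection Ω (p.β (p.time n))) (hw : w ∈ p.V P) (hw0 : w ≠ 0) :
    0 < p.stepForm P n w w := by
  have lw := (P.mem_space_iff.1 hw).1
  rw [stepForm, aJ, convForm_self P.isOpen P.isBounded hβ.1 hβ.2.2 lw]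
  refine add_pos_of_pos_of_nonneg (l2_self_pos P.isOpen P.isBounded lw hw0) ?_
  have h1 := gradForm_self_nonneg (Ω := Ω) w
  have h2 := l2_self_nonneg (Ω := Ω) w
  have h3 := cip_self_nonneg P hγ (p.β (p.time n)) w
  positivity

theorem plus_mem (hk : 1 ≤ p.k) (n : ℕ) (u : Space d → ℝ) : p.plus P n u ∈ p.V P := by
  have := (P.finite_nodeSet hk).fintype
  rw [plus, P.constrained_eq]
  exact P.nodal_mem hk _

theorem minus_mem (hk : 1 ≤ p.k) (n : ℕ) (hu : u ∈ p.V P) : p.minus P n u ∈ p.V P :=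
  (P.subspace p.k).sub_mem hu (plus_mem hk n u)

theorem plus_at (hk : 1 ≤ p.k) (n : ℕ) (u : Space d → ℝ) {x : Space d} (hx : x ∈ P.nodeSet p.k) :
    p.plus P n u x = clip (p.κ (p.time n)) (u x) := by
  have := (P.finite_nodeSet hk).fintype
  rw [plus, P.constrained_eq, P.nodal_at hk _ ⟨x, hx⟩]

theorem minus_at (hk : 1 ≤ p.k) (n : ℕ) (u : Space d → ℝ) {x : Space d} (hx : x ∈ P.nodeSet p.k) :
    p.minus P n u x = u x - clip (p.κ (p.time n)) (u x) := by
  have := plus_at (P := P) hk n u hx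
  rw [← this]; rfl

theorem F_add (hk : 1 ≤ p.k) (hβ : ContinuousOn (p.β (p.time (n - 1))) (closure Ω))
    (hf : MemLp (p.source n) 2 (volume.restrict Ω)) (hv : v ∈ p.V P) (hw : w ∈ p.V P) :
    p.F P n u (v + w) = p.F P n u v + p.F P n u w := by
  have hu := plus_mem (P := P) hk (n - 1) u
  have lu := (P.mem_space_iff.1 hu).1
  have lv := (P.mem_space_iff.1 hv).1
  have lw := (P.mem_space_iff.1 hw).1
  rw [F, l2_add_right P.isBounded hf lv lw, gradForm_add_right P.isBounded lu lv lw,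
    convForm_add_right P.isOpen P.isBounded hβ lu lv lw,
    l2_add_right P.isBounded (lu.memLp P.isBounded 2) lv lw, cip_add_right P _ _ hu hv hw]
  simp only [F]
  ring

theorem F_smul (c : ℝ) (hv : v ∈ p.V P) : p.F P n u (c • v) = c * p.F P n u v := by
  have lv := (P.mem_space_iff.1 hv).1
  rw [F, l2_smul_right, gradForm_smul_right lv, convForm_smul_right, l2_smul_right,
    cip_smul_right P _ _ c hv]
  simp only [F]
  ring

end StepForm

/-- The nodal weights of the stabilisation, including the time step. -/
def weight (n : ℕ) (x : Space d) : ℝ :=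
  p.dt * (p.α * (p.ε * P.meshFun x ^ (d - 2)
      + supNorm (volume.restrict (P.patch x)) (p.β (p.time n)) * P.meshFun x ^ (d - 1)
      + (1 / p.dt + p.μ) * P.meshFun x ^ d))

variable {p P} {n : ℕ}

theorem weight_pos (hd : 0 < d) (hε : 0 < p.ε) (hμ : 0 ≤ p.μ) (hα : 0 < p.α) (hdt : 0 < p.dt)
    {x : Space d} (hx : x ∈ Ω) : 0 < p.weight P n x := by
  have h1 := P.meshFun_pos hd (subset_closure hx)
  have h2 : 0 ≤ supNorm (volume.restrict (P.patch x)) (p.β (p.time n)) := ENNReal.toReal_nonneg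
  unfold weight
  positivity

theorem dt_mul_s [Fintype (P.nodeSet p.k)] (z v : Space d → ℝ) :
    p.dt * p.s P n z v = ∑ x : P.nodeSet p.k, p.weight P n x * z x * v x := by
  rw [s, P.finsum_nodeSet, Finset.mul_sum, Finset.mul_sum]
  refine Finset.sum_congr rfl fun x _ => ?_
  simp only [weight]
  ring

/-- The discrete problem in nodal coordinates. -/
theorem isSolution_iff [Fintype (P.nodeSet p.k)] (hk : 1 ≤ p.k) {u' u : Space d → ℝ}
    (hu : u ∈ p.V P) : p.IsSolution P n u' u ↔ ∀ a : P.nodeSet p.k → ℝ,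
      p.stepForm P n (P.nodal p.k fun x => clip (p.κ (p.time n)) (u x)) (P.nodal p.k a)
        + ∑ x : P.nodeSet p.k, p.weight P n x * (u x - clip (p.κ (p.time n)) (u x)) * a x
      = p.F P n u' (P.nodal p.k a) := by
  have key : ∀ v, l2 Ω (p.plus P n u) v + p.dt * p.θ * p.aJ P (p.time n) (p.plus P n u) v
      + p.dt * p.s P n (p.minus P n u) v
      = p.stepForm P n (P.nodal p.k fun x => clip (p.κ (p.time n)) (u x)) v
        + ∑ x : P.nodeSet p.k, p.weight P n x * (u x - clip (p.κ (p.time n)) (u x)) * v x := by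
    intro v
    rw [dt_mul_s, stepForm, plus, P.constrained_eq]
    congr 1
    exact Finset.sum_congr rfl fun x _ => by rw [minus_at hk n u x.2]
  constructor
  · rintro ⟨-, h⟩ a
    have e := h _ (P.nodal_mem hk a)
    rw [key] at e
    rw [← e]
    simp only [P.nodal_at hk]
  · refine fun h => ⟨hu, fun v hv => ?_⟩
    have e := h fun x => v x
    rw [P.nodal_values hk hv] at e
    rw [key, e]

end Data

end BPFEM

end

/-! ### The main theorem -/

open BPFEM in
theorem theorem14 {d : ℕ} (hd : d = 2 ∨ d = 3) {Ω : Set (Space d)} (P : Mesh Ω) (p : Data d)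
    (hε : 0 < p.ε) (hμ : 0 ≤ p.μ) (hγ : 0 ≤ p.γ) (hα : 0 < p.α) (hT : 0 < p.T) (hk : 1 ≤ p.k)
    (hθ : p.θ ∈ Set.Icc (1 / 2 : ℝ) 1)
    (hβ : ∀ t ∈ Set.Icc 0 p.T, IsConvection Ω (p.β t))
    (hf : ∀ t ∈ Set.Icc 0 p.T, MeasureTheory.MemLp (p.f t) 2 (MeasureTheory.volume.restrict Ω))
    (hκ : ∀ t ∈ Set.Icc 0 p.T, 0 < p.κ t)
    (n : ℕ) (hn : 1 ≤ n) (hnN : n ≤ p.N)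
    (u' : Space d → ℝ) (hu' : u' ∈ p.V P) :
    (∃ u, p.IsSolution P n u' u) ∧
    (∀ u, p.IsSolution P n u' u →
      (p.plus P n u ∈ p.Vplus P n ∧
        ∀ v ∈ p.Vplus P n,
          l2 Ω (p.plus P n u) (v - p.plus P n u)
            + p.dt * p.θ * p.aJ P (p.time n) (p.plus P n u) (v - p.plus P n u)
            ≥ p.F P n u' (v - p.plus P n u)) ∧
      p.minus P n u ∈ p.V P ∧
      ∀ z ∈ p.V P,
        (∀ v ∈ p.V P, p.dt * p.s P n z v
          = p.F P n u' v
            - (l2 Ω (p.plus P n u) v + p.dt * p.θ * p.aJ P (p.time n) (p.plus P n u) v)) ↔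
        z = p.minus P n u) ∧
    (∀ u₁ u₂, p.IsSolution P n u' u₁ → p.IsSolution P n u' u₂ → u₁ = u₂) := by
  have hd0 : 0 < d := by omega
  have hN : 0 < p.N := by omega
  have hdt := p.dt_pos hT hN
  have htn := p.time_mem hT hN hnN
  have htn' := p.time_mem hT hN (m := n - 1) (by omega)
  have hc := hκ _ htn
  have hsrc : MeasureTheory.MemLp (p.source n) 2 (MeasureTheory.volume.restrict Ω) :=
    ((hf _ htn).const_mul p.θ).add ((hf _ htn').const_mul (1 - p.θ))
  have := (P.finite_nodeSet hk).fintype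
  have hmem := P.nodal_mem hk
  have hD : ∀ x : P.nodeSet p.k, 0 < p.weight P n x := fun x =>
    Data.weight_pos hd0 hε hμ hα hdt x.2.2
  let B : (P.nodeSet p.k → ℝ) →ₗ[ℝ] (P.nodeSet p.k → ℝ) →ₗ[ℝ] ℝ :=
    LinearMap.mk₂ ℝ (fun a b => p.stepForm P n (P.nodal p.k a) (P.nodal p.k b))
      (fun a a' b => by
        rw [map_add]; exact Data.stepForm_add_left (hβ _ htn).1 (hmem b) (hmem a) (hmem a'))
      (fun c a b => by rw [map_smul]; exact Data.stepForm_smul_left c (hmem a))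
      (fun a b b' => by
        rw [map_add]; exact Data.stepForm_add_right (hβ _ htn).1 (hmem a) (hmem b) (hmem b'))
      (fun c a b => by rw [map_smul]; exact Data.stepForm_smul_right c (hmem b))
  -- Nodal values recover the coefficients, so a nonzero vector gives a nonzero function.
  have hB : ∀ a, a ≠ 0 → 0 < B a a := fun a ha =>
    Data.stepForm_self_pos hε hμ hγ hdt (by linarith [hθ.1]) (hβ _ htn) (hmem a) fun h0 =>
      ha (funext fun x => by rw [← P.nodal_at hk a x, h0]; rfl)
  let l : (P.nodeSet p.k → ℝ) →ₗ[ℝ] ℝ :=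
    { toFun := fun a => p.F P n u' (P.nodal p.k a)
      map_add' := fun a b => by
        rw [map_add]; exact Data.F_add hk (hβ _ htn').1 hsrc (hmem a) (hmem b)
      map_smul' := fun c a => by rw [map_smul]; exact Data.F_smul c (hmem a) }
  refine ⟨?_, fun u hu => ⟨⟨⟨Data.plus_mem hk n u, fun x hx => ?_⟩, fun v hv => ?_⟩,
    Data.minus_mem hk n hu.1, fun z hz => ⟨fun h => ?_, ?_⟩⟩, fun u₁ u₂ h₁ h₂ => ?_⟩
  · obtain ⟨a, ha⟩ := exists_box_solution B hB (fun x : P.nodeSet p.k => p.weight P n x) hD l hc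
    refine ⟨P.nodal p.k a, (Data.isSolution_iff hk (hmem a)).2 fun b => ?_⟩
    simp only [P.nodal_at hk]
    exact ha b
  · rw [Data.plus_at hk n u hx]
    exact clip_mem hc.le _
  · have e := hu.2 (v - p.plus P n u) ((P.subspace p.k).sub_mem hv.1 (Data.plus_mem hk n u))
    have hs : p.dt * p.s P n (p.minus P n u) (v - p.plus P n u) ≤ 0 := by
      rw [Data.dt_mul_s]
      refine Finset.sum_nonpos fun x _ => ?_
      rw [Data.minus_at hk n u x.2, Pi.sub_apply, Data.plus_at hk n u x.2, mul_assoc]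
      exact mul_nonpos_of_nonneg_of_nonpos (hD x).le (sub_clip_mul_le (hv.2 x x.2))
    linarith
  · rw [← sub_eq_zero]
    refine P.eq_zero_of_nodes hk ((P.subspace p.k).sub_mem hz (Data.minus_mem hk n hu.1))
      fun x hx => ?_
    classical
    -- Testing with the basis function at `x` isolates one diagonal entry of `s`, whose weight can
    -- be cancelled.
    have e₁ := h _ (hmem (Pi.single ⟨x, hx⟩ 1))
    have e₂ := hu.2 _ (hmem (Pi.single ⟨x, hx⟩ 1))
    have e : p.dt * p.s P n z (P.nodal p.k (Pi.single ⟨x, hx⟩ 1))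
        = p.dt * p.s P n (p.minus P n u) (P.nodal p.k (Pi.single ⟨x, hx⟩ 1)) := by linarith
    rw [Data.dt_mul_s, Data.dt_mul_s] at e
    simp only [P.nodal_at hk, Pi.single_apply, mul_ite, mul_one, mul_zero, Finset.sum_ite_eq',
      Finset.mem_univ, if_true] at e
    rw [Pi.sub_apply, sub_eq_zero]
    exact mul_left_cancel₀ (hD ⟨x, hx⟩).ne' e
  · rintro rfl v hv
    have e := hu.2 v hv
    linarith
  · have e := box_solution_unique B hB (fun x : P.nodeSet p.k => p.weight P n x) hD l
      (c := p.κ (p.time n))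
      ((Data.isSolution_iff hk h₁.1).1 h₁) ((Data.isSolution_iff hk h₂.1).1 h₂)
    rw [← P.nodal_values hk h₁.1, ← P.nodal_values hk h₂.1, e]
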